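/- Let $n\geq 1$ and $0\leq p\leq n-1$. Let $M^{2n}$ be a connected Kaehler manifold of real dimension $2n$, that is, a connected smooth manifold with a smooth Riemannian metric $\langle\,,\rangle$ and a smooth almost complex structure $J$ that is orthogonal and parallel with respect to the Levi-Civita connection. Let $\mathbb{L}^{N+1}$ be $\mathbb{R}^{N+1}$ with the Lorentzian inner product $-x_0y_0+x_1y_1+\cdots+x_Ny_N$, let $\mathbb{H}^{N}_{c}=\{x\in\mathbb{L}^{N+1}:\langle x,x\rangle=1/c,\ x_0>0\}$ for $c<0$, and let $\mathbb{S}^2_c=\{x\in\mathbb{R}^3:\|x\|^2=1/c\}$ for $c>0$. Let $f\colon M^{2n}\to\mathbb{H}^{2n+p}_{-1}$ be a smooth isometric immersion. Assume that at some point $x_0\in M^{2n}$ there is a $J$-invariant vector subspace $V\subset T_{x_0}M$ of real dimension $2m$ with $m\geq p$ such that the sectional curvature of $M^{2n}$ satisfies $K(S,JS)>0$ for every $0\neq S\in V$. Then $p=n-1$, and there are real numbers $c_1<0$ and $c_2,\dots,c_n>0$ with $\sum_{j=1}^n 1/c_j=-1$ such that, up to an isometry of the ambient hyperbolic space, $f(M)$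 is an open subset of the extrinsic product $$\mathbb{H}^2_{c_1}\times\mathbb{S}^2_{c_2}\times\cdots\times\mathbb{S}^2_{c_n}\subset\mathbb{H}^{3n-1}_{-1}\subset\mathbb{L}^{3n}=\mathbb{L}^3\times\mathbb{R}^3\times\cdots\times\mathbb{R}^3 .$$ More precisely, there is a linear isometry $\Phi\colon\mathbb{L}^3\times\mathbb{R}^3\times\cdots\times\mathbb{R}^3\to\mathbb{L}^{3n}$ that maps the hyperbolic space $\mathbb{H}^{3n-1}_{-1}$ of the first space onto that of the second and is such that $f(M)$ is a relatively open subset of $\Phi(\mathbb{H}^2_{c_1}\times\mathbb{S}^2_{c_2}\times\cdots\times\mathbb{S}^2_{c_n})$. -/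

import Mathlib

open scoped Manifold ContDiff

noncomputable section

namespace KaehlerHyperbolic

/-! ### Riemannian geometry in charts

`M` is a smooth manifold of dimension `d`, `g` a smooth Riemannian metric on `M` and `e` a chart of
`M`. The quantities below are those of `g` in the coordinates `e`; vectors of `ℝ^d` stand for the
constant vector fields on `e.target`. -/

section Charts

variable {d : ℕ} {M : Type*} [TopologicalSpace M] [ChartedSpace (EuclideanSpace ℝ (Fin d)) M]
  [IsManifold (𝓡 d) ∞ M]

/-- A smooth Riemannian metric on `M`. -/
abbrev RiemMetric (d : ℕ) (M : Type*) [TopologicalSpace M]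
    [ChartedSpace (EuclideanSpace ℝ (Fin d)) M] [IsManifold (𝓡 d) ∞ M] :=
  Bundle.ContMDiffRiemannianMetric (𝓡 d) ∞ (EuclideanSpace ℝ (Fin d))
    (fun x : M => TangentSpace (𝓡 d) x)

/-- The tangent vector at `e.symm y` whose coordinate vector in the chart `e` is `u`. -/
def ofCoord (e : OpenPartialHomeomorph M (EuclideanSpace ℝ (Fin d)))
    (y u : EuclideanSpace ℝ (Fin d)) : TangentSpace (𝓡 d) (e.symm y) :=
  mfderiv (𝓡 d) (𝓡 d) e.symm y u

/-- The coordinate vector in the chart `e` of a tangent vector at `x`. -/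
def toCoord (e : OpenPartialHomeomorph M (EuclideanSpace ℝ (Fin d)))
    (x : M) (v : TangentSpace (𝓡 d) x) : EuclideanSpace ℝ (Fin d) :=
  mfderiv (𝓡 d) (𝓡 d) e x v

/-- The metric in the chart `e`: `g_y(u, v)`. -/
def coordMetric (g : RiemMetric d M) (e : OpenPartialHomeomorph M (EuclideanSpace ℝ (Fin d)))
    (y u v : EuclideanSpace ℝ (Fin d)) : ℝ :=
  g.inner (e.symm y) (ofCoord e y u) (ofCoord e y v)

/-- The Gram matrix `(g_{ij}(y))` of the metric in the chart `e`. -/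
def gram (g : RiemMetric d M) (e : OpenPartialHomeomorph M (EuclideanSpace ℝ (Fin d)))
    (y : EuclideanSpace ℝ (Fin d)) : Matrix (Fin d) (Fin d) ℝ :=
  Matrix.of fun i j =>
    coordMetric g e y (EuclideanSpace.single i (1 : ℝ)) (EuclideanSpace.single j (1 : ℝ))

/-- Christoffel symbols of the first kind: `⟨∇_u v, w⟩` for constant vector fields `u, v, w`, that is
`(∂_u g(v, w) + ∂_v g(u, w) - ∂_w g(u, v)) / 2`. -/
def christoffelLower (g : RiemMetric d M)
    (e : OpenPartialHomeomorph M (EuclideanSpace ℝ (Fin d)))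
    (y u v w : EuclideanSpace ℝ (Fin d)) : ℝ :=
  (fderiv ℝ (fun z => coordMetric g e z v w) y u + fderiv ℝ (fun z => coordMetric g e z u w) y v
    - fderiv ℝ (fun z => coordMetric g e z u v) y w) / 2

/-- The Levi-Civita connection in the chart `e`: `Γ_y(u, v) = (∇_u v)(y)` for constant vector fields
`u, v`, with components `Γ^k = ∑_l g^{kl} ⟨∇_u v, ∂_l⟩`. -/
def christoffel (g : RiemMetric d M) (e : OpenPartialHomeomorph M (EuclideanSpace ℝ (Fin d)))
    (y u v : EuclideanSpace ℝ (Fin d)) : EuclideanSpace ℝ (Fin d) :=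
  WithLp.toLp 2 fun k =>
    ∑ l, (gram g e y)⁻¹ k l * christoffelLower g e y u v (EuclideanSpace.single l (1 : ℝ))

/-- The curvature tensor in the chart `e`:
`R(u, v) w = ∇_u ∇_v w - ∇_v ∇_u w` for constant vector fields `u, v, w`. -/
def coordCurvature (g : RiemMetric d M)
    (e : OpenPartialHomeomorph M (EuclideanSpace ℝ (Fin d)))
    (y u v w : EuclideanSpace ℝ (Fin d)) : EuclideanSpace ℝ (Fin d) :=
  (fderiv ℝ (fun z => christoffel g e z v w) y u + christoffel g e y u (christoffel g e y v w))
    - (fderiv ℝ (fun z => christoffel g e z u w) y v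
      + christoffel g e y v (christoffel g e y u w))

/-- The curvature `⟨R(u, v) w, z⟩` at `x`, computed in the preferred chart at `x`. -/
def curvature (g : RiemMetric d M) (x : M) (u v w z : TangentSpace (𝓡 d) x) : ℝ :=
  let e := chartAt (EuclideanSpace ℝ (Fin d)) x
  coordMetric g e (e x)
    (coordCurvature g e (e x) (toCoord e x u) (toCoord e x v) (toCoord e x w)) (toCoord e x z)

/-- The sectional curvature of the plane spanned by `u` and `v`:
`K(u, v) = ⟨R(u, v) v, u⟩ / (|u|² |v|² - ⟨u, v⟩²)`. -/
def sectionalCurvature (g : RiemMetric d M) (x : M) (u v : TangentSpace (𝓡 d) x) : ℝ :=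
  curvature g x u v v u / (g.inner x u u * g.inner x v v - g.inner x u v ^ 2)

/-- A field of endomorphisms of the tangent spaces, in the chart `e`. -/
def coordEndo (J : ∀ x : M, TangentSpace (𝓡 d) x →L[ℝ] TangentSpace (𝓡 d) x)
    (e : OpenPartialHomeomorph M (EuclideanSpace ℝ (Fin d)))
    (y u : EuclideanSpace ℝ (Fin d)) : EuclideanSpace ℝ (Fin d) :=
  toCoord e (e.symm y) (J (e.symm y) (ofCoord e y u))

/-- The covariant derivative `(∇_u J) v = ∇_u (J v) - J (∇_u v)` in the chart `e`. -/
def coordCovDeriv (g : RiemMetric d M)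
    (J : ∀ x : M, TangentSpace (𝓡 d) x →L[ℝ] TangentSpace (𝓡 d) x)
    (e : OpenPartialHomeomorph M (EuclideanSpace ℝ (Fin d)))
    (y u v : EuclideanSpace ℝ (Fin d)) : EuclideanSpace ℝ (Fin d) :=
  (fderiv ℝ (fun z => coordEndo J e z v) y u + christoffel g e y u (coordEndo J e y v))
    - coordEndo J e y (christoffel g e y u v)

/-- A Kaehler structure on `M`: a Riemannian metric together with a smooth almost complex structure
`J` that is orthogonal and parallel with respect to the Levi-Civita connection. -/
structure KaehlerStructure (d : ℕ) (M : Type*) [TopologicalSpace M]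
    [ChartedSpace (EuclideanSpace ℝ (Fin d)) M] [IsManifold (𝓡 d) ∞ M] where
  metric : RiemMetric d M
  J : ∀ x : M, TangentSpace (𝓡 d) x →L[ℝ] TangentSpace (𝓡 d) x
  contMDiff_J : ContMDiff (𝓡 d)
    ((𝓡 d).prod 𝓘(ℝ, EuclideanSpace ℝ (Fin d) →L[ℝ] EuclideanSpace ℝ (Fin d))) ∞
    (fun x : M => Bundle.TotalSpace.mk'
      (EuclideanSpace ℝ (Fin d) →L[ℝ] EuclideanSpace ℝ (Fin d))
      (E := fun x : M => TangentSpace (𝓡 d) x →L[ℝ] TangentSpace (𝓡 d) x) x (J x))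
  J_J : ∀ (x : M) (v : TangentSpace (𝓡 d) x), J x (J x v) = -v
  inner_J_J : ∀ (x : M) (v w : TangentSpace (𝓡 d) x),
    metric.inner x (J x v) (J x w) = metric.inner x v w
  parallel_J : ∀ e ∈ IsManifold.maximalAtlas (𝓡 d) ∞ M, ∀ y ∈ e.target, ∀ u v,
    coordCovDeriv metric J e y u v = 0

end Charts

/-! ### Lorentzian space and hyperbolic space -/

section Lorentz

variable {ι : Type*} [Fintype ι] [DecidableEq ι]

/-- The Lorentzian inner product on `ℝ^ι` whose time coordinate is `o`. -/
def lorentz (o : ι) (x y : ι → ℝ) : ℝ :=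
  ∑ i, (if i = o then -1 else 1) * (x i * y i)

/-- The hyperbolic space of curvature `c < 0` in the Lorentzian space `ℝ^ι`: the sheet `x_o > 0` of
the hyperboloid `⟨x, x⟩ = 1 / c`. -/
def hyperboloid (o : ι) (c : ℝ) : Set (ι → ℝ) :=
  {x | lorentz o x x = 1 / c ∧ 0 < x o}

/-- The hyperbolic space `ℍ^N_{-1} ⊂ 𝕃^{N+1}`. -/
abbrev HyperbolicSpace (N : ℕ) := hyperboloid (0 : Fin (N + 1)) (-1)

/-- The umbilical surface `ℍ²_c ⊂ 𝕃³`. -/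
def hyperbolicPlane (c : ℝ) : Set (Fin 3 → ℝ) := hyperboloid 0 c

/-- The umbilical surface `𝕊²_c ⊂ ℝ³`, the round sphere of curvature `c > 0` centred at `0`. -/
def roundSphere (c : ℝ) : Set (Fin 3 → ℝ) := {x | ∑ i, x i ^ 2 = 1 / c}

/-- The extrinsic product `ℍ²_{c_0} × 𝕊²_{c_1} × ⋯ × 𝕊²_{c_k}` in
`𝕃^{3(k+1)} = 𝕃³ × ℝ³ × ⋯ × ℝ³`; the coordinates of `𝕃^{3(k+1)}` are indexed by
`Fin (k + 1) × Fin 3` and the time coordinate is `(0, 0)`. -/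
def extrinsicProduct (k : ℕ) (c : Fin (k + 1) → ℝ) : Set (Fin (k + 1) × Fin 3 → ℝ) :=
  {x | (fun i => x (0, i)) ∈ hyperbolicPlane (c 0) ∧
    ∀ j, j ≠ 0 → (fun i => x (j, i)) ∈ roundSphere (c j)}

end Lorentz

/-- `f : M → ℍ^N_{-1}` is a (smooth) isometric immersion. -/
structure IsIsometricImmersion {d N : ℕ} {M : Type*} [TopologicalSpace M]
    [ChartedSpace (EuclideanSpace ℝ (Fin d)) M] [IsManifold (𝓡 d) ∞ M]
    (g : RiemMetric d M) (f : M → HyperbolicSpace N) : Prop where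
  contMDiff : ContMDiff (𝓡 d) 𝓘(ℝ, Fin (N + 1) → ℝ) ∞ (fun x => (f x : Fin (N + 1) → ℝ))
  isometric : ∀ (x : M) (u v : TangentSpace (𝓡 d) x),
    lorentz (0 : Fin (N + 1))
      (mfderiv (𝓡 d) 𝓘(ℝ, Fin (N + 1) → ℝ) (fun x => (f x : Fin (N + 1) → ℝ)) x u)
      (mfderiv (𝓡 d) 𝓘(ℝ, Fin (N + 1) → ℝ) (fun x => (f x : Fin (N + 1) → ℝ)) x v)
      = g.inner x u v

end KaehlerHyperbolic

end

open scoped Manifold ContDiff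

noncomputable section

namespace KaehlerHyperbolic

/-! ### Flat Hermitian forms -/

section FlatHermitian

open Module ComplexConjugate

variable {T W : Type*} [AddCommGroup T] [Module ℂ T] [FiniteDimensional ℂ T]
  [NormedAddCommGroup W] [NormedSpace ℂ W] [FiniteDimensional ℂ W]

/-! Regard `f` as an immersion `F` into Lorentzian space. Its second fundamental form `α` takes
values in a normal space of dimension `p + 1` that contains `F`, and `⟨α(u, v), F⟩ = -⟨u, v⟩`.
Because the curvature commutes with `J`, the Gauss equation turns into flatness of the (1,1)-part
`h` of the complexified `α`: the product `⟨h(X, Y), h(X', Y')⟩` does not change when `X` and `X'`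
are exchanged. Pairing with `F` shows that `h(X, X) ≠ 0` for `X ≠ 0`.

At `x₀`, positive curvature makes `h(S, S)` non-null for `S` in `V`. A maximal rank argument
(`IsFlatHermitian.exists_injOn`, `IsFlatHermitian.exists_injective`) then yields `Z` with `h(·, Z)`
injective, so `n ≤ p + 1` and therefore `n = p + 1`. The operators `h(·, Z)⁻¹ h(·, Y)` commute, and
their joint eigenvectors `X_i` diagonalize `h` (`IsFlatHermitian.exists_diagonal`). The (2,0)-part
of `α` is orthogonal to `F`, which forces it to vanish (`IsFlatHermitian.eq_zero_of_diagonal`).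
Hence `α(JX, JY) = α(X, Y)`, and the ambient space is the orthogonal sum of the 3-dimensional blocks
spanned by `α(X_i, X_i)`, `F_* X_i`, `F_* J X_i`.

Regularity of `Z` is an open condition, so `α` has type (1,1) near `x₀`, and the Codazzi equation
makes it parallel (`LocalKaehler.covSff_eq_zero`). The tangent projection, its derivative and the
extension of `J` by zero then solve a first order system, so their commutators with the block
projections satisfy a linear differential inequality and stay zero nearby
(`LocalKaehler.eventually_ad_eq_zero`); the norms of the block components of `F` stay constant. Away
from `x₀` nothing is known about the curvature, but a splitting at a point itself supplies a regular
vector there (`HyperbolicKaehler.exists_regular`). So the splitting can be restarted at limit points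
and holds on all of `M` (`splitsAt_of_eventually`).

The image thus lies in a product of quadrics in the blocks. Exactly one block is Lorentzian, since
`F` is timelike and two timelike vectors are never orthogonal. Equality of dimensions makes the
image open (`HyperbolicKaehler.eventually_mem_image`). -/

/-- `M Y X = h(X, Y)` is a flat Hermitian form on `T`, definite in the sense that `h(X, X) ≠ 0` for
`X ≠ 0`, with values in the space `W` with complex bilinear form `B` and conjugation `σ`. -/
structure IsFlatHermitian (B : LinearMap.BilinForm ℂ W) (σ : W →ₗ⋆[ℂ] W)
    (M : T →ₗ⋆[ℂ] T →ₗ[ℂ] W) : Prop where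
  symm : ∀ x y, B x y = B y x
  nondeg : B.Nondegenerate
  conj_eq : ∀ X Y, σ (M Y X) = M X Y
  flat : ∀ Y X Y' X', B (M Y X) (M Y' X') = B (M Y X') (M Y' X)
  self_ne_zero : ∀ X, X ≠ 0 → M X X ≠ 0

variable {B : LinearMap.BilinForm ℂ W} {σ : W →ₗ⋆[ℂ] W} {M : T →ₗ⋆[ℂ] T →ₗ[ℂ] W}

/-- Take `Z` in `V` for which `M Z` has maximal rank on `V`. A kernel vector `b` would give, by
flatness, `h(b, b)` orthogonal to the image `I` of `V`; being non-null it lies outside `I`, and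
moving `Z` slightly in the direction `b` would raise the rank. -/
theorem IsFlatHermitian.exists_injOn (H : IsFlatHermitian B σ M) (V : Submodule ℂ T)
    (hV : ∀ S ∈ V, S ≠ 0 → B (M S S) (M S S) ≠ 0) :
    ∃ Z ∈ V, ∀ X ∈ V, M Z X = 0 → X = 0 := by
  classical
  obtain ⟨Z, hZV, hmax⟩ : ∃ Z ∈ V, ∀ Z' ∈ V,
      finrank ℂ (V.map (M Z')) ≤ finrank ℂ (V.map (M Z)) := by
    have hne : ((fun Z => finrank ℂ (V.map (M Z))) '' (V : Set T)).Nonempty :=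
      ⟨_, 0, V.zero_mem, rfl⟩
    have hbdd : BddAbove ((fun Z => finrank ℂ (V.map (M Z))) '' (V : Set T)) := by
      refine ⟨finrank ℂ W, ?_⟩
      rintro _ ⟨Z, _, rfl⟩
      exact Submodule.finrank_le _
    obtain ⟨Z, hZ, hZe⟩ := Nat.sSup_mem hne hbdd
    refine ⟨Z, hZ, fun Z' hZ' => ?_⟩
    simp only at hZe
    rw [hZe]
    exact le_csSup hbdd ⟨Z', hZ', rfl⟩
  refine ⟨Z, hZV, ?_⟩
  by_contra! hcon
  obtain ⟨b, hbV, hZb, hb⟩ := hcon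
  set I := V.map (M Z) with hI
  set e := M b b with he
  have horth : ∀ ξ ∈ I, B e ξ = 0 := by
    rintro _ ⟨A, -, rfl⟩
    rw [he, H.flat, hZb]; simp
  have heI : e ∉ I := fun h => hV b hbV hb (horth e h)
  let bI := Module.finBasis ℂ I
  have hlift : ∀ i, ∃ A ∈ V, M Z A = (bI i : W) := fun i => (bI i).2
  choose A hAV hA using hlift
  -- For `t ≠ 0` all these vectors are values of `M (Z + t b)` on `V`: since `M Z b = 0`, the vector
  -- `e` is the value at `t⁻¹ b`. At `t = 0` they are `e` and a basis of `I`, and independence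
  -- persists for small `t`. A real `t` is unaffected by the conjugation in the first slot.
  let v : ℝ → Fin (finrank ℂ I + 1) → W := fun t => Fin.cons e fun i => M Z (A i) + (t : ℂ) • M b (A i)
  have hv0 : LinearIndependent ℂ (v 0) := by
    have h1 : LinearIndependent ℂ (fun i => (bI i : W)) :=
      bI.linearIndependent.map' I.subtype (Submodule.ker_subtype I)
    have h2 : v 0 = Fin.cons e (fun i => (bI i : W)) := by
      simp [v, hA]
    rw [h2, linearIndependent_finCons]
    refine ⟨h1, fun h => heI ?_⟩
    refine Submodule.span_le.2 ?_ h
    rintro _ ⟨i, rfl⟩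
    exact (bI i).2
  have hcont : Continuous v := by
    refine continuous_pi fun i => ?_
    refine Fin.cases ?_ (fun i => ?_) i
    · simpa [v] using continuous_const
    · simp only [v, Fin.cons_succ]; fun_prop
  have hev := hcont.continuousAt.eventually (LinearIndependent.eventually hv0)
  have hev' : ∀ᶠ t in nhdsWithin (0 : ℝ) {0}ᶜ, LinearIndependent ℂ (v t) :=
    hev.filter_mono nhdsWithin_le_nhds
  obtain ⟨t, htv, ht⟩ := (hev'.and self_mem_nhdsWithin).exists
  have ht0 : (t : ℂ) ≠ 0 := by exact_mod_cast ht
  have hMt : ∀ X, M (Z + (t : ℂ) • b) X = M Z X + (t : ℂ) • M b X := by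
    intro X
    rw [map_add, M.map_smulₛₗ, Complex.conj_ofReal, LinearMap.add_apply, LinearMap.smul_apply]
  have hmem : ∀ i, v t i ∈ V.map (M (Z + (t : ℂ) • b)) := by
    intro i
    refine Fin.cases ?_ (fun i => ?_) i
    · refine ⟨(t : ℂ)⁻¹ • b, V.smul_mem _ hbV, ?_⟩
      rw [hMt, map_smul, map_smul, hZb, smul_zero, zero_add, smul_smul, mul_inv_cancel₀ ht0, one_smul]
      rfl
    · exact ⟨A i, hAV i, hMt _⟩
  have hspan : finrank ℂ (Submodule.span ℂ (Set.range (v t)))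
      ≤ finrank ℂ (V.map (M (Z + (t : ℂ) • b))) := by
    refine Submodule.finrank_mono (Submodule.span_le.2 ?_)
    rintro _ ⟨i, rfl⟩
    exact hmem i
  rw [finrank_span_eq_card htv, Fintype.card_fin] at hspan
  have := hmax _ (V.add_mem hZV (V.smul_mem (t : ℂ) hbV))
  omega

/-- With `Z` injective on `V`, flatness places `h(b, Y)` in the orthogonal complement of `I` for
every `b` in the kernel of `M Z`. That complement is at most a line, so if the kernel is nonzero it
is spanned by `e = h(b, b)`, and `M b` is a functional times `e`. -/
theorem IsFlatHermitian.exists_injective (H : IsFlatHermitian B σ M) (V : Submodule ℂ T)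
    (hV : ∀ S ∈ V, S ≠ 0 → B (M S S) (M S S) ≠ 0)
    (hdim : finrank ℂ W ≤ finrank ℂ V + 1) :
    ∃ Z, Function.Injective (M Z) := by
  obtain ⟨Z, hZV, hZ⟩ := H.exists_injOn V hV
  by_cases hK : ∀ X, M Z X = 0 → X = 0
  · exact ⟨Z, (injective_iff_map_eq_zero _).2 hK⟩
  push Not at hK
  obtain ⟨b, hZb, hb⟩ := hK
  set I := V.map (M Z) with hI
  set e := M b b with he
  have he0 : e ≠ 0 := H.self_ne_zero b hb
  have hIrank : finrank ℂ I = finrank ℂ V :=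
    by
    have hinj : Function.Injective ((M Z).domRestrict V) := by
      refine (injective_iff_map_eq_zero _).2 fun x hx => ?_
      exact Subtype.ext (hZ x x.2 hx)
    rw [← LinearMap.finrank_range_of_inj hinj, LinearMap.range_domRestrict]
  have hRefl : B.IsRefl := fun x y h => by rw [H.symm]; exact h
  have hI' : finrank ℂ (B.orthogonal I) ≤ 1 := by
    rw [LinearMap.BilinForm.finrank_orthogonal H.nondeg]; omega
  have hker : ∀ X, M Z X = 0 → ∀ Y, M Y X ∈ B.orthogonal I := by
    rintro X hX Y _ ⟨A, -, rfl⟩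
    change B (M Z A) (M Y X) = 0
    rw [H.flat, hX]; simp
  have heI : e ∈ B.orthogonal I := hker b hZb b
  have hspan : ∀ ξ ∈ B.orthogonal I, ∃ c : ℂ, ξ = c • e := by
    intro ξ hξ
    have : finrank ℂ (B.orthogonal I) = 1 := by
      refine le_antisymm hI' (Nat.one_le_iff_ne_zero.2 fun h => he0 ?_)
      have := Submodule.finrank_eq_zero.1 h
      rw [this] at heI
      simpa using heI
    obtain ⟨c, hc⟩ := (finrank_eq_one_iff_of_nonzero' (⟨e, heI⟩ : B.orthogonal I)
      (by simpa using he0)).1 this ⟨ξ, hξ⟩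
    exact ⟨c, by simpa using (congrArg Subtype.val hc).symm⟩
  have hφ : ∀ Y, ∃ c : ℂ, M Y b = c • e := fun Y => hspan _ (hker b hZb Y)
  choose φ hφ using hφ
  have hσe : σ e = e := H.conj_eq b b
  have hφ' : ∀ Y, M b Y = conj (φ Y) • e := by
    intro Y
    rw [← H.conj_eq b Y, hφ, σ.map_smulₛₗ, hσe]
  have hBe : ∀ Y X, B e (M Y X) = conj (φ X) * φ Y * B e e := by
    intro Y X
    rw [he, H.flat, ← he, hφ, hφ']
    simp; ring
  -- If `e` is null then `e` lies in `I` itself, say `e = M Z S` with `S` in `V`, and flatness makes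
  -- `h(S, S)` a multiple of the null vector `e`, contrary to the assumption on `V`. If `e` is not
  -- null, adding `b` to `Z` removes the kernel.
  by_cases hee : B e e = 0
  · exfalso
    have : e ∈ I := by
      rw [← LinearMap.BilinForm.orthogonal_orthogonal H.nondeg hRefl I]
      intro ξ hξ
      obtain ⟨c, rfl⟩ := hspan ξ hξ
      change B (c • e) e = 0
      simp [hee]
    obtain ⟨S, hSV, hS⟩ := this
    have hS0 : S ≠ 0 := by
      rintro rfl
      exact he0 (by rw [← hS, map_zero])
    have hperp : M S S ∈ B.orthogonal I := by
      rintro _ ⟨A, -, rfl⟩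
      change B (M Z A) (M S S) = 0
      rw [H.flat, hS, hBe, hee, mul_zero]
    obtain ⟨c, hc⟩ := hspan _ hperp
    refine hV S hSV hS0 ?_
    rw [hc]; simp [hee]
  · refine ⟨Z + b, (injective_iff_map_eq_zero _).2 fun X hX => ?_⟩
    have hX' : M Z X + M b X = 0 := by simpa using hX
    have hφZ : φ Z = 0 := by
      have := hφ Z
      rw [hZb] at this
      exact (smul_eq_zero.1 this.symm).resolve_right he0
    have hφX : conj (φ X) = 0 := by
      have h1 := congrArg (B e) hX'
      rw [map_add, hBe, hφZ, hφ'] at h1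
      simpa [hee] using h1
    have hbX : M b X = 0 := by rw [hφ', hφX, zero_smul]
    have hZX : M Z X = 0 := by rwa [hbX, add_zero] at hX'
    obtain ⟨c, hc⟩ := hspan _ (hker X hZX X)
    have h2 := hBe X X
    rw [hφX, hc] at h2
    have hc0 : c = 0 := by simpa [hee] using h2
    by_contra hX0
    exact H.self_ne_zero X hX0 (by rw [hc, hc0, zero_smul])

/-- If some operator is not scalar on `S`, pass to one of its eigenspaces inside `S`; the other
operators preserve it because they commute. -/
theorem exists_joint_eigenvector {ι : Type*} (C : ι → Module.End ℂ T)
    (hC : ∀ i j, Commute (C i) (C j)) (S : Submodule ℂ T) (hS : S ≠ ⊥)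
    (hinv : ∀ i, ∀ x ∈ S, C i x ∈ S) :
    ∃ x ∈ S, x ≠ 0 ∧ ∀ i, ∃ μ : ℂ, C i x = μ • x := by
  induction hk : finrank ℂ S using Nat.strong_induction_on generalizing S with
  | _ k ih =>
    by_cases hsc : ∀ i, ∃ μ : ℂ, ∀ x ∈ S, C i x = μ • x
    · obtain ⟨x, hx, hx0⟩ := S.ne_bot_iff.1 hS
      exact ⟨x, hx, hx0, fun i => (hsc i).imp fun μ hμ => hμ x hx⟩
    push Not at hsc
    obtain ⟨i, hi⟩ := hsc
    have : Nontrivial S := Submodule.nontrivial_iff_ne_bot.2 hS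
    obtain ⟨μ, hμ⟩ := Module.End.exists_eigenvalue ((C i).restrict (hinv i))
    obtain ⟨v, hv⟩ := hμ.exists_hasEigenvector
    have hvC : C i v = μ • (v : T) := congrArg Subtype.val hv.apply_eq_smul
    set S' := S ⊓ Module.End.eigenspace (C i) μ with hS'
    have hlt : S' < S := by
      refine lt_of_le_of_ne inf_le_left fun h => ?_
      obtain ⟨x, hx, hx'⟩ := hi μ
      rw [← h] at hx
      exact hx' (Module.End.mem_eigenspace_iff.1 hx.2)
    have hv0 : (v : T) ≠ 0 := fun h => hv.2 (by simpa using h)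
    have hne : S' ≠ ⊥ := by
      intro h
      have : (v : T) ∈ S' := ⟨v.2, Module.End.mem_eigenspace_iff.2 hvC⟩
      rw [h] at this
      exact hv0 (by simpa using this)
    obtain ⟨x, hx, hx0, hxe⟩ := ih _ (hk ▸ Submodule.finrank_lt_finrank_of_lt hlt) S' hne (by
      intro j x hx
      refine ⟨hinv j x hx.1, Module.End.mem_eigenspace_iff.2 ?_⟩
      have h1 : C i (C j x) = C j (C i x) := congrArg (fun g : Module.End ℂ T => g x) (hC i j)
      rw [h1, Module.End.mem_eigenspace_iff.1 hx.2, map_smul]) rfl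
    exact ⟨x, hx.1, hx0, hxe⟩

/-- `X` is principal for `h` if `h(X, ·)` takes values in the line of `h(X, X)`. -/
def IsPrincipal (M : T →ₗ⋆[ℂ] T →ₗ[ℂ] W) (X : T) : Prop :=
  X ≠ 0 ∧ ∀ Y, ∃ c : ℂ, M Y X = c • M X X

theorem IsFlatHermitian.exists_coeff (H : IsFlatHermitian B σ M) {X : T} (hX : IsPrincipal M X) :
    ∃ φ : T → ℂ, (∀ Y, M Y X = φ Y • M X X) ∧ (∀ Y, M X Y = conj (φ Y) • M X X) ∧
      ∀ Y Y', B (M X X) (M Y Y') = conj (φ Y') * φ Y * B (M X X) (M X X) := by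
  choose φ hφ using hX.2
  have hφ' : ∀ Y, M X Y = conj (φ Y) • M X X := by
    intro Y
    rw [← H.conj_eq X Y, hφ, σ.map_smulₛₗ, H.conj_eq X X]
  refine ⟨φ, hφ, hφ', fun Y Y' => ?_⟩
  rw [H.flat, hφ Y, hφ' Y']
  simp; ring

/-- Equal dimensions make `M Z` invertible. Flatness says that the operators `C Y = (M Z)⁻¹ M Y` are
symmetric for the form transported by `M Z` and commute. A joint eigenvector is principal, and the
vectors `h(X, X)` of principal `X` are non-null because the form is nondegenerate. The induction
adds one eigenvector in the common kernel of the `M (X i)` found so far. -/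
theorem IsFlatHermitian.exists_diagonal (H : IsFlatHermitian B σ M) {Z : T}
    (hZ : Function.Injective (M Z)) (hdim : finrank ℂ W ≤ finrank ℂ T) (k : ℕ)
    (hk : k ≤ finrank ℂ T) :
    ∃ X : Fin k → T, (∀ i, IsPrincipal M (X i)) ∧ (∀ i j, i ≠ j → M (X i) (X j) = 0) ∧
      ∀ i, B (M (X i) (X i)) (M (X i) (X i)) ≠ 0 := by
  have hdimEq : finrank ℂ T = finrank ℂ W :=
    le_antisymm (LinearMap.finrank_le_finrank_of_injective hZ) hdim
  let mz : T ≃ₗ[ℂ] W := LinearEquiv.ofInjectiveOfFinrankEq (M Z) hZ hdimEq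
  have hmz : ∀ x, mz x = M Z x := fun x => rfl
  let C : T → Module.End ℂ T := fun Y => mz.symm.toLinearMap ∘ₗ M Y
  have hMC : ∀ Y X, M Z (C Y X) = M Y X := fun Y X => by
    rw [← hmz]; exact mz.apply_symm_apply _
  have hnd : ∀ ξ, (∀ X, B ξ (M Z X) = 0) → ξ = 0 := by
    intro ξ hξ
    refine H.nondeg.1 ξ fun η => ?_
    rw [← mz.apply_symm_apply η]; exact hξ _
  have hsymm : ∀ Y X X', B (M Z (C Y X)) (M Z X') = B (M Z X) (M Z (C Y X')) := by
    intro Y X X'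
    rw [hMC, hMC, H.flat, H.symm]
  have hcomm : ∀ Y Y', Commute (C Y) (C Y') := by
    intro Y Y'
    refine LinearMap.ext fun X => hZ (sub_eq_zero.1 (hnd _ fun X' => ?_))
    rw [map_sub, LinearMap.sub_apply, Module.End.mul_apply, Module.End.mul_apply, hMC, hMC, H.flat Y,
      ← hMC Y X', ← hMC Y' (C Y X), hsymm Y' (C Y X), H.symm, hMC, hMC, hMC, hMC, H.symm (M Y X),
      H.flat Y' X', sub_self]
  have hprinc_ne : ∀ X, IsPrincipal M X → B (M X X) (M X X) ≠ 0 := by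
    intro X hX h0
    obtain ⟨φ, -, -, h3⟩ := H.exists_coeff hX
    refine H.self_ne_zero X hX.1 (hnd _ fun X' => ?_)
    rw [h3, h0, mul_zero]
  induction k with
  | zero => exact ⟨Fin.elim0, fun i => i.elim0, fun i => i.elim0, fun i => i.elim0⟩
  | succ k ih =>
    obtain ⟨X, hX, hXo, hXn⟩ := ih (Nat.le_of_succ_le hk)
    let S : Submodule ℂ T := ⨅ i, LinearMap.ker (M (X i))
    have hSmem : ∀ Y, Y ∈ S ↔ ∀ i, M (X i) Y = 0 := by
      intro Y; simp [S, Submodule.mem_iInf]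
    have hS : S ≠ ⊥ := by
      let L : T →ₗ[ℂ] (Fin k → ℂ) := LinearMap.pi fun i => B (M (X i) (X i)) ∘ₗ M (X i)
      have hL : LinearMap.ker L ≠ ⊥ := by
        refine LinearMap.ker_ne_bot_of_finrank_lt ?_
        rw [Module.finrank_fin_fun]; omega
      obtain ⟨Y, hY, hY0⟩ := (Submodule.ne_bot_iff _).1 hL
      refine (Submodule.ne_bot_iff _).2 ⟨Y, (hSmem Y).2 fun i => ?_, hY0⟩
      obtain ⟨φ, h1, h2, h3⟩ := H.exists_coeff (hX i)
      have h4 : B (M (X i) (X i)) (M (X i) Y) = 0 := congrFun (LinearMap.mem_ker.1 hY) i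
      rw [h2 Y, map_smul, smul_eq_mul] at h4
      rw [h2 Y, (mul_eq_zero.1 h4).resolve_right (hXn i), zero_smul]
    -- For principal `X i`, the map `M (X i)` is the conjugate of `φ` times the non-null vector `h(X
    -- i, X i)`. Pairing this vector with `M Z (C Y x) = M Y x` shows that `φ` vanishes at `C Y x`
    -- if it does at `x`, because `φ Z ≠ 0` by injectivity of `M Z`.
    obtain ⟨x, hxS, hx0, hxe⟩ := exists_joint_eigenvector C hcomm S hS (by
      intro Y x hx
      rw [hSmem] at hx ⊢
      intro i
      obtain ⟨φ, h1, h2, h3⟩ := H.exists_coeff (hX i)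
      have hφx : conj (φ x) = 0 := by
        have := hx i
        rw [h2] at this
        exact (smul_eq_zero.1 this).resolve_right (H.self_ne_zero _ (hX i).1)
      have hφZ : φ Z ≠ 0 := by
        intro h0
        have := h1 Z
        rw [h0, zero_smul] at this
        exact (hX i).1 (hZ (by rw [this, map_zero]))
      have h4 := h3 Z (C Y x)
      rw [hMC, h3, hφx] at h4
      simp only [zero_mul, zero_eq_mul, mul_eq_zero, hXn i, or_false, hφZ] at h4
      rw [h2, h4, zero_smul])
    have hxp : IsPrincipal M x := by
      have hsm : ∀ Y, ∃ μ : ℂ, M Y x = μ • M Z x := by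
        intro Y
        obtain ⟨μ, hμ⟩ := hxe Y
        exact ⟨μ, by rw [← hMC, hμ, map_smul]⟩
      obtain ⟨ν, hν⟩ := hsm x
      have hν0 : ν ≠ 0 := by
        rintro rfl
        exact H.self_ne_zero x hx0 (by rw [hν, zero_smul])
      refine ⟨hx0, fun Y => ?_⟩
      obtain ⟨μ, hμ⟩ := hsm Y
      exact ⟨μ * ν⁻¹, by rw [hμ, hν, smul_smul, mul_assoc, inv_mul_cancel₀ hν0, mul_one]⟩
    have hxo : ∀ i, M (X i) x = 0 := (hSmem x).1 hxS
    refine ⟨Fin.cons x X, ?_, ?_, ?_⟩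
    · intro i
      refine Fin.cases ?_ (fun i => ?_) i
      · exact hxp
      · exact hX i
    · intro i j
      refine Fin.cases (Fin.cases (fun h => (h rfl).elim) (fun j _ => ?_) j)
        (fun i => Fin.cases (fun _ => ?_) (fun j hij => ?_) j) i
      · simp only [Fin.cons_zero, Fin.cons_succ]
        rw [← H.conj_eq, hxo, map_zero]
      · exact hxo i
      · exact hXo i j fun h => hij (by rw [h])
    · intro i
      refine Fin.cases ?_ (fun i => ?_) i
      · exact hprinc_ne x hxp
      · exact hXn i

theorem IsFlatHermitian.linearIndependent (H : IsFlatHermitian B σ M) {k : ℕ} {X : Fin k → T}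
    (hX : ∀ i, X i ≠ 0) (hXo : ∀ i j, i ≠ j → M (X i) (X j) = 0) : LinearIndependent ℂ X := by
  refine Fintype.linearIndependent_iff.2 fun c hc i => ?_
  have h := congrArg (M (X i)) hc
  rw [map_sum, map_zero, Finset.sum_eq_single i
    (fun j _ hj => by rw [map_smul, hXo i j hj.symm, smul_zero]) (by simp), map_smul] at h
  exact (smul_eq_zero.1 h).resolve_right (H.self_ne_zero _ (hX i))

/-- The `(2, 0)`-part that goes with a diagonal flat Hermitian form vanishes if it is orthogonal to a
vector to which no `h(X, X)` is orthogonal. -/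
theorem IsFlatHermitian.eq_zero_of_diagonal (H : IsFlatHermitian B σ M) {X : Fin (finrank ℂ T) → T}
    (hdim : finrank ℂ W = finrank ℂ T)
    (hX : ∀ i, X i ≠ 0) (hXo : ∀ i j, i ≠ j → M (X i) (X j) = 0)
    (hXn : ∀ i, B (M (X i) (X i)) (M (X i) (X i)) ≠ 0)
    (a : T →ₗ[ℂ] T →ₗ[ℂ] W) (ha : ∀ x y, a x y = a y x)
    (hflat : ∀ x y z z', B (a x y) (M z z') = B (a z' y) (M z x))
    (f : W) (haf : ∀ x y, B (a x y) f = 0) (hMf : ∀ i, B (M (X i) (X i)) f ≠ 0) : a = 0 := by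
  have hortho : ∀ i j, i ≠ j → B (M (X i) (X i)) (M (X j) (X j)) = 0 := by
    intro i j hij
    rw [H.flat, hXo i j hij, map_zero, LinearMap.zero_apply]
  have hWind : LinearIndependent ℂ (fun i => M (X i) (X i)) := by
    refine Fintype.linearIndependent_iff.2 fun c hc i => ?_
    have h := congrArg (B (M (X i) (X i))) hc
    rw [map_sum, map_zero, Finset.sum_eq_single i
      (fun j _ hj => by rw [map_smul, hortho i j hj.symm, smul_zero]) (by simp), map_smul] at h
    exact (smul_eq_zero.1 h).resolve_right (hXn i)
  let bW := basisOfLinearIndependentOfCardEqFinrank' _ hWind (by rw [Fintype.card_fin, hdim])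
  have hbW : ∀ i, bW i = M (X i) (X i) := fun i => by simp [bW]
  let bT := basisOfLinearIndependentOfCardEqFinrank' _ (H.linearIndependent hX hXo)
    (by rw [Fintype.card_fin])
  have hbT : ∀ i, bT i = X i := fun i => by simp [bT]
  have hnd : ∀ ξ, (∀ i, B ξ (M (X i) (X i)) = 0) → ξ = 0 := by
    intro ξ hξ
    refine H.nondeg.1 ξ fun η => ?_
    have : B ξ = 0 := bW.ext fun i => by rw [hbW, hξ]; rfl
    rw [this]; rfl
  -- Mixed flatness exchanges arguments and produces `h(X i, X j) = 0`. So `a (X i) y` is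
  -- proportional to `h(X i, X i)`: mixed values vanish by symmetry of `a`, and pairing with `f`
  -- kills the diagonal ones.
  have hperp : ∀ i j y, i ≠ j → B (a (X i) y) (M (X j) (X j)) = 0 := by
    intro i j y hij
    rw [hflat, hXo j i hij.symm, map_zero]
  refine bT.ext fun i => bT.ext fun j => ?_
  rw [hbT, hbT, LinearMap.zero_apply, LinearMap.zero_apply]
  by_cases hij : i = j
  · subst hij
    set c := B (a (X i) (X i)) (M (X i) (X i)) / B (M (X i) (X i)) (M (X i) (X i)) with hc
    have h1 : a (X i) (X i) = c • M (X i) (X i) := by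
      refine sub_eq_zero.1 (hnd _ fun k => ?_)
      by_cases hik : i = k
      · subst hik
        simp only [map_sub, map_smul, LinearMap.sub_apply, LinearMap.smul_apply, smul_eq_mul, hc]
        rw [div_mul_cancel₀ _ (hXn i), sub_self]
      · simp only [map_sub, map_smul, LinearMap.sub_apply, LinearMap.smul_apply, smul_eq_mul]
        rw [hperp i k _ hik, hortho i k hik, mul_zero, sub_zero]
    have h2 := haf (X i) (X i)
    rw [h1, map_smul, LinearMap.smul_apply, smul_eq_mul] at h2
    rw [h1, (mul_eq_zero.1 h2).resolve_right (hMf i), zero_smul]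
  · refine hnd _ fun k => ?_
    by_cases hik : i = k
    · subst hik
      rw [ha, hperp j i _ (Ne.symm hij)]
    · exact hperp i k _ hik

end FlatHermitian

/-! ### Second fundamental forms with the curvature of a Kaehler manifold -/

section KaehlerPoint

open Module

variable {E W : Type*} [AddCommGroup E] [Module ℝ E] [FiniteDimensional ℝ E]
  [AddCommGroup W] [Module ℝ W] [FiniteDimensional ℝ W]

/-- The complex vector space structure given by a complex structure `J`. -/
abbrev complexModule (J : E →ₗ[ℝ] E) (hJ : ∀ u, J (J u) = -u) : Module ℂ E where
  smul z u := z.re • u + z.im • J u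
  one_smul u := by
    change (1 : ℂ).re • u + (1 : ℂ).im • J u = u
    simp
  mul_smul z w u := by
    change (z * w).re • u + (z * w).im • J u
      = z.re • (w.re • u + w.im • J u) + z.im • J (w.re • u + w.im • J u)
    simp only [Complex.mul_re, Complex.mul_im, map_add, map_smul, hJ]
    module
  smul_zero z := by
    change z.re • (0 : E) + z.im • J 0 = 0
    simp
  smul_add z u v := by
    change z.re • (u + v) + z.im • J (u + v) = (z.re • u + z.im • J u) + (z.re • v + z.im • J v)
    rw [map_add]; module
  add_smul z w u := by
    change (z + w).re • u + (z + w).im • J u = (z.re • u + z.im • J u) + (w.re • u + w.im • J u)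
    simp only [Complex.add_re, Complex.add_im]; module
  zero_smul u := by
    change (0 : ℂ).re • u + (0 : ℂ).im • J u = 0
    simp

/-- A symmetric bilinear form `α` on a Hermitian vector space, with values in a Lorentzian vector space
that contains a unit timelike vector `f` with `⟨α, f⟩ = -g`, such that the algebraic curvature tensor
of `α` given by the Gauss equation is of Kaehler type. -/
structure KaehlerPoint (J : E →ₗ[ℝ] E) (g : E → E → ℝ) (b : W →ₗ[ℝ] W →ₗ[ℝ] ℝ)
    (α : E →ₗ[ℝ] E →ₗ[ℝ] W) (f : W) : Prop where
  J_J : ∀ u, J (J u) = -u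
  g_J : ∀ u v, g (J u) (J v) = g u v
  g_pos : ∀ u, u ≠ 0 → 0 < g u u
  b_symm : ∀ x y, b x y = b y x
  b_nondeg : ∀ x, (∀ y, b x y = 0) → x = 0
  α_symm : ∀ u v, α u v = α v u
  kaehler : ∀ u v w z, b (α u z) (α v w) - b (α u w) (α v z)
    = b (α u (J z)) (α v (J w)) - b (α u (J w)) (α v (J z))
  α_f : ∀ u v, b (α u v) f = -g u v
  nonneg : ∀ x, b x f = 0 → 0 ≤ b x x

variable {J : E →ₗ[ℝ] E} {g : E → E → ℝ} {b : W →ₗ[ℝ] W →ₗ[ℝ] ℝ}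
  {α : E →ₗ[ℝ] E →ₗ[ℝ] W} {f : W}

/-- The complexification map `W → W ⊗ ℂ` in terms of a basis of `W`. -/
def complexify (W : Type*) [AddCommGroup W] [Module ℝ W] [FiniteDimensional ℝ W] :
    W →ₗ[ℝ] (Fin (finrank ℝ W) → ℂ) where
  toFun w k := ((finBasis ℝ W).repr w k : ℝ)
  map_add' x y := by ext k; simp
  map_smul' c x := by ext k; simp

/-- The complex bilinear extension of a bilinear form on `W`. -/
def complexForm (b : W →ₗ[ℝ] W →ₗ[ℝ] ℝ) : LinearMap.BilinForm ℂ (Fin (finrank ℝ W) → ℂ) :=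
  Matrix.toBilin' (Matrix.of fun k l => ((b (finBasis ℝ W k) (finBasis ℝ W l) : ℝ) : ℂ))

theorem complexForm_apply (b : W →ₗ[ℝ] W →ₗ[ℝ] ℝ) (x y : Fin (finrank ℝ W) → ℂ) :
    complexForm b x y
      = ∑ k, ∑ l, x k * ((b (finBasis ℝ W k) (finBasis ℝ W l) : ℝ) : ℂ) * y l := by
  simp [complexForm, Matrix.toBilin'_apply]

theorem complexForm_complexify (b : W →ₗ[ℝ] W →ₗ[ℝ] ℝ) (x y : W) :
    complexForm b (complexify W x) (complexify W y) = (b x y : ℝ) := by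
  rw [complexForm_apply]
  conv_rhs => rw [← (finBasis ℝ W).sum_repr x, ← (finBasis ℝ W).sum_repr y]
  simp only [complexify, LinearMap.coe_mk, AddHom.coe_mk, map_sum, map_smul, LinearMap.sum_apply,
    LinearMap.smul_apply, smul_eq_mul]
  push_cast
  simp only [Finset.mul_sum]
  rw [Finset.sum_comm]
  refine Finset.sum_congr rfl fun k _ => ?_
  refine Finset.sum_congr rfl fun l _ => ?_
  ring

theorem complexForm_add_I_smul (b : W →ₗ[ℝ] W →ₗ[ℝ] ℝ) (x y x' y' : W) :
    complexForm b (complexify W x + Complex.I • complexify W y)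
      (complexify W x' + Complex.I • complexify W y')
      = ((b x x' - b y y' : ℝ) : ℂ) + Complex.I * ((b x y' + b y x' : ℝ) : ℂ) := by
  simp only [map_add, map_smul, LinearMap.add_apply, LinearMap.smul_apply, complexForm_complexify,
    smul_eq_mul]
  push_cast
  linear_combination ((b y y' : ℝ) : ℂ) * Complex.I_mul_I

theorem exists_complexify (ξ : Fin (finrank ℝ W) → ℂ) :
    ∃ x y : W, ξ = complexify W x + Complex.I • complexify W y := by
  refine ⟨∑ k, (ξ k).re • finBasis ℝ W k, ∑ k, (ξ k).im • finBasis ℝ W k, ?_⟩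
  ext k
  have h : ∀ c : Fin (finrank ℝ W) → ℝ,
      complexify W (∑ k, c k • finBasis ℝ W k) k = (c k : ℂ) := by
    intro c
    simp [complexify, Finsupp.single_apply, apply_ite]
  rw [Pi.add_apply, Pi.smul_apply, h, h, smul_eq_mul, mul_comm]
  exact (Complex.re_add_im _).symm

theorem complexify_injective : Function.Injective (complexify W) := by
  intro x y h
  refine (finBasis ℝ W).ext_elem fun k => ?_
  have := congrFun h k
  simpa [complexify] using this

theorem complexForm_nondegenerate (hs : ∀ x y, b x y = b y x)
    (hb : ∀ x, (∀ y, b x y = 0) → x = 0) : (complexForm b).Nondegenerate := by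
  have hsymm : ∀ x y, complexForm b x y = complexForm b y x := by
    intro x y
    rw [complexForm_apply, complexForm_apply, Finset.sum_comm]
    refine Finset.sum_congr rfl fun k _ => Finset.sum_congr rfl fun l _ => ?_
    rw [hs]; ring
  have hl : ∀ ξ, (∀ η, complexForm b ξ η = 0) → ξ = 0 := by
    intro ξ hξ
    obtain ⟨x, y, rfl⟩ := exists_complexify ξ
    have h : ∀ w, b x w = 0 ∧ b y w = 0 := by
      intro w
      have h1 := hξ (complexify W w + Complex.I • complexify W 0)
      rw [complexForm_add_I_smul] at h1
      have h2 := congrArg Complex.re h1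
      have h3 := congrArg Complex.im h1
      simpa using And.intro h2 h3
    rw [hb x fun w => (h w).1, hb y fun w => (h w).2]; simp
  refine ⟨hl, fun ξ hξ => hl ξ fun η => ?_⟩
  rw [hsymm]; exact hξ η

namespace KaehlerPoint

/-- Pair symmetry of the algebraic curvature tensor moves `J` from the last two arguments to the
first two. -/
theorem kaehler' (H : KaehlerPoint J g b α f) (u v w z : E) :
    b (α u z) (α v w) - b (α u w) (α v z)
      = b (α (J u) z) (α (J v) w) - b (α (J u) w) (α (J v) z) := by
  have h := H.kaehler w z u v
  rw [H.b_symm (α w v), H.b_symm (α w (J v))] at h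
  simp only [H.α_symm w, H.α_symm z] at h
  linarith [h, H.b_symm (α u z) (α v w), H.b_symm (α v z) (α u w)]

/-- The `(1, 1)`-part of `α`: `h(X, Y)` as a function of `Y` and `X`. -/
def hermitianPart (H : KaehlerPoint J g b α f) :
    letI := complexModule J H.J_J
    E →ₗ⋆[ℂ] E →ₗ[ℂ] (Fin (finrank ℝ W) → ℂ) :=
  letI := complexModule J H.J_J
  LinearMap.mk₂'ₛₗ (starRingEnd ℂ) (RingHom.id ℂ)
    (fun Y X => complexify W (α X Y + α (J X) (J Y))
      + Complex.I • complexify W (α X (J Y) - α (J X) Y))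
    (by intro Y Y' X; simp only [map_add, map_sub]; module)
    (by
      intro z Y X
      have hz : z • Y = z.re • Y + z.im • J Y := rfl
      rw [hz]
      ext k
      apply Complex.ext <;> simp [H.J_J, complexify] <;> ring)
    (by
      intro Y X X'
      simp only [map_add, map_sub, LinearMap.add_apply]; module)
    (by
      intro z Y X
      have hz : z • X = z.re • X + z.im • J X := rfl
      rw [hz]
      ext k
      apply Complex.ext <;> simp [H.J_J, complexify] <;> ring)

/-- The `(2, 0)`-part of `α`. -/
def bilinearPart (H : KaehlerPoint J g b α f) :
    letI := complexModule J H.J_J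
    E →ₗ[ℂ] E →ₗ[ℂ] (Fin (finrank ℝ W) → ℂ) :=
  letI := complexModule J H.J_J
  LinearMap.mk₂ ℂ
    (fun X Y => complexify W (α X Y - α (J X) (J Y))
      + Complex.I • complexify W (-(α X (J Y) + α (J X) Y)))
    (by intro X X' Y; simp only [map_add, map_sub, map_neg, LinearMap.add_apply]; module)
    (by
      intro z X Y
      have hz : z • X = z.re • X + z.im • J X := rfl
      rw [hz]
      ext k
      apply Complex.ext <;> simp [H.J_J, complexify] <;> ring)
    (by
      intro X Y Y'
      simp only [map_add, map_sub, map_neg]; module)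
    (by
      intro z X Y
      have hz : z • Y = z.re • Y + z.im • J Y := rfl
      rw [hz]
      ext k
      apply Complex.ext <;> simp [H.J_J, complexify] <;> ring)

/-- Conjugation of `ℂ^k`. -/
def conjPi (k : ℕ) : (Fin k → ℂ) →ₗ⋆[ℂ] (Fin k → ℂ) where
  toFun ξ i := starRingEnd ℂ (ξ i)
  map_add' x y := by ext i; simp
  map_smul' c x := by ext i; simp

theorem hermitianPart_apply (H : KaehlerPoint J g b α f) (X Y : E) :
    letI := complexModule J H.J_J
    H.hermitianPart Y X = complexify W (α X Y + α (J X) (J Y))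
      + Complex.I • complexify W (α X (J Y) - α (J X) Y) := rfl

theorem bilinearPart_apply (H : KaehlerPoint J g b α f) (X Y : E) :
    letI := complexModule J H.J_J
    H.bilinearPart X Y = complexify W (α X Y - α (J X) (J Y))
      + Complex.I • complexify W (-(α X (J Y) + α (J X) Y)) := rfl

/-- Flatness is a combination of Kaehler identities for `X, X', Y, Y'` with `J` inserted.
Definiteness holds because the product of `h(X, X)` with `f` is `-2 g(X, X)`. -/
theorem isFlatHermitian (H : KaehlerPoint J g b α f) :
    letI := complexModule J H.J_J
    IsFlatHermitian (complexForm b) (conjPi (finrank ℝ W)) H.hermitianPart := by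
  letI := complexModule J H.J_J
  refine ⟨?_, complexForm_nondegenerate H.b_symm H.b_nondeg, ?_, ?_, ?_⟩
  · intro x y
    rw [complexForm_apply, complexForm_apply, Finset.sum_comm]
    refine Finset.sum_congr rfl fun k _ => Finset.sum_congr rfl fun l _ => ?_
    rw [H.b_symm]; ring
  · intro X Y
    rw [hermitianPart_apply, hermitianPart_apply, H.α_symm X Y, H.α_symm (J X) (J Y),
      H.α_symm X (J Y), H.α_symm (J X) Y]
    ext k
    apply Complex.ext <;> simp [conjPi, complexify]
  · intro Y X Y' X'
    rw [hermitianPart_apply, hermitianPart_apply, hermitianPart_apply, hermitianPart_apply,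
      complexForm_add_I_smul, complexForm_add_I_smul]
    -- `k1` to `k4` contain an even number of factors `J` and belong to the real part; `k5` to `k8`
    -- contain an odd number and belong to the imaginary part.
    have k1 := H.kaehler' X X' Y' Y
    have k2 := H.kaehler' X X' (J Y') (J Y)
    have k3 := H.kaehler' X (J X') (J Y') Y
    have k4 := H.kaehler' X (J X') Y' (J Y)
    have k5 := H.kaehler' X X' (J Y') Y
    have k6 := H.kaehler' X X' Y' (J Y)
    have k7 := H.kaehler' X (J X') Y' Y
    have k8 := H.kaehler' X (J X') (J Y') (J Y)
    simp only [H.J_J, map_neg, LinearMap.neg_apply] at k3 k4 k7 k8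
    have e1 : ∀ x y z w, b (α x y) (α z w) = b (α z w) (α x y) := fun x y z w => H.b_symm _ _
    refine congrArg₂ (fun s t : ℝ => (s : ℂ) + Complex.I * (t : ℂ)) ?_ ?_
    · simp only [map_add, map_sub, LinearMap.add_apply, LinearMap.sub_apply]
      rw [e1 X' Y X Y', e1 X' Y (J X) (J Y'), e1 (J X') (J Y) X Y', e1 (J X') (J Y) (J X) (J Y'),
        e1 X' (J Y) X (J Y'), e1 X' (J Y) (J X) Y', e1 (J X') Y X (J Y'), e1 (J X') Y (J X) Y']
      linarith
    · simp only [map_add, map_sub, LinearMap.add_apply, LinearMap.sub_apply]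
      rw [e1 X' Y X (J Y'), e1 X' Y (J X) Y', e1 (J X') (J Y) X (J Y'), e1 (J X') (J Y) (J X) Y',
        e1 X' (J Y) X Y', e1 X' (J Y) (J X) (J Y'), e1 (J X') Y X Y', e1 (J X') Y (J X) (J Y')]
      linarith
  · intro X hX h
    have h1 : complexForm b (H.hermitianPart X X)
        (complexify W f + Complex.I • complexify W 0) = 0 := by rw [h]; simp
    rw [hermitianPart_apply, complexForm_add_I_smul] at h1
    have h2 := congrArg Complex.re h1
    simp [H.α_f, H.g_J] at h2
    linarith [H.g_pos X hX]

/-- The same eight instances of the Kaehler identity couple the (2,0)-part to the (1,1)-part; this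
is what lets a diagonalization of `h` control the (2,0)-part. -/
theorem bilinearPart_flat (H : KaehlerPoint J g b α f) (X Y Y' X' : E) :
    letI := complexModule J H.J_J
    complexForm b (H.bilinearPart X Y) (H.hermitianPart Y' X')
      = complexForm b (H.bilinearPart X' Y) (H.hermitianPart Y' X) := by
  letI := complexModule J H.J_J
  rw [hermitianPart_apply, hermitianPart_apply, bilinearPart_apply, bilinearPart_apply,
    complexForm_add_I_smul, complexForm_add_I_smul]
  have k1 := H.kaehler' X X' Y' Y
  have k2 := H.kaehler' X X' (J Y') (J Y)
  have k3 := H.kaehler' X (J X') (J Y') Y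
  have k4 := H.kaehler' X (J X') Y' (J Y)
  have k5 := H.kaehler' X X' (J Y') Y
  have k6 := H.kaehler' X X' Y' (J Y)
  have k7 := H.kaehler' X (J X') Y' Y
  have k8 := H.kaehler' X (J X') (J Y') (J Y)
  simp only [H.J_J, map_neg, LinearMap.neg_apply] at k3 k4 k7 k8
  have e1 : ∀ x y z w, b (α x y) (α z w) = b (α z w) (α x y) := fun x y z w => H.b_symm _ _
  refine congrArg₂ (fun s t : ℝ => (s : ℂ) + Complex.I * (t : ℂ)) ?_ ?_
  · simp only [map_add, map_sub, map_neg, LinearMap.add_apply, LinearMap.sub_apply,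
      LinearMap.neg_apply]
    rw [e1 X' Y X Y', e1 X' Y (J X) (J Y'), e1 (J X') (J Y) X Y', e1 (J X') (J Y) (J X) (J Y'),
      e1 X' (J Y) X (J Y'), e1 X' (J Y) (J X) Y', e1 (J X') Y X (J Y'), e1 (J X') Y (J X) Y']
    linarith
  · simp only [map_add, map_sub, map_neg, LinearMap.add_apply, LinearMap.sub_apply,
      LinearMap.neg_apply]
    rw [e1 X' Y X (J Y'), e1 X' Y (J X) Y', e1 (J X') (J Y) X (J Y'), e1 (J X') (J Y) (J X) Y',
      e1 X' (J Y) X Y', e1 X' (J Y) (J X) (J Y'), e1 (J X') Y X Y', e1 (J X') Y (J X) (J Y')]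
    linarith

theorem finrank_eq (hJ : ∀ u, J (J u) = -u) :
    finrank ℝ E = 2 * (letI := complexModule J hJ; finrank ℂ E) := by
  letI := complexModule J hJ
  haveI : IsScalarTower ℝ ℂ E := ⟨fun r z u => by
    change (r • z).re • u + (r • z).im • J u = r • (z.re • u + z.im • J u)
    simp [smul_smul]⟩
  rw [← Module.finrank_mul_finrank ℝ ℂ E, Complex.finrank_real_complex]

theorem finiteDimensional (hJ : ∀ u, J (J u) = -u) :
    letI := complexModule J hJ
    FiniteDimensional ℂ E := by
  letI := complexModule J hJ
  haveI : IsScalarTower ℝ ℂ E := ⟨fun r z u => by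
    change (r • z).re • u + (r • z).im • J u = r • (z.re • u + z.im • J u)
    simp [smul_smul]⟩
  exact Module.Finite.right ℝ ℂ E

end KaehlerPoint

end KaehlerPoint

section KaehlerPoint

open Module

variable {E W : Type*} [AddCommGroup E] [Module ℝ E] [FiniteDimensional ℝ E]
  [AddCommGroup W] [Module ℝ W] [FiniteDimensional ℝ W]

variable {J : E →ₗ[ℝ] E} {g : E → E → ℝ} {b : W →ₗ[ℝ] W →ₗ[ℝ] ℝ}
  {α : E →ₗ[ℝ] E →ₗ[ℝ] W} {f : W}

/-- `Z` is regular for `α` if `h(·, Z)` is injective, `h` being the `(1, 1)`-part of `α`. -/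
def IsRegular (J : E →ₗ[ℝ] E) (α : E →ₗ[ℝ] E →ₗ[ℝ] W) (Z : E) : Prop :=
  ∀ u, α u Z + α (J u) (J Z) = 0 → α u (J Z) - α (J u) Z = 0 → u = 0

namespace KaehlerPoint

theorem hermitianPart_eq_zero_iff (H : KaehlerPoint J g b α f) (X Y : E) :
    letI := complexModule J H.J_J
    H.hermitianPart Y X = 0 ↔ α X Y + α (J X) (J Y) = 0 ∧ α X (J Y) - α (J X) Y = 0 := by
  rw [hermitianPart_apply]
  constructor
  · intro h
    constructor <;> refine complexify_injective ?_ <;> ext k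
    · have h1 := congrArg Complex.re (congrFun h k)
      simp [complexify] at h1 ⊢
      exact_mod_cast h1
    · have h1 := congrArg Complex.im (congrFun h k)
      simp [complexify] at h1 ⊢
      exact_mod_cast h1
  · rintro ⟨h1, h2⟩
    rw [h1, h2]; simp

/-- `J` is orthogonal with square `-1`, hence skew. The symmetry and linearity of `g` used here are
inherited from `α` through `α_f`. -/
theorem g_J_self (H : KaehlerPoint J g b α f) (u : E) : g u (J u) = 0 := by
  have h1 := H.g_J u (J u)
  have h2 := H.α_f (J u) (-u)
  rw [map_neg, map_neg, LinearMap.neg_apply, H.α_f] at h2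
  have h3 := H.α_f (J u) u
  rw [H.α_symm, H.α_f] at h3
  rw [H.J_J] at h1
  linarith

theorem hermitianPart_self_form (H : KaehlerPoint J g b α f) (X Y : E) :
    letI := complexModule J H.J_J
    complexForm b (H.hermitianPart X X) (H.hermitianPart Y Y)
      = ((b (α X X + α (J X) (J X)) (α Y Y + α (J Y) (J Y)) : ℝ) : ℂ) := by
  rw [hermitianPart_apply, hermitianPart_apply, complexForm_add_I_smul, H.α_symm X (J X),
    H.α_symm Y (J Y), sub_self, sub_self]
  simp

/-- The square of `α(S, S) + α(JS, JS)` is `4 ⟨α(S, S), α(JS, JS)⟩` plus the square of the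
difference. The difference and `α(S, JS)` are orthogonal to `f`, hence have nonnegative squares, so
the curvature hypothesis makes the total positive. Thus `h(S, S)` is non-null on `V`, and
`IsFlatHermitian.exists_injective` applies. -/
theorem exists_isRegular (H : KaehlerPoint J g b α f) (V : Submodule ℝ E)
    (hVJ : ∀ S ∈ V, J S ∈ V) {m : ℕ} (hVm : finrank ℝ V = 2 * m) (hm : finrank ℝ W ≤ m + 1)
    (hV : ∀ S ∈ V, S ≠ 0 → b (α S (J S)) (α S (J S)) < b (α S S) (α (J S) (J S))) :
    ∃ Z, IsRegular J α Z := by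
  let inst := complexModule J H.J_J
  have : FiniteDimensional ℂ E := finiteDimensional H.J_J
  let Vc : Submodule ℂ E :=
    { V with
      smul_mem' := fun z u hu => V.add_mem (V.smul_mem _ hu) (V.smul_mem _ (hVJ u hu)) }
  have hVc : finrank ℂ Vc = m := by
    let JV : V →ₗ[ℝ] V := J.restrict hVJ
    have hJV : ∀ u, JV (JV u) = -u := fun u => Subtype.ext (H.J_J u)
    have h1 := finrank_eq hJV
    have h2 : (letI := complexModule JV hJV; finrank ℂ V) = finrank ℂ Vc := rfl
    rw [h2] at h1
    omega
  obtain ⟨Z, hZ⟩ := H.isFlatHermitian.exists_injective Vc (by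
    intro S hS hS0
    rw [hermitianPart_self_form]
    have h1 := hV S hS hS0
    have h2 : 0 ≤ b (α S S - α (J S) (J S)) (α S S - α (J S) (J S)) := by
      refine H.nonneg _ ?_
      rw [map_sub, LinearMap.sub_apply, H.α_f, H.α_f, H.g_J, sub_self]
    have h3 : 0 ≤ b (α S (J S)) (α S (J S)) := by
      refine H.nonneg _ ?_
      rw [H.α_f, H.g_J_self, neg_zero]
    have h4 : 0 < b (α S S + α (J S) (J S)) (α S S + α (J S) (J S)) := by
      simp only [map_sub, map_add, LinearMap.sub_apply, LinearMap.add_apply] at h2 ⊢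
      rw [H.b_symm (α (J S) (J S)) (α S S)] at h2 ⊢
      linarith
    exact_mod_cast h4.ne') (by rw [hVc]; simpa using hm)
  refine ⟨Z, fun u h1 h2 => hZ ?_⟩
  rw [map_zero]
  exact (H.hermitianPart_eq_zero_iff u Z).2 ⟨h1, h2⟩

/-- Injectivity gives `dim_ℂ E ≤ dim W`, and with `hdim` equality. The (2,0)-part is orthogonal to
`f` since `g` is `J`-invariant, so it vanishes. Then `h(X, Y) = 2 (α(X, Y) + i α(X, JY))`, and a
diagonalization of `h` is one of `α`. -/
theorem exists_diagonal (H : KaehlerPoint J g b α f) {Z : E} (hZ : IsRegular J α Z)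
    (hdim : 2 * finrank ℝ W ≤ finrank ℝ E) :
    finrank ℝ E = 2 * finrank ℝ W ∧ (∀ u v, α (J u) (J v) = α u v) ∧
      ∃ X : Fin (finrank ℝ W) → E, (∀ i, X i ≠ 0) ∧
        (∀ i j, i ≠ j → α (X i) (X j) = 0 ∧ α (X i) (J (X j)) = 0) ∧
        (∀ i j, i ≠ j → b (α (X i) (X i)) (α (X j) (X j)) = 0) ∧
        ∀ i, b (α (X i) (X i)) (α (X i) (X i)) ≠ 0 := by
  let inst := complexModule J H.J_J
  have : FiniteDimensional ℂ E := finiteDimensional H.J_J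
  have hE : finrank ℝ E = 2 * finrank ℂ E := finrank_eq H.J_J
  have hW : finrank ℂ (Fin (finrank ℝ W) → ℂ) = finrank ℝ W := by simp
  have HF := H.isFlatHermitian
  have hinj : Function.Injective (H.hermitianPart Z) := by
    refine (injective_iff_map_eq_zero _).2 fun u hu => ?_
    obtain ⟨h1, h2⟩ := (H.hermitianPart_eq_zero_iff u Z).1 hu
    exact hZ u h1 h2
  have hdimEq : finrank ℂ E = finrank ℝ W := by
    have := LinearMap.finrank_le_finrank_of_injective hinj
    omega
  obtain ⟨X, hX, hXo, hXn⟩ := HF.exists_diagonal hinj (by omega) _ le_rfl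
  have ha : H.bilinearPart = 0 := by
    refine HF.eq_zero_of_diagonal (by omega) (fun i => (hX i).1) hXo hXn _ ?_
      (fun x y z z' => H.bilinearPart_flat x y z z')
      (complexify W f + Complex.I • complexify W 0) ?_ ?_
    · intro x y
      rw [bilinearPart_apply, bilinearPart_apply, H.α_symm x, H.α_symm (J x), H.α_symm x,
        H.α_symm (J x), add_comm (α (J y) x)]
    · intro x y
      rw [bilinearPart_apply, complexForm_add_I_smul]
      have h1 := H.g_J x (J y)
      rw [H.J_J] at h1
      have h2 := H.α_f (J x) (-y)
      rw [map_neg, map_neg, LinearMap.neg_apply, H.α_f] at h2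
      simp only [map_sub, map_neg, map_add, LinearMap.sub_apply, LinearMap.add_apply,
        LinearMap.neg_apply, H.α_f, H.g_J, map_zero]
      have h3 : -(-g x (J y) + -g (J x) y) = 0 := by linarith
      rw [h3]; simp
    · intro i
      rw [hermitianPart_apply, complexForm_add_I_smul]
      have h0 := H.g_pos (X i) (hX i).1
      intro h1
      have h2 := congrArg Complex.re h1
      simp [H.α_f, H.g_J] at h2
      linarith
  have hαJ : ∀ u v, α (J u) (J v) = α u v := by
    intro u v
    have h1 : complexify W (α u v - α (J u) (J v))
        + Complex.I • complexify W (-(α u (J v) + α (J u) v)) = 0 := by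
      rw [← H.bilinearPart_apply, ha]; rfl
    have h2 : α u v - α (J u) (J v) = 0 := by
      refine complexify_injective ?_
      ext k
      have h3 := congrArg Complex.re (congrFun h1 k)
      simp [complexify] at h3 ⊢
      exact_mod_cast h3
    exact (sub_eq_zero.1 h2).symm
  rw [hdimEq] at hE
  refine ⟨hE, hαJ, fun i => X (finCongr hdimEq.symm i), fun i => (hX _).1, ?_, ?_, ?_⟩
  · intro i j hij
    have h1 := hXo (finCongr hdimEq.symm j) (finCongr hdimEq.symm i)
      (fun h => hij ((finCongr hdimEq.symm).injective h).symm)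
    obtain ⟨h2, h3⟩ := (H.hermitianPart_eq_zero_iff _ _).1 h1
    rw [hαJ, ← two_smul ℝ] at h2
    rw [← hαJ (J _) _, H.J_J, map_neg, LinearMap.neg_apply, sub_neg_eq_add, ← two_smul ℝ] at h3
    exact ⟨by simpa using h2, by simpa using h3⟩
  · intro i j hij
    have h1 := HF.flat (X (finCongr hdimEq.symm i)) (X (finCongr hdimEq.symm i))
      (X (finCongr hdimEq.symm j)) (X (finCongr hdimEq.symm j))
    rw [hXo _ _ fun h => hij ((finCongr hdimEq.symm).injective h), hermitianPart_self_form,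
      hαJ, hαJ, map_zero, LinearMap.zero_apply] at h1
    have h2 := Complex.ofReal_eq_zero.1 h1
    simp only [map_add, LinearMap.add_apply] at h2
    linarith
  · intro i h0
    refine hXn (finCongr hdimEq.symm i) ?_
    rw [hermitianPart_self_form, hαJ, map_add, map_add, LinearMap.add_apply, h0]
    simp

end KaehlerPoint

end KaehlerPoint

/-! ### Immersions into pseudo-Euclidean spaces -/

section LocalImmersion

open Module ContinuousLinearMap Filter Topology

variable {E L : Type*} [NormedAddCommGroup E] [NormedSpace ℝ E] [FiniteDimensional ℝ E]
  [NormedAddCommGroup L] [NormedSpace ℝ L] [FiniteDimensional ℝ L]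

theorem fderiv_comp_clm_apply {X G₁ G₂ G₃ : Type*} [NormedAddCommGroup X] [NormedSpace ℝ X]
    [NormedAddCommGroup G₁] [NormedSpace ℝ G₁] [NormedAddCommGroup G₂] [NormedSpace ℝ G₂]
    [NormedAddCommGroup G₃] [NormedSpace ℝ G₃] {c : X → G₂ →L[ℝ] G₃} {d : X → G₁ →L[ℝ] G₂} {y : X}
    (hc : DifferentiableAt ℝ c y) (hd : DifferentiableAt ℝ d y) (u : X) :
    fderiv ℝ (fun z => (c z).comp (d z)) y u
      = (c y).comp (fderiv ℝ d y u) + (fderiv ℝ c y u).comp (d y) := by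
  rw [fderiv_clm_comp hc hd]; rfl

/-- The map `w ↦ ⟨w, A ·⟩`. -/
def dualMap (β : L →L[ℝ] L →L[ℝ] ℝ) (A : E →L[ℝ] L) : L →L[ℝ] (E →L[ℝ] ℝ) :=
  ((compL ℝ E L ℝ).flip A).comp β

/-- The tangential part of `w`, as a vector of `E`, if `A` is the differential of an immersion. -/
def tangentPart (β : L →L[ℝ] L →L[ℝ] ℝ) (A : E →L[ℝ] L) : L →L[ℝ] E :=
  ((dualMap β A).comp A).inverse.comp (dualMap β A)

/-- `F` is an immersion of `U` with positive definite induced metric. -/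
structure LocalImmersion (β : L →L[ℝ] L →L[ℝ] ℝ) (U : Set E) (F : E → L) : Prop where
  isOpen : IsOpen U
  symm : ∀ x y, β x y = β y x
  smooth : ContDiffOn ℝ ∞ F U
  pos : ∀ y ∈ U, ∀ u, u ≠ 0 → 0 < β (fderiv ℝ F y u) (fderiv ℝ F y u)

variable (β : L →L[ℝ] L →L[ℝ] ℝ) (F : E → L)

/-- The inverse of the differential of `F` on tangent vectors, zero on normal vectors. -/
def rho (y : E) : L →L[ℝ] E := tangentPart β (fderiv ℝ F y)

/-- The projection onto the tangent space. -/
def tau (y : E) : L →L[ℝ] L := (fderiv ℝ F y).comp (rho β F y)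

/-- The Levi-Civita connection of the induced metric. -/
def Gam (y u : E) : E →L[ℝ] E := (rho β F y).comp (fderiv ℝ (fderiv ℝ F) y u)

/-- The derivative of the tangent projection. -/
def dTau (y : E) : E →L[ℝ] L →L[ℝ] L := fderiv ℝ (tau β F) y

/-- The skew part of the flat connection with respect to tangent and normal spaces. -/
def skew (y u : E) : L →L[ℝ] L := dTau β F y u * (2 * tau β F y - 1)

/-- The second fundamental form. -/
def sff (y u v : E) : L := dTau β F y u (fderiv ℝ F y v)

variable {β F} {U : Set E}

theorem isInvertible_gram {A : E →L[ℝ] L} (hA : ∀ u, u ≠ 0 → 0 < β (A u) (A u)) :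
    ((dualMap β A).comp A).IsInvertible := by
  have hinj : Function.Injective ((dualMap β A).comp A : E →ₗ[ℝ] (E →L[ℝ] ℝ)) := by
    refine (injective_iff_map_eq_zero _).2 fun u hu => ?_
    by_contra h
    have h1 := hA u h
    have h2 : β (A u) (A u) = 0 := congrArg (fun φ : E →L[ℝ] ℝ => φ u) hu
    exact h1.ne' h2
  have hdim : finrank ℝ E = finrank ℝ (E →L[ℝ] ℝ) := by
    rw [← (LinearMap.toContinuousLinearMap (𝕜 := ℝ) (E := E) (F' := ℝ)).finrank_eq]
    exact (Subspace.dual_finrank_eq).symm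
  refine ⟨(LinearEquiv.ofInjectiveOfFinrankEq _ hinj hdim).toContinuousLinearEquiv, ?_⟩
  ext u v
  rfl

theorem tangentPart_comp {A : E →L[ℝ] L} (hA : ∀ u, u ≠ 0 → 0 < β (A u) (A u)) :
    (tangentPart β A).comp A = ContinuousLinearMap.id ℝ E := by
  rw [tangentPart, ContinuousLinearMap.comp_assoc, (isInvertible_gram hA).inverse_comp_self]

theorem beta_tangentPart {A : E →L[ℝ] L} (hA : ∀ u, u ≠ 0 → 0 < β (A u) (A u)) (w : L) (u : E) :
    β (A (tangentPart β A w)) (A u) = β w (A u) := by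
  have h := (isInvertible_gram hA).self_comp_inverse
  exact congrArg (fun φ : E →L[ℝ] ℝ => φ u)
    (congrArg (fun ψ : (E →L[ℝ] ℝ) →L[ℝ] (E →L[ℝ] ℝ) => ψ (dualMap β A w)) h)

namespace LocalImmersion

theorem contDiffOn_fderiv (H : LocalImmersion β U F) : ContDiffOn ℝ ∞ (fderiv ℝ F) U :=
  H.smooth.fderiv_of_isOpen H.isOpen (by simp)

theorem contDiffOn_rho (H : LocalImmersion β U F) : ContDiffOn ℝ ∞ (rho β F) U := by
  intro y hy
  refine ContDiffAt.contDiffWithinAt ?_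
  have hA : ContDiffAt ℝ ∞ (fderiv ℝ F) y := H.contDiffOn_fderiv.contDiffAt (H.isOpen.mem_nhds hy)
  have h1 : ContDiffAt ℝ ∞ (fun z => dualMap β (fderiv ℝ F z)) y := by
    unfold dualMap; fun_prop
  have h2 : ContDiffAt ℝ ∞ (fun z => (dualMap β (fderiv ℝ F z)).comp (fderiv ℝ F z)) y :=
    h1.clm_comp hA
  exact (((isInvertible_gram (H.pos y hy)).contDiffAt_map_inverse).comp y h2).clm_comp h1

theorem contDiffOn_tau (H : LocalImmersion β U F) : ContDiffOn ℝ ∞ (tau β F) U :=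
  H.contDiffOn_fderiv.clm_comp H.contDiffOn_rho

theorem contDiffOn_dTau (H : LocalImmersion β U F) : ContDiffOn ℝ ∞ (dTau β F) U :=
  H.contDiffOn_tau.fderiv_of_isOpen H.isOpen (by simp)

theorem differentiableAt (H : LocalImmersion β U F)
    {G : Type*} [NormedAddCommGroup G] [NormedSpace ℝ G] {φ : E → G}
    (hφ : ContDiffOn ℝ ∞ φ U) {y : E} (hy : y ∈ U) : DifferentiableAt ℝ φ y :=
  (hφ.contDiffAt (H.isOpen.mem_nhds hy)).differentiableAt (by simp)

theorem fderiv_fderiv_comm (H : LocalImmersion β U F)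
    {G : Type*} [NormedAddCommGroup G] [NormedSpace ℝ G] {φ : E → G}
    (hφ : ContDiffOn ℝ ∞ φ U) {y : E} (hy : y ∈ U) (u v : E) :
    fderiv ℝ (fderiv ℝ φ) y u v = fderiv ℝ (fderiv ℝ φ) y v u :=
  ((hφ.contDiffAt (H.isOpen.mem_nhds hy)).isSymmSndFDerivAt
    (by
      simp only [minSmoothness_of_isRCLikeNormedField]
      exact ENat.LEInfty.out)) u v

theorem fderiv_congr (H : LocalImmersion β U F)
    {G : Type*} [NormedAddCommGroup G] [NormedSpace ℝ G] {φ ψ : E → G}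
    (h : ∀ y ∈ U, φ y = ψ y) {y : E} (hy : y ∈ U) : fderiv ℝ φ y = fderiv ℝ ψ y :=
  Filter.EventuallyEq.fderiv_eq (Filter.eventuallyEq_of_mem (H.isOpen.mem_nhds hy) h)

theorem rho_comp (H : LocalImmersion β U F) {y : E} (hy : y ∈ U)
    : (rho β F y).comp (fderiv ℝ F y) = ContinuousLinearMap.id ℝ E :=
  tangentPart_comp (H.pos y hy)

theorem rho_apply (H : LocalImmersion β U F) {y : E} (hy : y ∈ U)
    (u : E) : rho β F y (fderiv ℝ F y u) = u :=
  congrArg (fun φ : E →L[ℝ] E => φ u) (H.rho_comp hy)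

theorem tau_comp (H : LocalImmersion β U F) {y : E} (hy : y ∈ U)
    : (tau β F y).comp (fderiv ℝ F y) = fderiv ℝ F y := by
  rw [tau, ContinuousLinearMap.comp_assoc, H.rho_comp hy, ContinuousLinearMap.comp_id]

theorem tau_apply (H : LocalImmersion β U F) {y : E} (hy : y ∈ U)
    (u : E) : tau β F y (fderiv ℝ F y u) = fderiv ℝ F y u :=
  congrArg (fun φ : E →L[ℝ] L => φ u) (H.tau_comp hy)

theorem rho_tau (H : LocalImmersion β U F) {y : E} (hy : y ∈ U)
    : (rho β F y).comp (tau β F y) = rho β F y := by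
  rw [tau, ← ContinuousLinearMap.comp_assoc, H.rho_comp hy, ContinuousLinearMap.id_comp]

theorem tau_mul_tau (H : LocalImmersion β U F) {y : E} (hy : y ∈ U)
    : tau β F y * tau β F y = tau β F y := by
  change (tau β F y).comp (tau β F y) = _
  conv_lhs => arg 2; rw [tau]
  rw [← ContinuousLinearMap.comp_assoc, H.tau_comp hy, tau]

theorem beta_tau (H : LocalImmersion β U F) {y : E} (hy : y ∈ U)
    (x z : L) : β (tau β F y x) z = β x (tau β F y z) := by
  have h : ∀ x z, β (tau β F y x) (tau β F y z) = β x (tau β F y z) := fun x z =>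
    beta_tangentPart (H.pos y hy) x (rho β F y z)
  rw [← h x z, H.symm _ (tau β F y z), h z x, H.symm]

/-- Differentiate `τ² = τ`. The identity says that the derivative of `τ` exchanges tangent and
normal vectors; it thereby contains both the second fundamental form and its adjoint. -/
theorem dTau_eq (H : LocalImmersion β U F) {y : E} (hy : y ∈ U)
    (u : E) : dTau β F y u = tau β F y * dTau β F y u + dTau β F y u * tau β F y := by
  have h1 := H.fderiv_congr (fun z hz => (H.tau_mul_tau hz).symm) hy
  have h2 := congrArg (fun φ : E →L[ℝ] (L →L[ℝ] L) => φ u) h1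
  exact h2.trans (fderiv_comp_clm_apply (H.differentiableAt H.contDiffOn_tau hy)
    (H.differentiableAt H.contDiffOn_tau hy) u)

theorem tau_dTau_tau (H : LocalImmersion β U F) {y : E} (hy : y ∈ U)
    (u : E) : tau β F y * dTau β F y u * tau β F y = 0 := by
  have h1 := H.dTau_eq hy u
  have h2 := congrArg (fun T => tau β F y * T * tau β F y) h1
  simp only [mul_add, add_mul] at h2
  have h3 : tau β F y * (tau β F y * dTau β F y u) * tau β F y
      = tau β F y * dTau β F y u * tau β F y := by
    rw [← mul_assoc (tau β F y), H.tau_mul_tau hy]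
  have h4 : tau β F y * (dTau β F y u * tau β F y) * tau β F y
      = tau β F y * dTau β F y u * tau β F y := by
    rw [mul_assoc, mul_assoc, H.tau_mul_tau hy, mul_assoc]
  rw [h3, h4] at h2
  simpa using h2

theorem dTau_anticomm (H : LocalImmersion β U F) {y : E} (hy : y ∈ U) (u : E) :
    (2 * tau β F y - 1) * dTau β F y u = -(dTau β F y u * (2 * tau β F y - 1)) := by
  have h := H.dTau_eq hy u
  linear_combination (norm := noncomm_ring) (-2) * h

theorem skew_comp (H : LocalImmersion β U F) {y : E} (hy : y ∈ U) (u : E) :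
    (skew β F y u).comp (fderiv ℝ F y) = (dTau β F y u).comp (fderiv ℝ F y) := by
  ext v
  change dTau β F y u ((2 * tau β F y - 1) (fderiv ℝ F y v)) = _
  have : (2 * tau β F y - 1) (fderiv ℝ F y v) = fderiv ℝ F y v := by
    rw [two_mul]
    change tau β F y (fderiv ℝ F y v) + tau β F y (fderiv ℝ F y v) - fderiv ℝ F y v = _
    rw [H.tau_apply hy]; abel
  rw [this]; rfl

/-- The Gauss formula, obtained by differentiating `τ ∘ dF = dF`. -/
theorem fderiv_fderiv_eq (H : LocalImmersion β U F) {y : E} (hy : y ∈ U)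
    (u : E) : fderiv ℝ (fderiv ℝ F) y u
    = (fderiv ℝ F y).comp (Gam β F y u) + (skew β F y u).comp (fderiv ℝ F y) := by
  have h1 := H.fderiv_congr (fun z hz => (H.tau_comp hz).symm) hy
  have h2 := congrArg (fun φ : E →L[ℝ] (E →L[ℝ] L) => φ u) h1
  rw [H.skew_comp hy]
  exact h2.trans (fderiv_comp_clm_apply (H.differentiableAt H.contDiffOn_tau hy)
    (H.differentiableAt H.contDiffOn_fderiv hy) u)

theorem skew_apply (H : LocalImmersion β U F) {y : E} (hy : y ∈ U)
    (u v : E) : skew β F y u (fderiv ℝ F y v) = sff β F y u v :=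
  congrArg (fun φ : E →L[ℝ] L => φ v) (H.skew_comp hy u)

theorem fderiv_fderiv_apply (H : LocalImmersion β U F) {y : E} (hy : y ∈ U)
    (u v : E) : fderiv ℝ (fderiv ℝ F) y u v
    = fderiv ℝ F y (Gam β F y u v) + sff β F y u v := by
  rw [H.fderiv_fderiv_eq hy, ← H.skew_apply hy]; rfl

theorem rho_skew (H : LocalImmersion β U F) {y : E} (hy : y ∈ U)
    (u : E) : (rho β F y).comp (skew β F y u) = -(rho β F y).comp (dTau β F y u) := by
  have h1 : tau β F y * skew β F y u = -(tau β F y * dTau β F y u) := by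
    rw [skew, mul_sub, mul_one, two_mul, mul_add, mul_sub, mul_add, ← mul_assoc,
      H.tau_dTau_tau hy]
    abel
  have h2 : ∀ T : L →L[ℝ] L, (rho β F y).comp (tau β F y * T) = (rho β F y).comp T := by
    intro T
    change (rho β F y).comp ((tau β F y).comp T) = _
    rw [← ContinuousLinearMap.comp_assoc, H.rho_tau hy]
  rw [← h2 (skew β F y u), h1, ContinuousLinearMap.comp_neg, h2]

/-- On tangent vectors, differentiate `ρ ∘ dF = 1`; on normal vectors, differentiate `ρ = ρ ∘ τ`. -/
theorem fderiv_rho (H : LocalImmersion β U F) {y : E} (hy : y ∈ U) (u : E) : fderiv ℝ (rho β F) y u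
    = -(Gam β F y u).comp (rho β F y) - (rho β F y).comp (skew β F y u) := by
  have hρ := H.differentiableAt H.contDiffOn_rho hy
  have h1 := congrArg (fun φ : E →L[ℝ] (E →L[ℝ] E) => φ u)
    (H.fderiv_congr (fun z hz => H.rho_comp hz) hy)
  have h1' := (fderiv_comp_clm_apply hρ (H.differentiableAt H.contDiffOn_fderiv hy) u).symm.trans h1
  rw [fderiv_fun_const] at h1'
  have h2 := congrArg (fun φ : E →L[ℝ] (L →L[ℝ] E) => φ u)
    (H.fderiv_congr (fun z hz => (H.rho_tau hz).symm) hy)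
  have h2' := h2.trans (fderiv_comp_clm_apply hρ (H.differentiableAt H.contDiffOn_tau hy) u)
  have h3 : (fderiv ℝ (rho β F) y u).comp (fderiv ℝ F y) = -Gam β F y u :=
    (neg_eq_of_add_eq_zero_right h1').symm
  rw [show fderiv ℝ (rho β F) y u = _ from h2', H.rho_skew hy, tau, ← ContinuousLinearMap.comp_assoc, h3]
  change (rho β F y).comp (dTau β F y u) + _ = _
  rw [ContinuousLinearMap.neg_comp]
  abel

theorem gam_comm (H : LocalImmersion β U F) {y : E} (hy : y ∈ U)
    (u v : E) : Gam β F y u v = Gam β F y v u := by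
  change rho β F y (fderiv ℝ (fderiv ℝ F) y u v) = rho β F y (fderiv ℝ (fderiv ℝ F) y v u)
  rw [H.fderiv_fderiv_comm H.smooth hy]

theorem sff_comm (H : LocalImmersion β U F) {y : E} (hy : y ∈ U)
    (u v : E) : sff β F y u v = sff β F y v u := by
  have h := H.fderiv_fderiv_comm H.smooth hy u v
  rw [H.fderiv_fderiv_apply hy, H.fderiv_fderiv_apply hy, H.gam_comm hy u v] at h
  exact add_left_cancel h

theorem beta_dTau (H : LocalImmersion β U F) {y : E} (hy : y ∈ U)
    (u : E) (x z : L) : β (dTau β F y u x) z = β x (dTau β F y u z) := by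
  have h1 := H.fderiv_congr (fun w hw => H.beta_tau hw x z) hy
  have hτ := H.differentiableAt H.contDiffOn_tau hy
  have h2 : HasFDerivAt (fun w => β (tau β F w x) z)
      ((β.flip z).comp ((dTau β F y).flip x)) y :=
    (β.flip z).hasFDerivAt.comp y (hτ.hasFDerivAt.clm_apply (hasFDerivAt_const x y) |>.congr_fderiv
      (by ext u; simp [dTau]))
  have h3 : HasFDerivAt (fun w => β x (tau β F w z))
      ((β x).comp ((dTau β F y).flip z)) y :=
    (β x).hasFDerivAt.comp y (hτ.hasFDerivAt.clm_apply (hasFDerivAt_const z y) |>.congr_fderiv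
      (by ext u; simp [dTau]))
  rw [h2.fderiv, h3.fderiv] at h1
  exact congrArg (fun φ : E →L[ℝ] ℝ => φ u) h1

theorem tau_sff (H : LocalImmersion β U F) {y : E} (hy : y ∈ U)
    (u v : E) : tau β F y (sff β F y u v) = 0 := by
  have h := congrArg (fun T : L →L[ℝ] L => T (fderiv ℝ F y v)) (H.tau_dTau_tau hy u)
  change tau β F y (dTau β F y u (tau β F y (fderiv ℝ F y v))) = 0 at h
  rwa [H.tau_apply hy] at h

theorem beta_sff (H : LocalImmersion β U F) {y : E} (hy : y ∈ U)
    (u v w : E) : β (sff β F y u v) (fderiv ℝ F y w) = 0 := by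
  rw [← H.tau_apply hy w, ← H.beta_tau hy, H.tau_sff hy, map_zero, ContinuousLinearMap.zero_apply]

end LocalImmersion

end LocalImmersion

/-! ### Kaehler immersions: curvature, Codazzi equation and parallel second fundamental form. -/

section LocalKaehler

open Module ContinuousLinearMap Filter Topology

variable {E L : Type*} [NormedAddCommGroup E] [NormedSpace ℝ E] [FiniteDimensional ℝ E]
  [NormedAddCommGroup L] [NormedSpace ℝ L] [FiniteDimensional ℝ L]

/-- `F` is an immersion of `U` whose induced metric is Kaehler with complex structure `J`. -/
structure LocalKaehler (β : L →L[ℝ] L →L[ℝ] ℝ) (U : Set E) (F : E → L) (J : E → E →L[ℝ] E) : Prop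
    extends LocalImmersion β U F where
  nondeg : ∀ x, (∀ z, β x z = 0) → x = 0
  smooth_J : ContDiffOn ℝ ∞ J U
  J_J : ∀ y ∈ U, ∀ u, J y (J y u) = -u
  orth : ∀ y ∈ U, ∀ u v,
    β (fderiv ℝ F y (J y u)) (fderiv ℝ F y (J y v)) = β (fderiv ℝ F y u) (fderiv ℝ F y v)
  parallel : ∀ y ∈ U, ∀ u,
    fderiv ℝ J y u = (J y).comp (Gam β F y u) - (Gam β F y u).comp (J y)

variable {β : L →L[ℝ] L →L[ℝ] ℝ} {F : E → L} {U : Set E} {J : E → E →L[ℝ] E}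

variable (β F J) in
/-- The complex structure on the tangent space, extended by zero to the normal space. -/
def Jhat (y : E) : L →L[ℝ] L := (fderiv ℝ F y).comp ((J y).comp (rho β F y))

theorem clm_mul_apply (S T : L →L[ℝ] L) (x : L) : (S * T) x = S (T x) := rfl

theorem LocalImmersion.sub_mul_self (H : LocalImmersion β U F) {y : E} (hy : y ∈ U) :
    (2 * tau β F y - 1) * (2 * tau β F y - 1) = 1 := by
  linear_combination (norm := noncomm_ring) 4 * H.tau_mul_tau hy

theorem LocalImmersion.skew_mul_skew (H : LocalImmersion β U F) {y : E} (hy : y ∈ U) (u v : E) :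
    skew β F y u * skew β F y v = -(dTau β F y u * dTau β F y v) := by
  rw [skew, skew, mul_assoc, ← mul_assoc (2 * tau β F y - 1), H.dTau_anticomm hy, neg_mul,
    mul_assoc, H.sub_mul_self hy, mul_one, mul_neg]

theorem LocalImmersion.fderiv_skew (H : LocalImmersion β U F) {y : E} (hy : y ∈ U) (u v : E) :
    fderiv ℝ (fun z => skew β F z v) y u
      = fderiv ℝ (dTau β F) y u v * (2 * tau β F y - 1) + dTau β F y v * (2 * dTau β F y u) := by
  have hB := H.differentiableAt H.contDiffOn_dTau hy
  have hτ := H.differentiableAt H.contDiffOn_tau hy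
  have h1 : HasFDerivAt (fun z => dTau β F z v) ((fderiv ℝ (dTau β F) y).flip v) y :=
    hB.hasFDerivAt.clm_apply (hasFDerivAt_const v y) |>.congr_fderiv (by ext; simp)
  have h2 : HasFDerivAt (fun z => 2 * tau β F z - 1) ((2 : ℝ) • dTau β F y) y := by
    have := (hτ.hasFDerivAt.const_smul (2 : ℝ)).sub_const (1 : L →L[ℝ] L)
    refine this.congr_of_eventuallyEq (Eventually.of_forall fun z => ?_)
    simp only [two_mul, two_smul, Pi.smul_apply]
  have h3 := fderiv_comp_clm_apply h1.differentiableAt h2.differentiableAt u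
  rw [h1.fderiv, h2.fderiv] at h3
  refine Eq.trans h3 ?_
  rw [add_comm]
  congr 1
  change dTau β F y v * ((2 : ℝ) • dTau β F y u) = _
  rw [two_smul, two_mul]

theorem LocalImmersion.contDiffOn_skew (H : LocalImmersion β U F) (v : E) :
    ContDiffOn ℝ ∞ (fun z => skew β F z v) U := by
  have h1 := H.contDiffOn_dTau
  have h2 := H.contDiffOn_tau
  unfold skew
  fun_prop

theorem LocalImmersion.fderiv_dTau_comm (H : LocalImmersion β U F) {y : E} (hy : y ∈ U) (u v : E) :
    fderiv ℝ (dTau β F) y u v = fderiv ℝ (dTau β F) y v u :=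
  H.fderiv_fderiv_comm H.contDiffOn_tau hy u v

/-- The failure of the second fundamental form to be parallel. -/
def covSff (β : L →L[ℝ] L →L[ℝ] ℝ) (F : E → L) (y u v : E) : L →L[ℝ] L :=
  fderiv ℝ (dTau β F) y u v - (skew β F y u * dTau β F y v - dTau β F y v * skew β F y u)
    - dTau β F y (Gam β F y u v)

/-- The Leibniz rule for the second fundamental form. -/
theorem LocalImmersion.fderiv_sff (H : LocalImmersion β U F) {y : E} (hy : y ∈ U)
    {φ ψ : E → E} (hφ : DifferentiableAt ℝ φ y) (hψ : DifferentiableAt ℝ ψ y) (u : E) :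
    fderiv ℝ (fun z => sff β F z (φ z) (ψ z)) y u
      = covSff β F y u (φ y) (fderiv ℝ F y (ψ y)) + skew β F y u (sff β F y (φ y) (ψ y))
        + sff β F y (fderiv ℝ φ y u + Gam β F y u (φ y)) (ψ y)
        + sff β F y (φ y) (fderiv ℝ ψ y u + Gam β F y u (ψ y)) := by
  have hB := H.differentiableAt H.contDiffOn_dTau hy
  have hA := H.differentiableAt H.contDiffOn_fderiv hy
  have h1 := (hB.hasFDerivAt.clm_apply hφ.hasFDerivAt).clm_apply
    (hA.hasFDerivAt.clm_apply hψ.hasFDerivAt)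
  have h2 := congrArg (fun T : E →L[ℝ] L => T u) h1.fderiv
  refine Eq.trans h2 ?_
  have h3 : fderiv ℝ (fderiv ℝ F) y u (ψ y) = fderiv ℝ F y (Gam β F y u (ψ y))
      + skew β F y u (fderiv ℝ F y (ψ y)) := by
    rw [H.fderiv_fderiv_apply hy, H.skew_apply hy]
  simp only [covSff, sff, ContinuousLinearMap.add_apply, ContinuousLinearMap.comp_apply,
    ContinuousLinearMap.flip_apply, ContinuousLinearMap.sub_apply, map_add, h3,
    clm_mul_apply]
  abel

/-- Codazzi: second derivatives of `τ` commute, and since the reflection `2τ - 1` anticommutes with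
`dτ`, the commutator correction is symmetric as well. Together with
`LocalImmersion.covSff_apply_comm` this makes `∇α` totally symmetric. -/
theorem LocalImmersion.covSff_comm (H : LocalImmersion β U F) {y : E} (hy : y ∈ U) (u v : E) :
    covSff β F y u v = covSff β F y v u := by
  rw [covSff, covSff, H.fderiv_dTau_comm hy u v, H.gam_comm hy u v]
  simp only [skew]
  have h1 := H.dTau_anticomm hy u
  have h2 := H.dTau_anticomm hy v
  linear_combination (norm := noncomm_ring)
    (-dTau β F y u) * h2 + dTau β F y v * h1

theorem LocalImmersion.covSff_apply_comm (H : LocalImmersion β U F) {y : E} (hy : y ∈ U)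
    (u v w : E) :
    covSff β F y u v (fderiv ℝ F y w) = covSff β F y u w (fderiv ℝ F y v) := by
  have h := congrArg (fun T : E →L[ℝ] L => T u)
    (H.fderiv_congr (fun z hz => H.sff_comm hz v w) hy)
  rw [H.fderiv_sff hy (differentiableAt_const v) (differentiableAt_const w),
    H.fderiv_sff hy (differentiableAt_const w) (differentiableAt_const v)] at h
  simp only [fderiv_fun_const, Pi.zero_apply, ContinuousLinearMap.zero_apply, zero_add] at h
  rw [H.sff_comm hy v w, H.sff_comm hy _ w, H.sff_comm hy v] at h
  linear_combination (norm := module) h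

theorem LocalImmersion.hasFDerivAt_dTau_apply (H : LocalImmersion β U F) {y : E} (hy : y ∈ U)
    (v : E) : HasFDerivAt (fun z => dTau β F z v) ((fderiv ℝ (dTau β F) y).flip v) y :=
  (H.differentiableAt H.contDiffOn_dTau hy).hasFDerivAt.clm_apply (hasFDerivAt_const v y)
    |>.congr_fderiv (by ext; simp)

theorem LocalImmersion.beta_fderiv_dTau (H : LocalImmersion β U F) {y : E} (hy : y ∈ U) (u v : E)
    (x z : L) : β (fderiv ℝ (dTau β F) y u v x) z = β x (fderiv ℝ (dTau β F) y u v z) := by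
  have h1 := H.fderiv_congr (fun w hw => H.beta_dTau hw v x z) hy
  have hB := H.hasFDerivAt_dTau_apply hy v
  have h2 : ∀ x, HasFDerivAt (fun w => dTau β F w v x)
      (((fderiv ℝ (dTau β F) y).flip v).flip x) y := fun x =>
    hB.clm_apply (hasFDerivAt_const x y) |>.congr_fderiv (by ext; simp)
  have h3 := (β.flip z).hasFDerivAt.comp y (h2 x)
  have h4 := (β x).hasFDerivAt.comp y (h2 z)
  exact congrArg (fun φ : E →L[ℝ] ℝ => φ u) (h3.fderiv.symm.trans (h1.trans h4.fderiv))

theorem LocalImmersion.beta_skew (H : LocalImmersion β U F) {y : E} (hy : y ∈ U) (u : E)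
    (x z : L) : β (skew β F y u x) z = -β x (skew β F y u z) := by
  have h1 : ∀ x z, β ((2 * tau β F y - 1) x) z = β x ((2 * tau β F y - 1) z) := by
    intro x z
    simp only [two_mul, ContinuousLinearMap.sub_apply, ContinuousLinearMap.add_apply, map_sub,
      map_add, H.beta_tau hy, ContinuousLinearMap.one_apply]
  have h2 : skew β F y u z = -((2 * tau β F y - 1) (dTau β F y u z)) := by
    rw [skew, ← neg_eq_iff_eq_neg, ← ContinuousLinearMap.neg_apply, ← H.dTau_anticomm hy]; rfl
  rw [h2, map_neg, neg_neg, ← h1, ← H.beta_dTau hy]; rfl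

theorem LocalImmersion.beta_covSff (H : LocalImmersion β U F) {y : E} (hy : y ∈ U) (u v : E)
    (x z : L) : β (covSff β F y u v x) z = β x (covSff β F y u v z) := by
  simp only [covSff, ContinuousLinearMap.sub_apply, map_sub, clm_mul_apply, H.beta_fderiv_dTau hy,
    H.beta_dTau hy, H.beta_skew hy]
  ring

/-- Like `dτ`, its covariant derivative exchanges tangent and normal spaces. The second derivative
of `τ² = τ` has an extra diagonal part, which the commutator with `skew` cancels. -/
theorem LocalImmersion.covSff_eq (H : LocalImmersion β U F) {y : E} (hy : y ∈ U) (u v : E) :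
    covSff β F y u v = tau β F y * covSff β F y u v + covSff β F y u v * tau β F y := by
  set t := tau β F y with ht
  set a := dTau β F y u with ha
  set b := dTau β F y v with hb
  set c := fderiv ℝ (dTau β F) y u v with hc
  have hta : a = t * a + a * t := H.dTau_eq hy u
  have htb : b = t * b + b * t := H.dTau_eq hy v
  have htt : t * t = t := H.tau_mul_tau hy
  have htg : dTau β F y (Gam β F y u v) = t * dTau β F y (Gam β F y u v)
      + dTau β F y (Gam β F y u v) * t := H.dTau_eq hy _
  have hwb := H.dTau_anticomm hy v
  have hcc : c = (t * c + a * b) + (b * a + c * t) := by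
    have hB := H.hasFDerivAt_dTau_apply hy v
    have hT := H.differentiableAt H.contDiffOn_tau hy
    have h1 := H.fderiv_congr (fun w hw => H.dTau_eq hw v) hy
    rw [fderiv_fun_add (hT.fun_mul hB.differentiableAt) (hB.differentiableAt.fun_mul hT),
      hB.fderiv] at h1
    have h2 := congrArg (fun φ : E →L[ℝ] (L →L[ℝ] L) => φ u) h1
    have h3 := fderiv_comp_clm_apply hT hB.differentiableAt u
    have h4 := fderiv_comp_clm_apply hB.differentiableAt hT u
    rw [hB.fderiv] at h3 h4
    exact h2.trans (congrArg₂ (· + ·) h3 h4)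
  have hN : t * (a * b + b * a) = (a * b + b * a) * t := by
    linear_combination (norm := noncomm_ring) -hta * b + a * htb - htb * a + b * hta
  set N := a * b + b * a with hNd
  have hX : skew β F y u * b - b * skew β F y u = -(N * (2 * t - 1)) := by
    rw [skew, ← ha, ← ht, hNd]
    linear_combination (norm := noncomm_ring) a * hwb
  have hNw : N * (2 * t - 1) - t * (N * (2 * t - 1)) - N * (2 * t - 1) * t = -N := by
    linear_combination (norm := noncomm_ring) -hN * (2 * t - 1) - 4 * N * htt
  rw [covSff, ← hc, ← hb, hX]
  linear_combination (norm := noncomm_ring) hcc + hNw - htg - hNd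

namespace LocalKaehler

theorem mono (H : LocalKaehler β U F J) {V : Set E} (hV : IsOpen V) (hVU : V ⊆ U) :
    LocalKaehler β V F J where
  isOpen := hV
  symm := H.symm
  smooth := H.smooth.mono hVU
  pos y hy := H.pos y (hVU hy)
  nondeg := H.nondeg
  smooth_J := H.smooth_J.mono hVU
  J_J y hy := H.J_J y (hVU hy)
  orth y hy := H.orth y (hVU hy)
  parallel y hy := H.parallel y (hVU hy)

theorem contDiffOn_Jhat (H : LocalKaehler β U F J) : ContDiffOn ℝ ∞ (Jhat β F J) U :=
  H.contDiffOn_fderiv.clm_comp (H.smooth_J.clm_comp H.contDiffOn_rho)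

variable {y : E}

theorem Jhat_apply (H : LocalKaehler β U F J) (hy : y ∈ U) (u : E) :
    Jhat β F J y (fderiv ℝ F y u) = fderiv ℝ F y (J y u) := by
  change fderiv ℝ F y (J y (rho β F y (fderiv ℝ F y u))) = _
  rw [H.rho_apply hy]

theorem Jhat_Jhat (H : LocalKaehler β U F J) (hy : y ∈ U) (x : L) :
    Jhat β F J y (Jhat β F J y x) = -tau β F y x := by
  change Jhat β F J y (fderiv ℝ F y (J y (rho β F y x))) = _
  rw [H.Jhat_apply hy, H.J_J y hy, map_neg]; rfl

theorem beta_Jhat (H : LocalKaehler β U F J) (hy : y ∈ U) (x z : L) :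
    β (Jhat β F J y x) z = -β x (Jhat β F J y z) := by
  have h0 : ∀ x, tau β F y (Jhat β F J y x) = Jhat β F J y x := fun x => H.tau_apply hy _
  have h1 : ∀ a c, β (fderiv ℝ F y (J y a)) (fderiv ℝ F y c)
      = -β (fderiv ℝ F y a) (fderiv ℝ F y (J y c)) := by
    intro a c
    rw [← H.orth y hy (J y a) c, H.J_J y hy, map_neg, map_neg, ContinuousLinearMap.neg_apply]
  calc β (Jhat β F J y x) z = β (tau β F y (Jhat β F J y x)) z := by rw [h0]
    _ = β (Jhat β F J y x) (tau β F y z) := H.beta_tau hy _ _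
    _ = -β (tau β F y x) (Jhat β F J y z) := h1 _ _
    _ = -β x (Jhat β F J y z) := by rw [H.beta_tau hy, h0]

/-- `Jhat` is parallel for the connection on tangent plus normal vectors, which differs from the
flat one by `skew`; so its flat derivative is a commutator. -/
theorem fderiv_Jhat (H : LocalKaehler β U F J) (hy : y ∈ U) (u : E) :
    fderiv ℝ (Jhat β F J) y u
      = skew β F y u * Jhat β F J y - Jhat β F J y * skew β F y u := by
  have hA := H.differentiableAt H.contDiffOn_fderiv hy
  have hJ := H.differentiableAt H.smooth_J hy
  have hρ := H.differentiableAt H.contDiffOn_rho hy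
  have h1 := fderiv_comp_clm_apply hA (hJ.clm_comp hρ) u
  refine Eq.trans h1 ?_
  rw [fderiv_comp_clm_apply hJ hρ, H.fderiv_fderiv_eq hy, H.fderiv_rho hy, H.parallel y hy]
  ext x
  simp only [Jhat, ContinuousLinearMap.add_apply, ContinuousLinearMap.comp_apply,
    ContinuousLinearMap.sub_apply, ContinuousLinearMap.neg_apply, map_add, map_sub, map_neg,
    clm_mul_apply]
  abel

/-- Symmetry of the second derivative of `Jhat`, with `skew_mul_skew` to replace products of `skew`
by products of `dTau`. The commutator of the `dTau` is the curvature operator on tangent vectors, so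
this is the statement that curvature commutes with `J`. -/
theorem dTau_commutator_Jhat (H : LocalKaehler β U F J) (hy : y ∈ U) (u v : E) :
    (dTau β F y u * dTau β F y v - dTau β F y v * dTau β F y u) * Jhat β F J y
      = Jhat β F J y * (dTau β F y u * dTau β F y v - dTau β F y v * dTau β F y u) := by
  have hJ := H.differentiableAt H.contDiffOn_Jhat hy
  have key : ∀ u v, fderiv ℝ (fderiv ℝ (Jhat β F J)) y u v
      = (skew β F y v * (skew β F y u * Jhat β F J y - Jhat β F J y * skew β F y u)
          + fderiv ℝ (fun z => skew β F z v) y u * Jhat β F J y)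
        - (Jhat β F J y * fderiv ℝ (fun z => skew β F z v) y u
          + (skew β F y u * Jhat β F J y - Jhat β F J y * skew β F y u) * skew β F y v) := by
    intro u v
    have hS := H.differentiableAt (H.contDiffOn_skew v) hy
    have hd := H.differentiableAt (H.contDiffOn_Jhat.fderiv_of_isOpen (m := ∞) H.isOpen (by simp)) hy
    have h1 : fderiv ℝ (fderiv ℝ (Jhat β F J)) y u v
        = fderiv ℝ (fun z => fderiv ℝ (Jhat β F J) z v) y u := by
      have := hd.hasFDerivAt.clm_apply (hasFDerivAt_const v y)
      rw [this.fderiv]; simp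
    rw [h1, H.fderiv_congr (fun z hz => H.fderiv_Jhat hz v) hy, fderiv_fun_sub
      (hS.fun_mul hJ) (hJ.fun_mul hS), ContinuousLinearMap.sub_apply]
    have h2 := fderiv_comp_clm_apply hS hJ u
    have h3 := fderiv_comp_clm_apply hJ hS u
    rw [H.fderiv_Jhat hy] at h2 h3
    exact congrArg₂ (· - ·) h2 h3
  have h := H.fderiv_fderiv_comm H.contDiffOn_Jhat hy u v
  rw [key, key, H.fderiv_skew hy, H.fderiv_skew hy, H.fderiv_dTau_comm hy u v] at h
  have s1 := H.skew_mul_skew hy u v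
  have s2 := H.skew_mul_skew hy v u
  have s1' := congrArg (fun T => T * Jhat β F J y) s1
  have s2' := congrArg (fun T => T * Jhat β F J y) s2
  have s1'' := congrArg (fun T => Jhat β F J y * T) s1
  have s2'' := congrArg (fun T => Jhat β F J y * T) s2
  linear_combination (norm := noncomm_ring) -h - s1' + s2' + s1'' - s2''

theorem kaehler (H : LocalKaehler β U F J) (hy : y ∈ U) (u v w z : E) :
    β (sff β F y u z) (sff β F y v w) - β (sff β F y u w) (sff β F y v z)
      = β (sff β F y u (J y z)) (sff β F y v (J y w))
        - β (sff β F y u (J y w)) (sff β F y v (J y z)) := by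
  set K := dTau β F y u * dTau β F y v - dTau β F y v * dTau β F y u with hK
  have key : ∀ w z, β (sff β F y u z) (sff β F y v w) - β (sff β F y u w) (sff β F y v z)
      = β (fderiv ℝ F y z) (K (fderiv ℝ F y w)) := by
    intro w z
    simp only [sff, hK, ContinuousLinearMap.sub_apply, map_sub]
    rw [H.symm (dTau β F y u (fderiv ℝ F y w)), H.beta_dTau hy, H.beta_dTau hy]
    rfl
  rw [key, key, ← H.Jhat_apply hy, ← H.Jhat_apply hy]
  have h1 : K (Jhat β F J y (fderiv ℝ F y w)) = Jhat β F J y (K (fderiv ℝ F y w)) :=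
    congrArg (fun T : L →L[ℝ] L => T (fderiv ℝ F y w)) (H.dTau_commutator_Jhat hy u v)
  rw [h1, H.beta_Jhat hy, H.Jhat_Jhat hy, map_neg, neg_neg, ← H.beta_tau hy, H.tau_apply hy]

/-- If the second fundamental form is of type `(1, 1)` then it is parallel. -/
theorem covSff_eq_zero (H : LocalKaehler β U F J)
    (hα : ∀ z ∈ U, ∀ u v, sff β F z (J z u) (J z v) = sff β F z u v) (hy : y ∈ U) (u v : E) :
    covSff β F y u v = 0 := by
  have hneg : ∀ z x w, sff β F z (-x) w = -sff β F z x w := by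
    intro z x w; simp [sff]
  have hα' : ∀ z ∈ U, ∀ u v, sff β F z (J z u) v + sff β F z u (J z v) = 0 := by
    intro z hz u v
    have := hα z hz (J z u) v
    rw [H.J_J z hz, hneg] at this
    rw [← this, neg_add_cancel]
  have hJd := H.differentiableAt H.smooth_J hy
  have hJ1 : ∀ w, HasFDerivAt (fun z => J z w) ((fderiv ℝ J y).flip w) y := fun w =>
    hJd.hasFDerivAt.clm_apply (hasFDerivAt_const w y) |>.congr_fderiv (by ext; simp)
  have hJ2 : ∀ w u, fderiv ℝ (fun z => J z w) y u + Gam β F y u (J y w) = J y (Gam β F y u w) := by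
    intro w u
    rw [(hJ1 w).fderiv, ContinuousLinearMap.flip_apply, H.parallel y hy]
    simp
  have hsd : ∀ φ ψ : E → E, DifferentiableAt ℝ φ y → DifferentiableAt ℝ ψ y →
      DifferentiableAt ℝ (fun z => sff β F z (φ z) (ψ z)) y := by
    intro φ ψ hφ hψ
    exact ((H.differentiableAt H.contDiffOn_dTau hy).clm_apply hφ).clm_apply
      ((H.differentiableAt H.contDiffOn_fderiv hy).clm_apply hψ)
  -- Covariant derivative of `α(Ju, v) + α(u, Jv) = 0`, with `J` parallel.
  have hc : ∀ u v w, covSff β F y u (J y v) (fderiv ℝ F y w)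
      = -covSff β F y u v (fderiv ℝ F y (J y w)) := by
    intro u v w
    have h := congrArg (fun T : E →L[ℝ] L => T u)
      (H.fderiv_congr (fun z hz => hα' z hz v w) hy)
    rw [fderiv_fun_add (hsd _ _ (hJ1 v).differentiableAt (differentiableAt_const w))
      (hsd _ _ (differentiableAt_const v) (hJ1 w).differentiableAt), ContinuousLinearMap.add_apply,
      H.fderiv_sff hy (hJ1 v).differentiableAt (differentiableAt_const w),
      H.fderiv_sff hy (differentiableAt_const v) (hJ1 w).differentiableAt, hJ2, hJ2] at h
    simp only [fderiv_fun_const, Pi.zero_apply, ContinuousLinearMap.zero_apply, zero_add] at h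
    have e1 := hα' y hy (Gam β F y u v) w
    have e2 := hα' y hy v (Gam β F y u w)
    have e3 := congrArg (skew β F y u) (hα' y hy v w)
    rw [map_add, map_zero] at e3
    linear_combination (norm := module) h - e1 - e2 - e3
  -- By total symmetry, moving `J` from any slot of `∇α` to another changes the sign. Going round
  -- the three slots gives three changes of sign, so `∇α` is its own negative when one argument is
  -- of the form `Ju`, and every argument is.
  have hzero : ∀ u v w, covSff β F y u v (fderiv ℝ F y w) = 0 := by
    have hz : ∀ u v w, covSff β F y (J y u) v (fderiv ℝ F y w) = 0 := by
      intro u v w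
      have h1 : covSff β F y (J y u) v (fderiv ℝ F y w)
          = -covSff β F y u (J y v) (fderiv ℝ F y w) := by
        rw [H.covSff_comm hy (J y u) v, H.covSff_apply_comm hy v, H.covSff_comm hy v,
          H.covSff_apply_comm hy w, H.covSff_comm hy u, H.covSff_apply_comm hy (J y v),
          H.covSff_comm hy (J y v), hc w u v, H.covSff_apply_comm hy w u]
      have h2 : covSff β F y (J y u) v (fderiv ℝ F y w)
          = -covSff β F y u v (fderiv ℝ F y (J y w)) := by
        rw [H.covSff_comm hy (J y u) v, hc, H.covSff_comm hy v u]
      rw [hc, neg_neg] at h1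
      have h3 := h1.symm.trans h2
      rw [h1]
      have h4 : (2 : ℝ) • covSff β F y u v (fderiv ℝ F y (J y w)) = 0 := by
        rw [two_smul]; nth_rw 1 [h3]; exact neg_add_cancel _
      exact (smul_eq_zero.1 h4).resolve_left (by norm_num)
    intro u v w
    have := hz (-(J y u)) v w
    rwa [map_neg, H.J_J y hy, neg_neg] at this
  have hτ : ∀ x, covSff β F y u v (tau β F y x) = 0 := fun x => hzero u v _
  -- The part that maps normal to tangent vectors is adjoint to the part just shown to vanish.
  have hτ' : ∀ x, tau β F y (covSff β F y u v x) = 0 := by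
    intro x
    refine H.nondeg _ fun z => ?_
    rw [H.beta_tau hy, H.beta_covSff hy, hτ, map_zero]
  ext x
  rw [H.covSff_eq hy u v, ContinuousLinearMap.add_apply, clm_mul_apply, clm_mul_apply, hτ, hτ',
    add_zero]
  rfl

end LocalKaehler

end LocalKaehler

/-! ### Local uniqueness for linear differential inequalities and propagation of commutators. -/

section Propagation

open Module ContinuousLinearMap Filter Topology

/-- Gronwall's inequality along the segments issuing from `y₀`. -/
theorem eventually_eq_zero_of_norm_fderiv_le {E X : Type*} [NormedAddCommGroup E] [NormedSpace ℝ E]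
    [NormedAddCommGroup X] [NormedSpace ℝ X] {D : E → X} {y₀ : E} {K : ℝ}
    (hD : ∀ᶠ y in 𝓝 y₀, DifferentiableAt ℝ D y ∧ ‖fderiv ℝ D y‖ ≤ K * ‖D y‖) (h0 : D y₀ = 0) :
    ∀ᶠ y in 𝓝 y₀, D y = 0 := by
  obtain ⟨r, hr, hball⟩ := Metric.eventually_nhds_iff_ball.1 hD
  refine Metric.eventually_nhds_iff_ball.2 ⟨r, hr, fun y hy => ?_⟩
  let γ : ℝ → E := fun t => y₀ + t • (y - y₀)
  have hγ : ∀ t ∈ Set.Icc (0 : ℝ) 1, γ t ∈ Metric.ball y₀ r := by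
    intro t ht
    have h1 : γ t = y₀ + t • (y - y₀) := rfl
    have h2 : (1 - t) • y₀ + t • y = γ t := by rw [h1]; module
    rw [← h2]
    exact convex_ball y₀ r (Metric.mem_ball_self hr) hy (by linarith [ht.2]) ht.1 (by ring)
  have hγd : ∀ t, HasDerivAt γ (y - y₀) t := by
    intro t
    have h := ((hasDerivAt_id t).smul_const (y - y₀)).const_add y₀
    rwa [one_smul] at h
  have hd : ∀ t ∈ Set.Icc (0 : ℝ) 1, HasDerivAt (D ∘ γ) (fderiv ℝ D (γ t) (y - y₀)) t :=
    fun t ht => (hball _ (hγ t ht)).1.hasFDerivAt.comp_hasDerivAt t (hγd t)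
  have h := eq_zero_of_abs_deriv_le_mul_abs_self_of_eq_zero_right (f := D ∘ γ)
    (f' := fun t => fderiv ℝ D (γ t) (y - y₀)) (K := K * ‖y - y₀‖) (a := 0) (b := 1)
    (fun t ht => (hd t ht).continuousAt.continuousWithinAt)
    (fun t ht => (hd t (Set.Ico_subset_Icc_self ht)).hasDerivWithinAt)
    (by simp [γ, h0])
    (fun t ht => by
      refine (le_opNorm _ _).trans ?_
      have := (hball _ (hγ t (Set.Ico_subset_Icc_self ht))).2
      calc ‖fderiv ℝ D (γ t)‖ * ‖y - y₀‖ ≤ K * ‖D (γ t)‖ * ‖y - y₀‖ := by gcongr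
        _ = K * ‖y - y₀‖ * ‖(D ∘ γ) t‖ := by simp only [Function.comp_apply]; ring)
  simpa [γ] using h 1 ⟨zero_le_one, le_rfl⟩

/-- The version for three coupled quantities; a common bound `δ` lets the three derivatives be
estimated separately. -/
theorem eventually_eq_zero_of_norm_le {E A₁ A₂ A₃ : Type*} [NormedAddCommGroup E] [NormedSpace ℝ E]
    [NormedAddCommGroup A₁] [NormedSpace ℝ A₁] [NormedAddCommGroup A₂] [NormedSpace ℝ A₂]
    [NormedAddCommGroup A₃] [NormedSpace ℝ A₃] {D₁ : E → A₁} {D₂ : E → A₂} {D₃ : E → A₃}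
    {D₁' : E → E →L[ℝ] A₁} {D₂' : E → E →L[ℝ] A₂} {D₃' : E → E →L[ℝ] A₃} {y₀ : E} {K : ℝ}
    (hK : 0 ≤ K)
    (hD : ∀ᶠ y in 𝓝 y₀, HasFDerivAt D₁ (D₁' y) y ∧ HasFDerivAt D₂ (D₂' y) y ∧
      HasFDerivAt D₃ (D₃' y) y ∧ ∀ δ, ‖D₁ y‖ ≤ δ → ‖D₂ y‖ ≤ δ → ‖D₃ y‖ ≤ δ → ∀ u,
        ‖D₁' y u‖ ≤ K * δ * ‖u‖ ∧ ‖D₂' y u‖ ≤ K * δ * ‖u‖ ∧ ‖D₃' y u‖ ≤ K * δ * ‖u‖)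
    (h₁ : D₁ y₀ = 0) (h₂ : D₂ y₀ = 0) (h₃ : D₃ y₀ = 0) :
    ∀ᶠ y in 𝓝 y₀, D₁ y = 0 ∧ D₂ y = 0 ∧ D₃ y = 0 := by
  let D : E → A₁ × A₂ × A₃ := fun y => (D₁ y, D₂ y, D₃ y)
  have key : ∀ᶠ y in 𝓝 y₀, DifferentiableAt ℝ D y ∧ ‖fderiv ℝ D y‖ ≤ K * ‖D y‖ := by
    filter_upwards [hD] with y hy
    obtain ⟨d1, d2, d3, hb⟩ := hy
    have hd := d1.prodMk (d2.prodMk d3)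
    refine ⟨hd.differentiableAt, ?_⟩
    rw [show fderiv ℝ D y = _ from hd.fderiv]
    refine opNorm_le_bound _ (by positivity) fun u => ?_
    obtain ⟨b1, b2, b3⟩ := hb ‖D y‖ (norm_fst_le (D y))
      ((norm_fst_le (D y).2).trans (norm_snd_le (D y)))
      ((norm_snd_le (D y).2).trans (norm_snd_le (D y))) u
    exact norm_prod_le_iff.2 ⟨b1, norm_prod_le_iff.2 ⟨b2, b3⟩⟩
  filter_upwards [eventually_eq_zero_of_norm_fderiv_le key
    (Prod.ext h₁ (Prod.ext h₂ h₃) : D y₀ = 0)] with y hy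
  exact ⟨congrArg Prod.fst hy, congrArg (fun p => p.2.1) hy, congrArg (fun p => p.2.2) hy⟩

theorem hasFDerivAt_const_comp {E A B : Type*} [NormedAddCommGroup E] [NormedSpace ℝ E]
    [NormedAddCommGroup A] [NormedSpace ℝ A] [NormedAddCommGroup B] [NormedSpace ℝ B]
    (S : A →L[ℝ] B) {T : E → E →L[ℝ] A} {T' : E →L[ℝ] E →L[ℝ] A} {y : E}
    (hT : HasFDerivAt T T' y) :
    HasFDerivAt (fun z => S.comp (T z)) ((compL ℝ E A B S).comp T') y :=
  (compL ℝ E A B S).hasFDerivAt.comp y hT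

theorem exists_eventually_norm_le {E X : Type*} [NormedAddCommGroup E] [NormedSpace ℝ E]
    [NormedAddCommGroup X] [NormedSpace ℝ X] {φ : E → X} {U : Set E} {y₀ : E}
    (hφ : ContDiffOn ℝ ∞ φ U) (hU : U ∈ 𝓝 y₀) : ∃ C, ∀ᶠ y in 𝓝 y₀, ‖φ y‖ ≤ C :=
  ⟨‖φ y₀‖ + 1, ((hφ.contDiffAt hU).continuousAt.norm.eventually
    (gt_mem_nhds (lt_add_one _))).mono fun _ hy => hy.le⟩

variable {E L : Type*} [NormedAddCommGroup E] [NormedSpace ℝ E] [FiniteDimensional ℝ E]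
  [NormedAddCommGroup L] [NormedSpace ℝ L] [FiniteDimensional ℝ L]

/-- The commutator with `P`. -/
def ad (P : L →L[ℝ] L) : (L →L[ℝ] L) →L[ℝ] (L →L[ℝ] L) :=
  ContinuousLinearMap.mul ℝ (L →L[ℝ] L) P - (ContinuousLinearMap.mul ℝ (L →L[ℝ] L)).flip P

theorem ad_apply (P T : L →L[ℝ] L) : ad P T = P * T - T * P := rfl

theorem ad_mul (P S T : L →L[ℝ] L) : ad P (S * T) = ad P S * T + S * ad P T := by
  simp only [ad_apply]; noncomm_ring

variable {β : L →L[ℝ] L →L[ℝ] ℝ} {F : E → L} {U : Set E} {J : E → E →L[ℝ] E}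

/-- If the second fundamental form is parallel, the operators that commute with the tangent projection,
its derivative and the complex structure do not depend on the point. -/
theorem LocalKaehler.eventually_ad_eq_zero (H : LocalKaehler β U F J)
    (hcov : ∀ z ∈ U, ∀ u v, covSff β F z u v = 0) (P : L →L[ℝ] L) {y₀ : E} (hy₀ : y₀ ∈ U)
    (h1 : ad P (tau β F y₀) = 0) (h2 : ∀ v, ad P (dTau β F y₀ v) = 0)
    (h3 : ad P (Jhat β F J y₀) = 0) :
    ∀ᶠ y in 𝓝 y₀, ad P (tau β F y) = 0 ∧ ad P (Jhat β F J y) = 0 := by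
  let D1 : E → L →L[ℝ] L := fun y => ad P (tau β F y)
  let D2 : E → E →L[ℝ] L →L[ℝ] L := fun y => (ad P).comp (dTau β F y)
  let D3 : E → L →L[ℝ] L := fun y => ad P (Jhat β F J y)
  -- The connection `Gam` as one bilinear-valued function, so that smoothness bounds it near `y₀`.
  let G : E → E →L[ℝ] E →L[ℝ] E := fun y =>
    (compL ℝ E L E (rho β F y)).comp (fderiv ℝ (fderiv ℝ F) y)
  have hnhds := H.isOpen.mem_nhds hy₀
  have hG : ContDiffOn ℝ ∞ G U := by
    have e1 := H.contDiffOn_rho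
    have e2 : ContDiffOn ℝ ∞ (fderiv ℝ (fderiv ℝ F)) U :=
      H.contDiffOn_fderiv.fderiv_of_isOpen H.isOpen (by simp)
    exact ContDiffOn.clm_comp (by fun_prop) e2
  have hw : ContDiffOn ℝ ∞ (fun y => 2 * tau β F y - 1) U := by
    have := H.contDiffOn_tau
    fun_prop
  obtain ⟨C₁, hC₁⟩ := exists_eventually_norm_le hw hnhds
  obtain ⟨C₂, hC₂⟩ := exists_eventually_norm_le H.contDiffOn_dTau hnhds
  obtain ⟨C₃, hC₃⟩ := exists_eventually_norm_le H.contDiffOn_Jhat hnhds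
  obtain ⟨C₄, hC₄⟩ := exists_eventually_norm_le hG hnhds
  let C := max (max C₁ C₂) (max C₃ C₄)
  have hdiff : ∀ y ∈ U, HasFDerivAt D1 (D2 y) y ∧
      HasFDerivAt D2 ((compL ℝ E (L →L[ℝ] L) (L →L[ℝ] L) (ad P)).comp (fderiv ℝ (dTau β F) y)) y ∧
      HasFDerivAt D3 ((ad P).comp (fderiv ℝ (Jhat β F J) y)) y := by
    intro y hy
    refine ⟨?_, ?_, ?_⟩
    · exact (ad P).hasFDerivAt.comp y (H.differentiableAt H.contDiffOn_tau hy).hasFDerivAt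
    · exact hasFDerivAt_const_comp (ad P) (H.differentiableAt H.contDiffOn_dTau hy).hasFDerivAt
    · exact (ad P).hasFDerivAt.comp y (H.differentiableAt H.contDiffOn_Jhat hy).hasFDerivAt
  have hC0 : 0 ≤ C := by
    obtain ⟨y, hy⟩ := hC₁.exists
    exact (norm_nonneg _).trans (hy.trans ((le_max_left _ _).trans (le_max_left _ _)))
  -- The derivative of `D1` is `D2`, which accounts for `1`. Parallelism expresses the second
  -- derivative of `τ` by a commutator with `skew`, which costs `8 C²`, and by `dTau` of the
  -- connection term, which costs `C`. The derivative of `D3` is a commutator of the first kind.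
  have key := eventually_eq_zero_of_norm_le (y₀ := y₀) (K := 8 * C ^ 2 + C + 1) (D₁ := D1)
    (D₂ := D2) (D₃ := D3) (D₁' := D2)
    (D₂' := fun y => (compL ℝ E (L →L[ℝ] L) (L →L[ℝ] L) (ad P)).comp (fderiv ℝ (dTau β F) y))
    (D₃' := fun y => (ad P).comp (fderiv ℝ (Jhat β F J) y)) (by positivity) ?_ h1 (by
      ext v : 1
      exact h2 v) h3
  · filter_upwards [key] with y hy
    exact ⟨hy.1, hy.2.2⟩
  · filter_upwards [hnhds, hC₁, hC₂, hC₃, hC₄] with y hy b1 b2 b3 b4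
    have c1 : ‖2 * tau β F y - 1‖ ≤ C := b1.trans ((le_max_left _ _).trans (le_max_left _ _))
    have c2 : ‖dTau β F y‖ ≤ C := b2.trans ((le_max_right _ _).trans (le_max_left _ _))
    have c3 : ‖Jhat β F J y‖ ≤ C := b3.trans ((le_max_left _ _).trans (le_max_right _ _))
    have c4 : ‖G y‖ ≤ C := b4.trans ((le_max_right _ _).trans (le_max_right _ _))
    obtain ⟨d1, d2, d3⟩ := hdiff y hy
    refine ⟨d1, d2, d3, fun δ e1 e2 e3 => ?_⟩
    have hδ0 : 0 ≤ δ := (norm_nonneg _).trans e1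
    have e2' : ∀ v, ‖ad P (dTau β F y v)‖ ≤ δ * ‖v‖ := fun v => (D2 y).le_of_opNorm_le e2 v
    have c2' : ∀ v, ‖dTau β F y v‖ ≤ C * ‖v‖ := fun v => (dTau β F y).le_of_opNorm_le c2 v
    have c4' : ∀ u v, ‖Gam β F y u v‖ ≤ C * ‖u‖ * ‖v‖ := fun u v =>
      (G y).le_of_opNorm₂_le_of_le c4 le_rfl le_rfl
    have hS : ∀ u, ‖skew β F y u‖ ≤ C * ‖u‖ * C := fun u =>
      (norm_mul_le _ _).trans (by gcongr; exact c2' u)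
    have had1 : ad P (1 : L →L[ℝ] L) = 0 := by rw [ad_apply, mul_one, one_mul, sub_self]
    have hadS : ∀ u, ‖ad P (skew β F y u)‖ ≤ 3 * C * δ * ‖u‖ := by
      intro u
      have : ad P (skew β F y u) = ad P (dTau β F y u) * (2 * tau β F y - 1)
          + (dTau β F y u * D1 y + dTau β F y u * D1 y) := by
        rw [skew, ad_mul, map_sub, had1, sub_zero, two_mul, map_add, mul_add]
      rw [this]
      calc _ ≤ ‖ad P (dTau β F y u)‖ * ‖2 * tau β F y - 1‖
            + (‖dTau β F y u‖ * ‖D1 y‖ + ‖dTau β F y u‖ * ‖D1 y‖) :=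
            (norm_add_le _ _).trans (add_le_add (norm_mul_le _ _)
              ((norm_add_le _ _).trans (add_le_add (norm_mul_le _ _) (norm_mul_le _ _))))
        _ ≤ δ * ‖u‖ * C + (C * ‖u‖ * δ + C * ‖u‖ * δ) := by
            gcongr <;> first | exact e2' u | exact c2' u
        _ = 3 * C * δ * ‖u‖ := by ring
    have hcomm : ∀ u (T : L →L[ℝ] L) (a c : ℝ), ‖T‖ ≤ a → ‖ad P T‖ ≤ c →
        ‖ad P (skew β F y u * T - T * skew β F y u)‖
          ≤ 2 * (3 * C * δ * ‖u‖ * a + C * ‖u‖ * C * c) := by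
      intro u T a c ha hc
      have ha0 := (norm_nonneg _).trans ha
      have hc0 := (norm_nonneg _).trans hc
      rw [map_sub, ad_mul, ad_mul]
      have t1 : ‖ad P (skew β F y u) * T‖ ≤ 3 * C * δ * ‖u‖ * a :=
        (norm_mul_le _ _).trans (by gcongr; exact hadS u)
      have t2 : ‖skew β F y u * ad P T‖ ≤ C * ‖u‖ * C * c :=
        (norm_mul_le _ _).trans (by gcongr; exact hS u)
      have t3 : ‖ad P T * skew β F y u‖ ≤ c * (C * ‖u‖ * C) :=
        (norm_mul_le _ _).trans (by gcongr; exact hS u)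
      have t4 : ‖T * ad P (skew β F y u)‖ ≤ a * (3 * C * δ * ‖u‖) :=
        (norm_mul_le _ _).trans (by gcongr; exact hadS u)
      refine (norm_sub_le _ _).trans ?_
      have t5 := norm_add_le (ad P (skew β F y u) * T) (skew β F y u * ad P T)
      have t6 := norm_add_le (ad P T * skew β F y u) (T * ad P (skew β F y u))
      linarith
    intro u
    have hu := norm_nonneg u
    have hK : ∀ s, s ≤ (8 * C ^ 2 + C) * δ * ‖u‖ → s ≤ (8 * C ^ 2 + C + 1) * δ * ‖u‖ := by
      intro s hs
      have : 0 ≤ δ * ‖u‖ := by positivity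
      linarith
    refine ⟨?_, ?_, ?_⟩
    · refine (e2' u).trans ?_
      have : 0 ≤ (8 * C ^ 2 + C) * (δ * ‖u‖) := by positivity
      linarith
    · refine hK _ (opNorm_le_bound _ (by positivity) fun v => ?_)
      change ‖ad P (fderiv ℝ (dTau β F) y u v)‖ ≤ _
      have hz := hcov y hy u v
      rw [covSff, sub_sub, sub_eq_zero] at hz
      rw [hz, map_add]
      have t1 := hcomm u (dTau β F y v) _ _ (c2' v) (e2' v)
      have t2 : ‖ad P (dTau β F y (Gam β F y u v))‖ ≤ δ * (C * ‖u‖ * ‖v‖) :=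
        (e2' _).trans (by gcongr; exact c4' u v)
      refine (norm_add_le _ _).trans ((add_le_add t1 t2).trans (le_of_eq ?_))
      ring
    · refine hK _ ?_
      change ‖ad P (fderiv ℝ (Jhat β F J) y u)‖ ≤ _
      rw [H.fderiv_Jhat hy]
      refine (hcomm u _ _ _ c3 e3).trans ?_
      have : 0 ≤ C * (δ * ‖u‖) := by positivity
      linarith

end Propagation

/-! ### Kaehler immersions into the hyperboloid and regular vectors. -/

section HyperbolicKaehler

open Module ContinuousLinearMap Filter Topology

variable {E L : Type*} [NormedAddCommGroup E] [NormedSpace ℝ E] [FiniteDimensional ℝ E]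
  [NormedAddCommGroup L] [NormedSpace ℝ L] [FiniteDimensional ℝ L]

/-- `F` is a Kaehler immersion into the hyperboloid `⟨x, x⟩ = -1` of a Lorentzian vector space. -/
structure HyperbolicKaehler (β : L →L[ℝ] L →L[ℝ] ℝ) (U : Set E) (F : E → L) (J : E → E →L[ℝ] E) :
    Prop extends LocalKaehler β U F J where
  norm_eq : ∀ y ∈ U, β (F y) (F y) = -1
  nonneg : ∀ x z, β z z < 0 → β x z = 0 → 0 ≤ β x x

variable {β : L →L[ℝ] L →L[ℝ] ℝ} {F : E → L} {U : Set E} {J : E → E →L[ℝ] E} {y : E}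

variable (β F) in
/-- The normal space. -/
def normalSpace (y : E) : Submodule ℝ L := LinearMap.ker (rho β F y : L →ₗ[ℝ] E)

theorem mem_normalSpace {x : L} : x ∈ normalSpace β F y ↔ rho β F y x = 0 := Iff.rfl

variable (β F) in
/-- The bilinear form of the normal space. -/
def normalForm (y : E) : normalSpace β F y →ₗ[ℝ] normalSpace β F y →ₗ[ℝ] ℝ :=
  LinearMap.mk₂ ℝ (fun x z => β (x : L) (z : L)) (by intros; simp) (by intros; simp)
    (by intros; simp) (by intros; simp)

namespace LocalImmersion

theorem injective_fderiv (H : LocalImmersion β U F) (hy : y ∈ U) :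
    Function.Injective (fderiv ℝ F y) :=
  Function.LeftInverse.injective (H.rho_apply hy)

theorem rho_eq_zero_iff (H : LocalImmersion β U F) (hy : y ∈ U) (x : L) :
    rho β F y x = 0 ↔ tau β F y x = 0 := by
  constructor
  · intro h
    change fderiv ℝ F y (rho β F y x) = 0
    rw [h, map_zero]
  · intro h
    exact H.injective_fderiv hy (by rw [map_zero]; exact h)

theorem sff_mem (H : LocalImmersion β U F) (hy : y ∈ U) (u v : E) :
    sff β F y u v ∈ normalSpace β F y :=
  mem_normalSpace.2 ((H.rho_eq_zero_iff hy _).2 (H.tau_sff hy u v))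

/-- The second fundamental form with values in the normal space. -/
def normalSff (H : LocalImmersion β U F) (hy : y ∈ U) : E →ₗ[ℝ] E →ₗ[ℝ] normalSpace β F y :=
  LinearMap.mk₂ ℝ (fun u v => ⟨sff β F y u v, H.sff_mem hy u v⟩)
    (by intros; ext1; simp [sff]) (by intros; ext1; simp [sff])
    (by intros; ext1; simp [sff]) (by intros; ext1; simp [sff])

theorem finrank_normalSpace (H : LocalImmersion β U F) (hy : y ∈ U) :
    finrank ℝ E + finrank ℝ (normalSpace β F y) = finrank ℝ L := by
  have h := LinearMap.finrank_range_add_finrank_ker (rho β F y : L →ₗ[ℝ] E)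
  rw [LinearMap.range_eq_top.2 (Function.RightInverse.surjective (H.rho_apply hy)),
    finrank_top] at h
  exact h

end LocalImmersion

namespace HyperbolicKaehler

theorem mono (H : HyperbolicKaehler β U F J) {V : Set E} (hV : IsOpen V) (hVU : V ⊆ U) :
    HyperbolicKaehler β V F J where
  toLocalKaehler := H.toLocalKaehler.mono hV hVU
  norm_eq y hy := H.norm_eq y (hVU hy)
  nonneg := H.nonneg

theorem hasFDerivAt (H : HyperbolicKaehler β U F J) (hy : y ∈ U) :
    HasFDerivAt F (fderiv ℝ F y) y :=
  (H.differentiableAt H.smooth hy).hasFDerivAt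

theorem beta_fderiv (H : HyperbolicKaehler β U F J) (hy : y ∈ U) (u : E) :
    β (F y) (fderiv ℝ F y u) = 0 := by
  have h1 := H.fderiv_congr (fun z hz => H.norm_eq z hz) hy
  have h2 := (β.hasFDerivAt.comp y (H.hasFDerivAt hy)).clm_apply (H.hasFDerivAt hy)
  have h3 := congrArg (fun T : E →L[ℝ] ℝ => T u) (h2.fderiv.symm.trans h1)
  simp only [ContinuousLinearMap.add_apply, ContinuousLinearMap.comp_apply,
    ContinuousLinearMap.flip_apply, fderiv_fun_const, Pi.zero_apply,
    ContinuousLinearMap.zero_apply, Function.comp_apply] at h3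
  rw [H.symm (fderiv ℝ F y u)] at h3
  linarith

theorem tau_self (H : HyperbolicKaehler β U F J) (hy : y ∈ U) : tau β F y (F y) = 0 := by
  refine H.nondeg _ fun z => ?_
  rw [H.beta_tau hy]
  exact H.beta_fderiv hy _

/-- Differentiate `⟨F, dF v⟩ = 0`. The position vector is thus a normal direction in which `α` is
minus the metric. -/
theorem beta_sff_self (H : HyperbolicKaehler β U F J) (hy : y ∈ U) (u v : E) :
    β (sff β F y u v) (F y) = -β (fderiv ℝ F y u) (fderiv ℝ F y v) := by
  have h1 := H.fderiv_congr (fun z hz => H.beta_fderiv hz v) hy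
  have hA := (H.differentiableAt H.contDiffOn_fderiv hy).hasFDerivAt
  have h2 := (β.hasFDerivAt.comp y (H.hasFDerivAt hy)).clm_apply
    (hA.clm_apply (hasFDerivAt_const v y))
  have h3 := congrArg (fun T : E →L[ℝ] ℝ => T u) (h2.fderiv.symm.trans h1)
  simp only [ContinuousLinearMap.add_apply, ContinuousLinearMap.comp_apply,
    ContinuousLinearMap.flip_apply, fderiv_fun_const, Pi.zero_apply,
    ContinuousLinearMap.zero_apply, Function.comp_apply, map_zero, zero_add] at h3
  rw [H.fderiv_fderiv_apply hy, map_add, H.beta_fderiv hy, H.symm (F y)] at h3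
  linarith

theorem kaehlerPoint (H : HyperbolicKaehler β U F J) (hy : y ∈ U) :
    KaehlerPoint (J y : E →ₗ[ℝ] E) (fun u v => β (fderiv ℝ F y u) (fderiv ℝ F y v))
      (normalForm β F y) (H.normalSff hy)
      ⟨F y, mem_normalSpace.2 ((H.rho_eq_zero_iff hy _).2 (H.tau_self hy))⟩ where
  J_J := H.J_J y hy
  g_J := H.orth y hy
  g_pos := H.pos y hy
  b_symm x z := H.symm _ _
  b_nondeg x hx := by
    refine Subtype.ext (H.nondeg _ fun z => ?_)
    have h1 : rho β F y (z - tau β F y z) = 0 := by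
      rw [H.rho_eq_zero_iff hy, map_sub]
      have := congrArg (fun T : L →L[ℝ] L => T z) (H.tau_mul_tau hy)
      rw [clm_mul_apply] at this
      rw [this, sub_self]
    have h2 : β x (z - tau β F y z) = 0 := hx ⟨_, h1⟩
    have h3 : β x (tau β F y z) = 0 := by
      rw [← H.beta_tau hy, (H.rho_eq_zero_iff hy _).1 x.2, map_zero, ContinuousLinearMap.zero_apply]
    rw [map_sub, h3, sub_zero] at h2
    exact h2
  α_symm u v := Subtype.ext (H.sff_comm hy u v)
  kaehler u v w z := H.kaehler hy u v w z
  α_f u v := H.beta_sff_self hy u v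
  nonneg x hx := H.nonneg x (F y) (by rw [H.norm_eq y hy]; norm_num) hx

/-- `Z` is regular for the second fundamental form at `y`. -/
def Regular (β : L →L[ℝ] L →L[ℝ] ℝ) (F : E → L) (J : E → E →L[ℝ] E) (y Z : E) : Prop :=
  ∀ u, sff β F y u Z + sff β F y (J y u) (J y Z) = 0 →
    sff β F y u (J y Z) - sff β F y (J y u) Z = 0 → u = 0

theorem isRegular_iff (H : HyperbolicKaehler β U F J) (hy : y ∈ U) (Z : E) :
    IsRegular (J y : E →ₗ[ℝ] E) (H.normalSff hy) Z ↔ Regular β F J y Z := by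
  refine forall_congr' fun u => ?_
  refine imp_congr ?_ (imp_congr ?_ Iff.rfl)
  · exact Subtype.ext_iff
  · exact Subtype.ext_iff

/-- The dimension bound says that the normal space has at most half the dimension of `E`, as the
pointwise diagonalization needs. -/
theorem sff_J_J (H : HyperbolicKaehler β U F J) (hdim : 2 * finrank ℝ L ≤ 3 * finrank ℝ E)
    (hy : y ∈ U) {Z : E} (hZ : Regular β F J y Z) (u v : E) :
    sff β F y (J y u) (J y v) = sff β F y u v := by
  have h1 := H.finrank_normalSpace hy
  have h2 := ((H.kaehlerPoint hy).exists_diagonal ((H.isRegular_iff hy Z).2 hZ) (by omega)).2.1 u v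
  exact congrArg Subtype.val h2

/-- Regularity is injectivity of a linear map `E → L × L` that depends continuously on the point,
and injectivity is open in finite dimension. -/
theorem eventually_regular (H : HyperbolicKaehler β U F J) (hy : y ∈ U) {Z : E}
    (hZ : Regular β F J y Z) : ∀ᶠ z in 𝓝 y, Regular β F J z Z := by
  let T : E → E →L[ℝ] L × L := fun z =>
    ((dTau β F z).flip (fderiv ℝ F z Z)
      + ((dTau β F z).flip (fderiv ℝ F z (J z Z))).comp (J z)).prod
    ((dTau β F z).flip (fderiv ℝ F z (J z Z))
      - ((dTau β F z).flip (fderiv ℝ F z Z)).comp (J z))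
  have hT : ∀ z, Function.Injective (T z) ↔ Regular β F J z Z := by
    intro z
    rw [injective_iff_map_eq_zero]
    refine forall_congr' fun u => ?_
    rw [← and_imp]
    refine imp_congr ?_ Iff.rfl
    exact Prod.ext_iff
  have hc : ContinuousAt T y := by
    have hn := H.isOpen.mem_nhds hy
    have c1 : ContinuousAt (dTau β F) y := (H.contDiffOn_dTau.contDiffAt hn).continuousAt
    have c2 : ContinuousAt (fderiv ℝ F) y := (H.contDiffOn_fderiv.contDiffAt hn).continuousAt
    have c3 : ContinuousAt J y := (H.smooth_J.contDiffAt hn).continuousAt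
    have c4 : ContinuousAt (fun z => J z Z) y := c3.clm_apply continuousAt_const
    have c5 : ContinuousAt (fun z => (dTau β F z).flip) y :=
      (ContinuousLinearMap.flipₗᵢ ℝ E L L).continuous.continuousAt.comp c1
    have c6 := c5.clm_apply (c2.clm_apply (continuousAt_const (y := Z)))
    have c7 := c5.clm_apply (c2.clm_apply c4)
    have c8 := (c6.add (c7.clm_comp c3)).prodMk (c7.sub (c6.clm_comp c3))
    exact (ContinuousLinearMap.prodₗᵢ ℝ : (E →L[ℝ] L) × (E →L[ℝ] L) ≃ₗᵢ[ℝ] (E →L[ℝ] L × L))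
      |>.continuous.continuousAt.comp c8
  have := hc.eventually (ContinuousLinearMap.isOpen_injective.mem_nhds ((hT y).2 hZ))
  exact this.mono fun z hz => (hT z).1 hz

end HyperbolicKaehler

end HyperbolicKaehler

/-! ### Orthogonal splittings of the ambient space at a point and near it. -/

section Splitting

open Module ContinuousLinearMap Filter Topology

variable {E L : Type*} [NormedAddCommGroup E] [NormedSpace ℝ E] [FiniteDimensional ℝ E]
  [NormedAddCommGroup L] [NormedSpace ℝ L] [FiniteDimensional ℝ L]

/-- An orthogonal decomposition of `L` into subspaces of dimension at most three. -/
structure OrthogonalSplitting {κ : Type*} [Fintype κ] [DecidableEq κ] (β : L →L[ℝ] L →L[ℝ] ℝ)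
    (P : κ → L →L[ℝ] L) : Prop where
  mul_self : ∀ i, P i * P i = P i
  mul_ne : ∀ i j, i ≠ j → P i * P j = 0
  sum_eq : ∀ x, ∑ i, P i x = x
  symm : ∀ i x z, β (P i x) z = β x (P i z)
  finrank_le : ∀ i, finrank ℝ (LinearMap.range (P i : L →ₗ[ℝ] L)) ≤ 3

variable {β : L →L[ℝ] L →L[ℝ] ℝ} {F : E → L} {U : Set E} {J : E → E →L[ℝ] E} {y : E}
  {κ : Type*} [Fintype κ] [DecidableEq κ] {P : κ → L →L[ℝ] L}

namespace HyperbolicKaehler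

/-- The splitting replaces the curvature hypothesis. The projections induce complex projections `Q
i` of `E`, whose ranges turn out to be complex lines; the sum of one nonzero vector from each line
is regular. -/
theorem exists_regular (H : HyperbolicKaehler β U F J) (hy : y ∈ U) (HP : OrthogonalSplitting β P)
    (hE : finrank ℝ E = 2 * Fintype.card κ) (h1 : ∀ i, ad (P i) (tau β F y) = 0)
    (h2 : ∀ i v, ad (P i) (dTau β F y v) = 0) (h3 : ∀ i, ad (P i) (Jhat β F J y) = 0) :
    ∃ Z, Regular β F J y Z := by
  have comm : ∀ {i} {T : L →L[ℝ] L}, ad (P i) T = 0 → ∀ x, P i (T x) = T (P i x) := by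
    intro i T hT x
    exact congrArg (fun S : L →L[ℝ] L => S x) (sub_eq_zero.1 hT)
  have hinj := H.injective_fderiv hy
  let Q : κ → E →ₗ[ℝ] E := fun i => ((rho β F y).comp ((P i).comp (fderiv ℝ F y)) : E →L[ℝ] E)
  have hQ : ∀ i u, fderiv ℝ F y (Q i u) = P i (fderiv ℝ F y u) := by
    intro i u
    change tau β F y (P i (fderiv ℝ F y u)) = _
    rw [← comm (h1 i), H.tau_apply hy]
  have hPP : ∀ i x, P i (P i x) = P i x := fun i x =>
    congrArg (fun S : L →L[ℝ] L => S x) (HP.mul_self i)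
  have hPne : ∀ i j x, i ≠ j → P i (P j x) = 0 := fun i j x hij =>
    congrArg (fun S : L →L[ℝ] L => S x) (HP.mul_ne i j hij)
  have hQQ : ∀ i u, Q i (Q i u) = Q i u := fun i u => hinj (by rw [hQ, hQ, hPP])
  have hQne : ∀ i j u, i ≠ j → Q i (Q j u) = 0 := fun i j u hij =>
    hinj (by rw [hQ, hQ, hPne i j _ hij, map_zero])
  have hQsum : ∀ u, ∑ i, Q i u = u := fun u => hinj (by
    rw [map_sum]; simp only [hQ]; exact HP.sum_eq _)
  have hQJ : ∀ i u, Q i (J y u) = J y (Q i u) := fun i u => hinj (by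
    rw [hQ, ← H.Jhat_apply hy, comm (h3 i), ← hQ, H.Jhat_apply hy])
  have hg : ∀ i u v, β (fderiv ℝ F y (Q i u)) (fderiv ℝ F y v)
      = β (fderiv ℝ F y u) (fderiv ℝ F y (Q i v)) := fun i u v => by rw [hQ, hQ, HP.symm]
  have hJrange : ∀ i, ∀ u ∈ LinearMap.range (Q i), (J y : E →ₗ[ℝ] E) u ∈ LinearMap.range (Q i) := by
    rintro i _ ⟨u, rfl⟩
    exact ⟨J y u, hQJ i u⟩
  have hle : ∀ i, finrank ℝ (LinearMap.range (Q i)) ≤ 2 := by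
    intro i
    have e1 : finrank ℝ (LinearMap.range (Q i)) ≤ 3 := by
      refine le_trans ?_ (HP.finrank_le i)
      let φ : LinearMap.range (Q i) →ₗ[ℝ] LinearMap.range (P i : L →ₗ[ℝ] L) :=
        ((fderiv ℝ F y : E →ₗ[ℝ] L).domRestrict _).codRestrict _ (by
          rintro ⟨_, u, rfl⟩
          exact ⟨fderiv ℝ F y u, (hQ i u).symm⟩)
      refine LinearMap.finrank_le_finrank_of_injective (f := φ) fun a b hab => ?_
      exact Subtype.ext (hinj (congrArg Subtype.val hab))
    -- The range carries a complex structure, so its dimension is even, and at most three means at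
    -- most two. As the dimensions add up to at least twice the number of blocks, each is two.
    have e2 := KaehlerPoint.finrank_eq (J := (J y : E →ₗ[ℝ] E).restrict (hJrange i))
      (fun u => Subtype.ext (H.J_J y hy u))
    omega
  have hsum : finrank ℝ E ≤ ∑ i, finrank ℝ (LinearMap.range (Q i)) := by
    rw [← Module.finrank_pi_fintype]
    let ψ : E →ₗ[ℝ] (∀ i, LinearMap.range (Q i)) := LinearMap.pi fun i => (Q i).rangeRestrict
    refine LinearMap.finrank_le_finrank_of_injective (f := ψ)
      ((injective_iff_map_eq_zero _).2 fun u hu => ?_)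
    rw [← hQsum u]
    refine Finset.sum_eq_zero fun i _ => ?_
    exact congrArg Subtype.val (congrFun hu i)
  have heq : ∀ i, finrank ℝ (LinearMap.range (Q i)) = 2 := by
    intro i
    by_contra hne
    have hlt : ∑ i, finrank ℝ (LinearMap.range (Q i)) < ∑ _i : κ, 2 :=
      Finset.sum_lt_sum (fun j _ => hle j) ⟨i, Finset.mem_univ i, lt_of_le_of_ne (hle i) hne⟩
    rw [Finset.sum_const, Finset.card_univ, smul_eq_mul] at hlt
    omega
  have hex : ∀ i, ∃ Z, Z ≠ 0 ∧ Q i Z = Z := by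
    intro i
    have : Nontrivial (LinearMap.range (Q i)) := Module.nontrivial_of_finrank_pos (R := ℝ)
      (by rw [heq]; norm_num)
    obtain ⟨⟨_, u, rfl⟩, hu⟩ := exists_ne (0 : LinearMap.range (Q i))
    exact ⟨Q i u, fun h => hu (Subtype.ext h), hQQ i u⟩
  choose Z hZ0 hZ using hex
  have hQZ : ∀ i, Q i (∑ j, Z j) = Z i := by
    intro i
    rw [map_sum, Finset.sum_eq_single i (fun j _ hj => by rw [← hZ j, hQne i j _ hj.symm])
      (by simp), hZ]
  have hK := H.kaehlerPoint hy
  have hgJ : ∀ u v, β (fderiv ℝ F y (J y u)) (fderiv ℝ F y v)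
      = -β (fderiv ℝ F y u) (fderiv ℝ F y (J y v)) := by
    intro u v
    rw [← H.orth y hy (J y u) v, H.J_J y hy, map_neg, map_neg, ContinuousLinearMap.neg_apply]
  have hperpJ : ∀ u, β (fderiv ℝ F y u) (fderiv ℝ F y (J y u)) = 0 := fun u => hK.g_J_self u
  refine ⟨∑ j, Z j, fun u hu1 hu2 => ?_⟩
  -- The projection `P i` isolates `Z i` in the equation `h(u, Z) = 0`, and pairing with the
  -- position vector turns `α` into the metric. The real and imaginary parts show that `u` is
  -- orthogonal to `Z i` and to `J Z i`.
  have a1 : ∀ i, β (fderiv ℝ F y u) (fderiv ℝ F y (Z i)) = 0 := by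
    intro i
    have hPs : ∀ a b, P i (sff β F y a b) = sff β F y a (Q i b) := by
      intro a b
      simp only [sff]
      rw [comm (h2 i a), hQ]
    have t := congrArg (fun x => β x (F y)) (congrArg (P i) hu1)
    simp only [map_add, map_zero, ContinuousLinearMap.add_apply, ContinuousLinearMap.zero_apply,
      hPs, hQJ, hQZ, H.beta_sff_self hy, H.orth y hy] at t
    linarith
  have a2 : ∀ i, β (fderiv ℝ F y u) (fderiv ℝ F y (J y (Z i))) = 0 := by
    intro i
    have hPs : ∀ a b, P i (sff β F y a b) = sff β F y a (Q i b) := by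
      intro a b
      simp only [sff]
      rw [comm (h2 i a), hQ]
    have t := congrArg (fun x => β x (F y)) (congrArg (P i) hu2)
    simp only [map_sub, map_zero, ContinuousLinearMap.sub_apply, ContinuousLinearMap.zero_apply,
      hPs, hQJ, hQZ, H.beta_sff_self hy, hgJ] at t
    linarith
  rw [← hQsum u]
  refine Finset.sum_eq_zero fun i _ => ?_
  have hspan : Submodule.span ℝ {Z i, J y (Z i)} = LinearMap.range (Q i) := by
    refine Submodule.eq_of_le_of_finrank_eq (Submodule.span_le.2 ?_) ?_
    · rintro x (rfl | rfl)
      · exact ⟨_, hZ i⟩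
      · exact hJrange i _ ⟨_, hZ i⟩
    · rw [heq]
      have hli : LinearIndependent ℝ ![Z i, J y (Z i)] := by
        refine LinearIndependent.pair_iff.2 fun s t hst => ?_
        have hpos := H.pos y hy (Z i) (hZ0 i)
        have r1 := congrArg (fun x => β (fderiv ℝ F y (Z i)) (fderiv ℝ F y x)) hst
        have r2 := congrArg (fun x => β (fderiv ℝ F y (J y (Z i))) (fderiv ℝ F y x)) hst
        simp only [map_add, map_smul, map_zero, hperpJ, smul_eq_mul, H.orth y hy] at r1 r2
        rw [hgJ, hperpJ] at r2
        constructor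
        · exact (mul_eq_zero.1 (by linarith)).resolve_right hpos.ne'
        · exact (mul_eq_zero.1 (by linarith)).resolve_right hpos.ne'
      have := finrank_span_eq_card hli
      rw [Matrix.range_cons_cons_empty] at this
      simpa using this
  obtain ⟨s, t, hst⟩ := Submodule.mem_span_pair.1
    (show Q i u ∈ Submodule.span ℝ {Z i, J y (Z i)} by rw [hspan]; exact ⟨u, rfl⟩)
  by_contra hne
  have hpos := H.pos y hy _ hne
  rw [hg, hQQ, ← hst, map_add, map_add, map_smul, map_smul, map_smul, map_smul, a1, a2] at hpos
  simp at hpos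

/-- A regular vector at `y` stays regular nearby, so `α` is of type (1,1) there, hence parallel, and
the commutators propagate. The function `⟨P i F, F⟩` is constant because `P i` preserves the tangent
space while `F` is normal. -/
theorem eventually_split (H : HyperbolicKaehler β U F J) (hy : y ∈ U)
    (HP : OrthogonalSplitting β P) (hE : finrank ℝ E = 2 * Fintype.card κ)
    (hL : finrank ℝ L = 3 * Fintype.card κ)
    (h1 : ∀ i, ad (P i) (tau β F y) = 0) (h2 : ∀ i v, ad (P i) (dTau β F y v) = 0)
    (h3 : ∀ i, ad (P i) (Jhat β F J y) = 0) :
    ∀ᶠ z in 𝓝 y, ∀ i, ad (P i) (tau β F z) = 0 ∧ ad (P i) (Jhat β F J z) = 0 ∧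
      β (P i (F z)) (F z) = β (P i (F y)) (F y) := by
  obtain ⟨Z, hZ⟩ := H.exists_regular hy HP hE h1 h2 h3
  obtain ⟨V, hVsub, hVo, hyV⟩ := eventually_nhds_iff.1
    ((H.eventually_regular hy hZ).and (H.isOpen.mem_nhds hy))
  have HV := H.mono hVo fun z hz => (hVsub z hz).2
  have hcov : ∀ z ∈ V, ∀ u v, covSff β F z u v = 0 := fun z hz u v =>
    HV.covSff_eq_zero (fun w hw => HV.sff_J_J (by omega) hw (hVsub w hw).1) hz u v
  have hev : ∀ᶠ z in 𝓝 y, ∀ i, ad (P i) (tau β F z) = 0 ∧ ad (P i) (Jhat β F J z) = 0 :=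
    eventually_all.2 fun i => HV.eventually_ad_eq_zero hcov (P i) hyV (h1 i) (h2 i) (h3 i)
  have hconst : ∀ i, ∀ᶠ z in 𝓝 y, β (P i (F z)) (F z) - β (P i (F y)) (F y) = 0 := by
    intro i
    refine eventually_eq_zero_of_norm_fderiv_le (K := 0) ?_ (sub_self _)
    filter_upwards [hev, hVo.mem_nhds hyV] with z hz hzV
    have hd := ((β.comp (P i)).hasFDerivAt.comp z (HV.hasFDerivAt hzV)).clm_apply
      (HV.hasFDerivAt hzV)
    have hd' := hd.sub_const (β (P i (F y)) (F y))
    have h0 : fderiv ℝ (fun z => β (P i (F z)) (F z) - β (P i (F y)) (F y)) z = 0 := by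
      refine hd'.fderiv.trans ?_
      ext u
      have e1 : β (F z) (P i (fderiv ℝ F z u)) = 0 := by
        have : P i (tau β F z (fderiv ℝ F z u)) = tau β F z (P i (fderiv ℝ F z u)) :=
          congrArg (fun S : L →L[ℝ] L => S (fderiv ℝ F z u)) (sub_eq_zero.1 (hz i).1)
        rw [HV.tau_apply hzV] at this
        rw [this, ← HV.beta_tau hzV, HV.tau_self hzV, map_zero, ContinuousLinearMap.zero_apply]
      simp only [ContinuousLinearMap.add_apply, ContinuousLinearMap.comp_apply,
        ContinuousLinearMap.flip_apply, ContinuousLinearMap.zero_apply, Function.comp_apply]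
      rw [HP.symm, e1, HV.symm, e1, add_zero]
    refine ⟨hd'.differentiableAt, ?_⟩
    rw [h0, zero_mul, norm_zero]
  filter_upwards [hev, eventually_all.2 hconst] with z hz hz' i
  exact ⟨(hz i).1, (hz i).2, sub_eq_zero.1 (hz' i)⟩

end HyperbolicKaehler

end Splitting

/-! ### The Lorentzian inner product and time orientation. -/

section LorentzForm

variable {ι : Type*} [Fintype ι] [DecidableEq ι] {o : ι} {x z : ι → ℝ}

theorem lorentz_eq (o : ι) (x z : ι → ℝ) :
    lorentz o x z = ∑ i ∈ Finset.univ.erase o, x i * z i - x o * z o := by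
  rw [lorentz, ← Finset.add_sum_erase _ _ (Finset.mem_univ o), if_pos rfl]
  rw [Finset.sum_congr rfl fun i hi => by rw [if_neg (Finset.ne_of_mem_erase hi), one_mul]]
  ring

/-- The Lorentzian inner product as a continuous bilinear form. -/
def lorentzForm (o : ι) : (ι → ℝ) →L[ℝ] (ι → ℝ) →L[ℝ] ℝ :=
  LinearMap.toContinuousBilinearMap (LinearMap.mk₂ ℝ (lorentz o)
    (fun x x' z => by simp only [lorentz, ← Finset.sum_add_distrib, Pi.add_apply]; exact Finset.sum_congr rfl fun i _ => by ring)
    (fun c x z => by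
      simp only [lorentz, Pi.smul_apply, smul_eq_mul, Finset.mul_sum]; exact Finset.sum_congr rfl fun i _ => by ring)
    (fun x z z' => by simp only [lorentz, ← Finset.sum_add_distrib, Pi.add_apply]; exact Finset.sum_congr rfl fun i _ => by ring)
    (fun c x z => by
      simp only [lorentz, Pi.smul_apply, smul_eq_mul, Finset.mul_sum]; exact Finset.sum_congr rfl fun i _ => by ring))

theorem lorentzForm_apply (o : ι) (x z : ι → ℝ) : lorentzForm o x z = lorentz o x z := rfl

theorem lorentz_comm (o : ι) (x z : ι → ℝ) : lorentz o x z = lorentz o z x := by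
  simp only [lorentz, mul_comm (x _)]

theorem lorentz_single (o : ι) (x : ι → ℝ) (i : ι) :
    lorentz o x (Pi.single i 1) = (if i = o then -1 else 1) * x i := by
  rw [lorentz, Finset.sum_eq_single i]
  · simp
  · intro j _ hj
    simp [hj]
  · simp

theorem eq_zero_of_lorentz_eq_zero (h : ∀ z, lorentz o x z = 0) : x = 0 := by
  ext i
  have := h (Pi.single i 1)
  rw [lorentz_single] at this
  split_ifs at this <;> simpa using this

theorem sq_sum_erase_le (o : ι) (x z : ι → ℝ) :
    (∑ i ∈ Finset.univ.erase o, x i * z i) ^ 2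
      ≤ (∑ i ∈ Finset.univ.erase o, x i * x i) * ∑ i ∈ Finset.univ.erase o, z i * z i := by
  simpa only [sq] using Finset.sum_mul_sq_le_sq_mul_sq (Finset.univ.erase o) x z

/-- Cauchy–Schwarz for the spatial parts. -/
theorem lorentz_self_nonneg_of_orthogonal (hz : lorentz o z z < 0) (hxz : lorentz o x z = 0) :
    0 ≤ lorentz o x x := by
  rw [lorentz_eq] at *
  have h1 := sq_sum_erase_le o x z
  have hx0 : 0 ≤ ∑ i ∈ Finset.univ.erase o, x i * x i :=
    Finset.sum_nonneg fun i _ => mul_self_nonneg _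
  have hz0 : 0 ≤ ∑ i ∈ Finset.univ.erase o, z i * z i :=
    Finset.sum_nonneg fun i _ => mul_self_nonneg _
  rw [sub_eq_zero.1 hxz] at h1
  by_contra! hneg
  nlinarith [mul_self_nonneg (x o), mul_self_nonneg (z o)]

/-- For timelike vectors the product of the time coordinates exceeds the spatial product in absolute
value, so it determines the sign. -/
theorem pos_iff_lorentz_neg (hx : lorentz o x x < 0) (hz : lorentz o z z < 0) (hzo : 0 < z o) :
    0 < x o ↔ lorentz o x z < 0 := by
  rw [lorentz_eq] at *
  have h1 := sq_sum_erase_le o x z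
  have hx0 : 0 ≤ ∑ i ∈ Finset.univ.erase o, x i * x i :=
    Finset.sum_nonneg fun i _ => mul_self_nonneg _
  have hz0 : 0 ≤ ∑ i ∈ Finset.univ.erase o, z i * z i :=
    Finset.sum_nonneg fun i _ => mul_self_nonneg _
  have h2 : (∑ i ∈ Finset.univ.erase o, x i * z i) ^ 2 < (x o * z o) ^ 2 := by
    nlinarith [mul_self_nonneg (x o), mul_self_nonneg (z o)]
  have h3 := sq_lt_sq.1 h2
  constructor
  · intro hxo
    rw [abs_of_pos (mul_pos hxo hzo)] at h3
    linarith [le_abs_self (∑ i ∈ Finset.univ.erase o, x i * z i)]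
  · intro h
    by_contra! hxo
    rw [abs_of_nonpos (mul_nonpos_of_nonpos_of_nonneg hxo hzo.le)] at h3
    linarith [neg_abs_le (∑ i ∈ Finset.univ.erase o, x i * z i)]

/-- A linear isometry that maps the time direction into the upper sheet maps hyperboloids to
hyperboloids. -/
theorem image_hyperboloid {ι' : Type*} [Fintype ι'] [DecidableEq ι'] {o' : ι'}
    (Φ : (ι → ℝ) ≃ₗ[ℝ] (ι' → ℝ)) (hΦ : ∀ x z, lorentz o' (Φ x) (Φ z) = lorentz o x z)
    (ho : 0 < Φ (Pi.single o 1) o') {c : ℝ} (hc : c < 0) :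
    Φ '' hyperboloid o c = hyperboloid o' c := by
  have hs : lorentz o (Pi.single o 1) (Pi.single o 1) = -1 := by simp [lorentz_single]
  have key : ∀ x, lorentz o x x = 1 / c → (0 < Φ x o' ↔ 0 < x o) := by
    intro x hx
    have hneg : lorentz o x x < 0 := by rw [hx]; exact one_div_neg.2 hc
    rw [pos_iff_lorentz_neg (by rwa [hΦ]) (by rw [hΦ, hs]; norm_num) ho, hΦ, lorentz_single]
    simp
  ext w
  constructor
  · rintro ⟨x, ⟨hx, hxo⟩, rfl⟩
    exact ⟨by rw [hΦ, hx], (key x hx).2 hxo⟩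
  · rintro ⟨hw, hwo⟩
    obtain ⟨x, rfl⟩ := Φ.surjective w
    rw [hΦ] at hw
    exact ⟨x, ⟨hw, (key x hw).1 hwo⟩, rfl⟩

end LorentzForm

/-! ### Orthogonal frames and their block projections. -/

section Frames

open Module

variable {L : Type*} [NormedAddCommGroup L] [NormedSpace ℝ L] [FiniteDimensional ℝ L]
  {β : L →L[ℝ] L →L[ℝ] ℝ}

theorem linearIndependent_of_orthogonal {ι : Type*} [Fintype ι] {e : ι → L}
    (horth : ∀ a b, a ≠ b → β (e a) (e b) = 0) (hne : ∀ a, β (e a) (e a) ≠ 0) :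
    LinearIndependent ℝ e := by
  rw [Fintype.linearIndependent_iff]
  intro c hc a
  have h := congrArg (fun x => β x (e a)) hc
  simp only [map_sum, map_smul, ContinuousLinearMap.sum_apply, ContinuousLinearMap.smul_apply,
    map_zero, ContinuousLinearMap.zero_apply, smul_eq_mul] at h
  rw [Finset.sum_eq_single a (fun b _ hb => by rw [horth b a hb, mul_zero]) (by simp)] at h
  exact (mul_eq_zero.1 h).resolve_right (hne a)

theorem sum_orthogonal_expansion {ι : Type*} [Fintype ι] {e : ι → L}
    (horth : ∀ a b, a ≠ b → β (e a) (e b) = 0) (hne : ∀ a, β (e a) (e a) ≠ 0)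
    (hcard : Fintype.card ι = finrank ℝ L) (x : L) :
    ∑ a, (β x (e a) / β (e a) (e a)) • e a = x := by
  have hspan : (⊤ : Submodule ℝ L) ≤ Submodule.span ℝ (Set.range e) :=
    ((linearIndependent_of_orthogonal horth hne).span_eq_top_of_card_eq_finrank' hcard).ge
  obtain ⟨c, hc⟩ := (Submodule.mem_span_range_iff_exists_fun ℝ).1 (hspan (Submodule.mem_top (x := x)))
  have : ∀ a, β x (e a) / β (e a) (e a) = c a := by
    intro a
    rw [← hc]
    simp only [map_sum, map_smul, ContinuousLinearMap.sum_apply, ContinuousLinearMap.smul_apply,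
      smul_eq_mul]
    rw [Finset.sum_eq_single a (fun b _ hb => by rw [horth b a hb, mul_zero]) (by simp),
      mul_div_cancel_right₀ _ (hne a)]
  simp only [this, hc]

variable {κ : Type*} [Fintype κ] [DecidableEq κ] {e : κ × Fin 3 → L}

/-- The orthogonal projection to the span of the three frame vectors with index `i`. -/
def blockProj (β : L →L[ℝ] L →L[ℝ] ℝ) (e : κ × Fin 3 → L) (i : κ) : L →L[ℝ] L :=
  ∑ k, (β.flip ((β (e (i, k)) (e (i, k)))⁻¹ • e (i, k))).smulRight (e (i, k))

theorem blockProj_apply (i : κ) (x : L) :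
    blockProj β e i x = ∑ k, (β x (e (i, k)) / β (e (i, k)) (e (i, k))) • e (i, k) := by
  simp only [blockProj, ContinuousLinearMap.sum_apply, ContinuousLinearMap.smulRight_apply,
    ContinuousLinearMap.flip_apply, map_smul, ContinuousLinearMap.smul_apply, smul_eq_mul,
    div_eq_inv_mul]

theorem blockProj_self (horth : ∀ a b, a ≠ b → β (e a) (e b) = 0) (hne : ∀ a, β (e a) (e a) ≠ 0)
    (i : κ) (k : Fin 3) : blockProj β e i (e (i, k)) = e (i, k) := by
  rw [blockProj_apply, Finset.sum_eq_single k
    (fun l _ hl => by rw [horth (i, k) (i, l) (by simpa using hl.symm), zero_div, zero_smul])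
    (by simp), div_self (hne _), one_smul]

theorem blockProj_eq_zero {i : κ} {x : L} (hx : ∀ k, β x (e (i, k)) = 0) :
    blockProj β e i x = 0 := by
  rw [blockProj_apply]
  exact Finset.sum_eq_zero fun k _ => by rw [hx, zero_div, zero_smul]

theorem orthogonalSplitting_blockProj (hsymm : ∀ x z, β x z = β z x)
    (horth : ∀ a b, a ≠ b → β (e a) (e b) = 0) (hne : ∀ a, β (e a) (e a) ≠ 0)
    (hcard : Fintype.card (κ × Fin 3) = finrank ℝ L) :
    OrthogonalSplitting β (blockProj β e) where
  mul_self i := by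
    ext x
    rw [clm_mul_apply, blockProj_apply i x, map_sum]
    simp only [map_smul, blockProj_self horth hne]
  mul_ne i j hij := by
    ext x
    rw [clm_mul_apply, blockProj_apply j x, map_sum]
    simp only [map_smul, ContinuousLinearMap.zero_apply]
    refine Finset.sum_eq_zero fun k _ => ?_
    rw [blockProj_eq_zero fun l => horth _ _ (by simp [hij.symm]), smul_zero]
  sum_eq x := by
    conv_rhs => rw [← sum_orthogonal_expansion horth hne hcard x, Fintype.sum_prod_type]
    simp only [blockProj_apply]
  symm i x z := by
    simp only [blockProj_apply, map_sum, map_smul, ContinuousLinearMap.sum_apply,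
      ContinuousLinearMap.smul_apply, smul_eq_mul]
    refine Finset.sum_congr rfl fun k _ => ?_
    rw [hsymm (e (i, k)) z]
    ring
  finrank_le i := by
    have hle : LinearMap.range (blockProj β e i : L →ₗ[ℝ] L)
        ≤ Submodule.span ℝ (Set.range fun k => e (i, k)) := by
      rintro _ ⟨x, rfl⟩
      rw [ContinuousLinearMap.coe_coe, blockProj_apply]
      exact Submodule.sum_mem _ fun k _ => Submodule.smul_mem _ _ (Submodule.subset_span ⟨k, rfl⟩)
    have h2 := finrank_range_le_card (R := ℝ) (fun k => e (i, k))
    rw [Fintype.card_fin] at h2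
    exact (Submodule.finrank_mono hle).trans h2

/-- By the orthogonal expansion, `T` maps each block into itself, so it commutes with the
projections. -/
theorem ad_blockProj_eq_zero (horth : ∀ a b, a ≠ b → β (e a) (e b) = 0)
    (hne : ∀ a, β (e a) (e a) ≠ 0) (hcard : Fintype.card (κ × Fin 3) = finrank ℝ L)
    {T : L →L[ℝ] L} (hT : ∀ i j k l, i ≠ j → β (T (e (i, k))) (e (j, l)) = 0) (i : κ) :
    ad (blockProj β e i) T = 0 := by
  have h0 : ∀ j k, ad (blockProj β e i) T (e (j, k)) = 0 := by
    intro j k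
    rw [ad_apply, ContinuousLinearMap.sub_apply, clm_mul_apply, clm_mul_apply]
    by_cases hij : i = j
    · subst hij
      rw [blockProj_self horth hne]
      conv_lhs => rw [← sum_orthogonal_expansion horth hne hcard (T (e (i, k)))]
      rw [Fintype.sum_prod_type, Finset.sum_eq_single i, map_sum, sub_eq_zero]
      · simp only [map_smul, blockProj_self horth hne]
      · intro j _ hj
        refine Finset.sum_eq_zero fun l _ => ?_
        rw [hT i j k l hj.symm, zero_div, zero_smul]
      · simp
    · rw [blockProj_eq_zero fun l => hT j i k l (Ne.symm hij),
        blockProj_eq_zero fun l => horth _ _ (by simp [Ne.symm hij]), map_zero, sub_zero]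
  ext x
  rw [← sum_orthogonal_expansion horth hne hcard x, map_sum]
  simp only [map_smul, h0, smul_zero, Finset.sum_const_zero, ContinuousLinearMap.zero_apply]

end Frames

/-! ### The adapted frame at a point where a regular vector exists. -/

section AdaptedFrame

open Module

variable {E L : Type*} [NormedAddCommGroup E] [NormedSpace ℝ E] [FiniteDimensional ℝ E]
  [NormedAddCommGroup L] [NormedSpace ℝ L] [FiniteDimensional ℝ L]
  {β : L →L[ℝ] L →L[ℝ] ℝ} {F : E → L} {U : Set E} {J : E → E →L[ℝ] E} {y : E}
  {κ : Type*} [Fintype κ] [DecidableEq κ]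

/-- The vectors `X i` diagonalize the second fundamental form at `y` over the complex numbers. -/
structure IsDiagonal (β : L →L[ℝ] L →L[ℝ] ℝ) (F : E → L) (J : E → E →L[ℝ] E) (y : E) (X : κ → E) :
    Prop where
  ne_zero : ∀ i, X i ≠ 0
  sff_J_J : ∀ u v, sff β F y (J y u) (J y v) = sff β F y u v
  sff_eq_zero : ∀ i j, i ≠ j → sff β F y (X i) (X j) = 0
  sff_J_eq_zero : ∀ i j, i ≠ j → sff β F y (X i) (J y (X j)) = 0
  orthogonal : ∀ i j, i ≠ j → β (sff β F y (X i) (X i)) (sff β F y (X j) (X j)) = 0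
  ne : ∀ i, β (sff β F y (X i) (X i)) (sff β F y (X i) (X i)) ≠ 0

theorem HyperbolicKaehler.exists_isDiagonal (H : HyperbolicKaehler β U F J) (hy : y ∈ U) {k : ℕ}
    (hL : finrank ℝ L = finrank ℝ E + k) (hE : 2 * k ≤ finrank ℝ E) {Z : E}
    (hZ : Regular β F J y Z) :
    finrank ℝ E = 2 * k ∧ ∃ X : Fin k → E, IsDiagonal β F J y X := by
  have hW := H.finrank_normalSpace hy
  obtain rfl : finrank ℝ (normalSpace β F y) = k := by omega
  obtain ⟨h1, h2, X, hX0, hX1, hX2, hX3⟩ :=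
    (H.kaehlerPoint hy).exists_diagonal ((H.isRegular_iff hy Z).2 hZ) hE
  exact ⟨h1, X, hX0, fun u v => congrArg Subtype.val (h2 u v),
    fun i j hij => congrArg Subtype.val (hX1 i j hij).1,
    fun i j hij => congrArg Subtype.val (hX1 i j hij).2, fun i j hij => hX2 i j hij,
    fun i => hX3 i⟩

variable (β F J) in
/-- The three vectors `α(X i, X i)`, `F_* X i` and `F_* J X i`. -/
def diagonalFrame (y : E) (X : κ → E) (a : κ × Fin 3) : L :=
  ![sff β F y (X a.1) (X a.1), fderiv ℝ F y (X a.1), fderiv ℝ F y (J y (X a.1))] a.2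

theorem diagonalFrame_apply (X : κ → E) (i : κ) :
    diagonalFrame β F J y X (i, 0) = sff β F y (X i) (X i) ∧
    diagonalFrame β F J y X (i, 1) = fderiv ℝ F y (X i) ∧
    diagonalFrame β F J y X (i, 2) = fderiv ℝ F y (J y (X i)) := ⟨rfl, rfl, rfl⟩

theorem IsDiagonal.comp {κ' : Type*} {X : κ → E} (h : IsDiagonal β F J y X)
    (σ : κ' → κ) (hσ : Function.Injective σ) : IsDiagonal β F J y (X ∘ σ) where
  ne_zero i := h.ne_zero _
  sff_J_J := h.sff_J_J
  sff_eq_zero i j hij := h.sff_eq_zero _ _ (hσ.ne hij)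
  sff_J_eq_zero i j hij := h.sff_J_eq_zero _ _ (hσ.ne hij)
  orthogonal i j hij := h.orthogonal _ _ (hσ.ne hij)
  ne i := h.ne _

namespace IsDiagonal

variable {X : κ → E}

theorem sff_J_left (h : IsDiagonal β F J y X) (H : HyperbolicKaehler β U F J) (hy : y ∈ U) (u v : E) :
    sff β F y (J y u) v = -sff β F y u (J y v) := by
  rw [← h.sff_J_J (J y u) v, H.J_J y hy]
  simp [sff]

theorem sff_J_self (h : IsDiagonal β F J y X) (H : HyperbolicKaehler β U F J) (hy : y ∈ U) (u : E) :
    sff β F y u (J y u) = 0 := by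
  have h1 := h.sff_J_left H hy u u
  rw [H.sff_comm hy] at h1
  have h2 : (2 : ℝ) • sff β F y u (J y u) = 0 := by
    rw [two_smul]; nth_rw 1 [h1]; exact neg_add_cancel _
  exact (smul_eq_zero.1 h2).resolve_left two_ne_zero

theorem metric_eq_zero (h : IsDiagonal β F J y X) (H : HyperbolicKaehler β U F J) (hy : y ∈ U)
    {i j : κ} (hij : i ≠ j) :
    β (fderiv ℝ F y (X i)) (fderiv ℝ F y (X j)) = 0 ∧
      β (fderiv ℝ F y (X i)) (fderiv ℝ F y (J y (X j))) = 0 := by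
  constructor
  · have := H.beta_sff_self hy (X i) (X j)
    rw [h.sff_eq_zero i j hij, map_zero, ContinuousLinearMap.zero_apply] at this
    linarith
  · have := H.beta_sff_self hy (X i) (J y (X j))
    rw [h.sff_J_eq_zero i j hij, map_zero, ContinuousLinearMap.zero_apply] at this
    linarith

theorem frame_orthogonal (h : IsDiagonal β F J y X) (H : HyperbolicKaehler β U F J) (hy : y ∈ U)
    (a b : κ × Fin 3) (hab : a ≠ b) :
    β (diagonalFrame β F J y X a) (diagonalFrame β F J y X b) = 0 := by
  obtain ⟨i, k⟩ := a
  obtain ⟨j, l⟩ := b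
  have hn : ∀ u v w, β (fderiv ℝ F y w) (sff β F y u v) = 0 := fun u v w => by
    rw [H.symm, H.beta_sff hy]
  have hJ : ∀ u, β (fderiv ℝ F y u) (fderiv ℝ F y (J y u)) = 0 := (H.kaehlerPoint hy).g_J_self
  by_cases hij : i = j
  · subst hij
    have hkl : k ≠ l := fun hkl => hab (by rw [hkl])
    fin_cases k <;> fin_cases l <;>
      first
      | exact absurd rfl hkl
      | exact H.beta_sff hy _ _ _
      | exact hn _ _ _
      | exact hJ _
      | exact (H.symm _ _).trans (hJ _)
  · have g1 := fun {i j} (hij : i ≠ j) => (h.metric_eq_zero H hy hij).1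
    have g2 := fun {i j} (hij : i ≠ j) => (h.metric_eq_zero H hy hij).2
    fin_cases k <;> fin_cases l <;>
      first
      | exact h.orthogonal i j hij
      | exact H.beta_sff hy _ _ _
      | exact hn _ _ _
      | exact g1 hij
      | exact g2 hij
      | exact (H.symm _ _).trans (g2 (Ne.symm hij))
      | exact (H.orth y hy _ _).trans (g1 hij)

theorem frame_pos (h : IsDiagonal β F J y X) (H : HyperbolicKaehler β U F J) (hy : y ∈ U)
    (i : κ) {k : Fin 3} (hk : k ≠ 0) :
    0 < β (diagonalFrame β F J y X (i, k)) (diagonalFrame β F J y X (i, k)) := by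
  have hpos := H.pos y hy (X i) (h.ne_zero i)
  fin_cases k
  · exact absurd rfl hk
  · exact hpos
  · exact hpos.trans_eq (H.orth y hy _ _).symm

theorem frame_ne (h : IsDiagonal β F J y X) (H : HyperbolicKaehler β U F J) (hy : y ∈ U)
    (a : κ × Fin 3) : β (diagonalFrame β F J y X a) (diagonalFrame β F J y X a) ≠ 0 := by
  obtain ⟨i, k⟩ := a
  by_cases hk : k = 0
  · subst hk
    exact h.ne i
  · exact (h.frame_pos H hy i hk).ne'

/-- The vectors `X i`, `J X i` form an orthogonal basis of `E`; expand `v` in it, and diagonality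
leaves only the terms with index `j`. -/
theorem sff_eq_smul (h : IsDiagonal β F J y X) (H : HyperbolicKaehler β U F J) (hy : y ∈ U)
    (hcard : Fintype.card (κ × Fin 3) = finrank ℝ L) (v : E) (j : κ) :
    (∃ r : ℝ, sff β F y v (X j) = r • sff β F y (X j) (X j)) ∧
      ∃ r : ℝ, sff β F y v (J y (X j)) = r • sff β F y (X j) (X j) := by
  have hv := sum_orthogonal_expansion (h.frame_orthogonal H hy) (h.frame_ne H hy) hcard
    (fderiv ℝ F y v)
  rw [Fintype.sum_prod_type] at hv
  simp only [Fin.sum_univ_three, (diagonalFrame_apply X _).1, (diagonalFrame_apply X _).2.1,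
    (diagonalFrame_apply X _).2.2, H.symm (fderiv ℝ F y v), H.beta_sff hy, zero_div, zero_smul,
    zero_add, ← map_smul, ← map_add, ← map_sum] at hv
  have hv' := H.injective_fderiv hy hv
  generalize hr : (fun i => β (fderiv ℝ F y (X i)) (fderiv ℝ F y v)
    / β (fderiv ℝ F y (X i)) (fderiv ℝ F y (X i))) = r at hv'
  generalize hs : (fun i => β (fderiv ℝ F y (J y (X i))) (fderiv ℝ F y v)
    / β (fderiv ℝ F y (J y (X i))) (fderiv ℝ F y (J y (X i)))) = s at hv'
  have hexp : ∀ w, sff β F y v w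
      = ∑ i, (r i • sff β F y (X i) w + s i • sff β F y (J y (X i)) w) := by
    intro w
    rw [← hv', ← hr, ← hs]
    simp only [sff, map_sum, map_add, map_smul, ContinuousLinearMap.sum_apply,
      ContinuousLinearMap.add_apply, ContinuousLinearMap.smul_apply]
  constructor
  · refine ⟨r j, ?_⟩
    rw [hexp, Finset.sum_eq_single j]
    · rw [h.sff_J_left H hy, h.sff_J_self H hy]; simp
    · intro i _ hij
      rw [h.sff_J_left H hy, h.sff_eq_zero i j hij, h.sff_J_eq_zero i j hij]; simp
    · simp
  · refine ⟨s j, ?_⟩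
    rw [hexp, Finset.sum_eq_single j]
    · rw [h.sff_J_J, h.sff_J_self H hy]; simp
    · intro i _ hij
      rw [h.sff_J_J, h.sff_eq_zero i j hij, h.sff_J_eq_zero i j hij]; simp
    · simp

theorem beta_tau_frame (h : IsDiagonal β F J y X) (H : HyperbolicKaehler β U F J) (hy : y ∈ U)
    (i j : κ) (k l : Fin 3) (hij : i ≠ j) :
    β (tau β F y (diagonalFrame β F J y X (i, k))) (diagonalFrame β F J y X (j, l)) = 0 := by
  have ho := fun k' => h.frame_orthogonal H hy (i, k') (j, l) (by simp [hij])
  fin_cases k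
  · change β (tau β F y (sff β F y (X i) (X i))) _ = 0
    rw [H.tau_sff hy, map_zero, ContinuousLinearMap.zero_apply]
  · change β (tau β F y (fderiv ℝ F y (X i))) _ = 0
    rw [H.tau_apply hy]
    exact ho 1
  · change β (tau β F y (fderiv ℝ F y (J y (X i)))) _ = 0
    rw [H.tau_apply hy]
    exact ho 2

theorem beta_Jhat_frame (h : IsDiagonal β F J y X) (H : HyperbolicKaehler β U F J) (hy : y ∈ U)
    (i j : κ) (k l : Fin 3) (hij : i ≠ j) :
    β (Jhat β F J y (diagonalFrame β F J y X (i, k))) (diagonalFrame β F J y X (j, l)) = 0 := by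
  have ho := fun k' => h.frame_orthogonal H hy (i, k') (j, l) (by simp [hij])
  fin_cases k
  · change β (fderiv ℝ F y (J y (rho β F y (sff β F y (X i) (X i))))) _ = 0
    rw [mem_normalSpace.1 (H.sff_mem hy _ _)]
    simp
  · change β (Jhat β F J y (fderiv ℝ F y (X i))) _ = 0
    rw [H.Jhat_apply hy]
    exact ho 2
  · change β (Jhat β F J y (fderiv ℝ F y (J y (X i)))) _ = 0
    rw [H.Jhat_apply hy, H.J_J y hy, map_neg, map_neg, ContinuousLinearMap.neg_apply, neg_eq_zero]
    exact ho 1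

/-- On tangent frame vectors `dTau` is `α`, which stays in the block by `sff_eq_smul`. Normal
against tangent follows by self-adjointness, and normal against normal vanishes because `dTau` maps
normal to tangent vectors. -/
theorem beta_dTau_frame (h : IsDiagonal β F J y X) (H : HyperbolicKaehler β U F J) (hy : y ∈ U)
    (hcard : Fintype.card (κ × Fin 3) = finrank ℝ L) (v : E)
    (i j : κ) (k l : Fin 3) (hij : i ≠ j) :
    β (dTau β F y v (diagonalFrame β F J y X (i, k))) (diagonalFrame β F J y X (j, l)) = 0 := by
  have tang : ∀ i j k (l : Fin 3), i ≠ j → k ≠ 0 →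
      β (dTau β F y v (diagonalFrame β F J y X (i, k))) (diagonalFrame β F J y X (j, l)) = 0 := by
    intro i j k l hij hk
    have ho := h.frame_orthogonal H hy (i, 0) (j, l) (by simp [hij])
    fin_cases k
    · exact absurd rfl hk
    · obtain ⟨r, hr⟩ := (h.sff_eq_smul H hy hcard v i).1
      change β (sff β F y v (X i)) _ = 0
      rw [hr, map_smul, ContinuousLinearMap.smul_apply]
      exact smul_eq_zero_of_right r ho
    · obtain ⟨r, hr⟩ := (h.sff_eq_smul H hy hcard v i).2
      change β (sff β F y v (J y (X i))) _ = 0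
      rw [hr, map_smul, ContinuousLinearMap.smul_apply]
      exact smul_eq_zero_of_right r ho
  by_cases hk : k = 0
  · by_cases hl : l = 0
    · subst hk hl
      have h0 : ∀ i, tau β F y (diagonalFrame β F J y X (i, 0)) = 0 := fun i =>
        H.tau_sff hy (X i) (X i)
      have h1 := congrArg (fun T : L →L[ℝ] L => T (diagonalFrame β F J y X (i, 0)))
        (H.dTau_eq hy v)
      simp only [ContinuousLinearMap.add_apply, clm_mul_apply, h0, map_zero, add_zero, zero_add] at h1
      rw [h1, H.beta_tau hy, h0, map_zero]
    · rw [H.beta_dTau hy, H.symm]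
      exact tang j i l k (Ne.symm hij) hl
  · exact tang i j k l hij hk

/-- The position vector has norm `-1`, so some frame vector is timelike, and only a normal one can
be. A vector orthogonal to a timelike one has nonnegative square, so there is no second. -/
theorem exists_timelike (h : IsDiagonal β F J y X) (H : HyperbolicKaehler β U F J) (hy : y ∈ U)
    (hcard : Fintype.card (κ × Fin 3) = finrank ℝ L) :
    ∃ i, β (sff β F y (X i) (X i)) (sff β F y (X i) (X i)) < 0 ∧
      ∀ j, j ≠ i → 0 < β (sff β F y (X j) (X j)) (sff β F y (X j) (X j)) := by
  have hex : ∃ i, β (sff β F y (X i) (X i)) (sff β F y (X i) (X i)) < 0 := by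
    by_contra! hcon
    have hall : ∀ a, 0 ≤ β (diagonalFrame β F J y X a) (diagonalFrame β F J y X a) := by
      rintro ⟨i, k⟩
      by_cases hk : k = 0
      · subst hk
        exact hcon i
      · exact (h.frame_pos H hy i hk).le
    have hF := congrArg (fun x => β x (F y)) (sum_orthogonal_expansion (h.frame_orthogonal H hy)
      (h.frame_ne H hy) hcard (F y))
    simp only [map_sum, map_smul, ContinuousLinearMap.sum_apply, ContinuousLinearMap.smul_apply,
      smul_eq_mul, H.norm_eq y hy, H.symm (F y)] at hF
    have : 0 ≤ ∑ a, β (diagonalFrame β F J y X a) (F y)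
        / β (diagonalFrame β F J y X a) (diagonalFrame β F J y X a)
        * β (diagonalFrame β F J y X a) (F y) := by
      refine Finset.sum_nonneg fun a _ => ?_
      rw [div_mul_eq_mul_div]
      exact div_nonneg (mul_self_nonneg _) (hall a)
    linarith
  obtain ⟨i, hi⟩ := hex
  exact ⟨i, hi, fun j hj =>
    lt_of_le_of_ne (H.nonneg _ _ hi (h.orthogonal j i hj)) (h.ne j).symm⟩

end IsDiagonal

/-- A frame of `L` that is orthonormal for the Lorentzian form `β`, whose blocks of three vectors are
invariant under the projection to the tangent space, its derivative and the complex structure at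
`y`, and such that the position vector has a negative product with the first vector of each block and
is orthogonal to the others. -/
structure AdaptedFrame {p : ℕ} (β : L →L[ℝ] L →L[ℝ] ℝ) (F : E → L) (J : E → E →L[ℝ] E) (y : E)
    (b : Fin (p + 1) × Fin 3 → L) : Prop where
  orthogonal : ∀ a a', a ≠ a' → β (b a) (b a') = 0
  norm_eq : ∀ a, β (b a) (b a) = if a = (0, 0) then -1 else 1
  ad_tau : ∀ i, ad (blockProj β b i) (tau β F y) = 0
  ad_dTau : ∀ i v, ad (blockProj β b i) (dTau β F y v) = 0
  ad_Jhat : ∀ i, ad (blockProj β b i) (Jhat β F J y) = 0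
  beta_self_neg : ∀ i, β (b (i, 0)) (F y) < 0
  beta_self_eq_zero : ∀ i k, k ≠ 0 → β (b (i, k)) (F y) = 0

theorem HyperbolicKaehler.exists_adaptedFrame (H : HyperbolicKaehler β U F J) (hy : y ∈ U) {p : ℕ}
    (hL : finrank ℝ L = finrank ℝ E + (p + 1)) (hE : 2 * (p + 1) ≤ finrank ℝ E) {Z : E}
    (hZ : Regular β F J y Z) :
    finrank ℝ E = 2 * (p + 1) ∧ ∃ b : Fin (p + 1) × Fin 3 → L, AdaptedFrame β F J y b := by
  obtain ⟨hE', X₀, hX₀⟩ := H.exists_isDiagonal hy hL hE hZ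
  refine ⟨hE', ?_⟩
  have hcard : Fintype.card (Fin (p + 1) × Fin 3) = finrank ℝ L := by
    rw [Fintype.card_prod, Fintype.card_fin, Fintype.card_fin]
    omega
  obtain ⟨i₀, hi₀, hpos₀⟩ := hX₀.exists_timelike H hy hcard
  -- Renumbering puts the timelike vector at index `(0, 0)`, the time coordinate of the model.
  have hσ := (Equiv.swap 0 i₀).injective
  have hX := hX₀.comp _ hσ
  have hneg : β (diagonalFrame β F J y (X₀ ∘ Equiv.swap 0 i₀) (0, 0))
      (diagonalFrame β F J y (X₀ ∘ Equiv.swap 0 i₀) (0, 0)) < 0 := by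
    rw [(diagonalFrame_apply _ _).1, Function.comp_apply, Equiv.swap_apply_left]
    exact hi₀
  have hpos : ∀ a, a ≠ (0, 0) → 0 < β (diagonalFrame β F J y (X₀ ∘ Equiv.swap 0 i₀) a)
      (diagonalFrame β F J y (X₀ ∘ Equiv.swap 0 i₀) a) := by
    rintro ⟨i, k⟩ ha
    by_cases hk : k = 0
    · subst hk
      have hi : i ≠ 0 := fun hi => ha (by rw [hi])
      exact hpos₀ _ fun h => hi (hσ (h.trans (Equiv.swap_apply_left 0 i₀).symm))
    · exact hX.frame_pos H hy i hk
  generalize X₀ ∘ Equiv.swap 0 i₀ = X at hX hneg hpos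
  set e := diagonalFrame β F J y X with he
  have hne := hX.frame_ne H hy
  have horth := hX.frame_orthogonal H hy
  let r : Fin (p + 1) × Fin 3 → ℝ := fun a => (√|β (e a) (e a)|)⁻¹
  have hr : ∀ a, 0 < r a := fun a => inv_pos.2 (Real.sqrt_pos.2 (abs_pos.2 (hne a)))
  have hr2 : ∀ a, r a * (r a * |β (e a) (e a)|) = 1 := by
    intro a
    have h1 := Real.mul_self_sqrt (abs_nonneg (β (e a) (e a)))
    have h2 : √|β (e a) (e a)| ≠ 0 := (Real.sqrt_pos.2 (abs_pos.2 (hne a))).ne'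
    simp only [r]
    nth_rw 3 [← h1]
    field_simp
  have hb : ∀ a a', β (r a • e a) (r a' • e a') = r a * (r a' * β (e a) (e a')) := by
    intro a a'
    simp only [map_smul, ContinuousLinearMap.smul_apply, smul_eq_mul]
    ring
  have ho : ∀ a a', a ≠ a' → β (r a • e a) (r a' • e a') = 0 := fun a a' h => by
    rw [hb, horth a a' h, mul_zero, mul_zero]
  have hn : ∀ a, β (r a • e a) (r a • e a) = if a = (0, 0) then -1 else 1 := by
    intro a
    have h2 := hr2 a
    rw [hb]
    split_ifs with ha
    · subst ha
      rw [abs_of_neg hneg] at h2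
      linarith
    · rw [abs_of_pos (hpos a ha)] at h2
      exact h2
  have hn0 : ∀ a, β (r a • e a) (r a • e a) ≠ 0 := by
    intro a
    rw [hn]
    split_ifs <;> norm_num
  have hT : ∀ T : L →L[ℝ] L, (∀ i j k l, i ≠ j → β (T (e (i, k))) (e (j, l)) = 0) → ∀ i,
      ad (blockProj β (fun a => r a • e a) i) T = 0 := by
    intro T hT
    refine ad_blockProj_eq_zero ho hn0 hcard fun i j k l hij => ?_
    simp only [map_smul, ContinuousLinearMap.smul_apply, hT i j k l hij, smul_zero]
  refine ⟨fun a => r a • e a, ho, hn, hT _ (hX.beta_tau_frame H hy),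
    fun i v => hT _ (hX.beta_dTau_frame H hy hcard v) i, hT _ (hX.beta_Jhat_frame H hy), ?_, ?_⟩
  · intro i
    have h1 : β (e (i, 0)) (F y) = -β (fderiv ℝ F y (X i)) (fderiv ℝ F y (X i)) :=
      H.beta_sff_self hy _ _
    rw [map_smul, ContinuousLinearMap.smul_apply, h1, smul_neg, smul_eq_mul]
    exact neg_neg_of_pos (mul_pos (hr _) (H.pos y hy _ (hX.ne_zero i)))
  · intro i k hk
    have h1 : ∀ v, β (fderiv ℝ F y v) (F y) = 0 := fun v => by rw [H.symm, H.beta_fderiv hy]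
    have h2 : β (e (i, k)) (F y) = 0 := by
      fin_cases k
      · exact absurd rfl hk
      · exact h1 _
      · exact h1 _
    rw [map_smul, ContinuousLinearMap.smul_apply, h2, smul_zero]

end AdaptedFrame

/-! ### The Gauss equation. -/

section Gauss

variable {E L : Type*} [NormedAddCommGroup E] [NormedSpace ℝ E] [FiniteDimensional ℝ E]
  [NormedAddCommGroup L] [NormedSpace ℝ L] [FiniteDimensional ℝ L]
  {β : L →L[ℝ] L →L[ℝ] ℝ} {F : E → L} {U : Set E} {y : E}

namespace LocalImmersion

/-- Isolates the third derivative of `F`, which is symmetric in `u` and `v` and so drops out of the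
curvature. -/
theorem fderiv_gam (H : LocalImmersion β U F) (hy : y ∈ U) (u v w : E) :
    fderiv ℝ (fun z => Gam β F z v w) y u + Gam β F y u (Gam β F y v w)
      = rho β F y (fderiv ℝ (fderiv ℝ (fderiv ℝ F)) y u v w + dTau β F y u (sff β F y v w)) := by
  have hρ := (H.differentiableAt H.contDiffOn_rho hy).hasFDerivAt
  have hF2 := (H.differentiableAt
    (H.contDiffOn_fderiv.fderiv_of_isOpen (m := ∞) H.isOpen (by simp)) hy).hasFDerivAt
  have hd := hρ.clm_apply ((hF2.clm_apply (hasFDerivAt_const v y)).clm_apply (hasFDerivAt_const w y))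
  have h1 : fderiv ℝ (fun z => Gam β F z v w) y u
      = rho β F y (fderiv ℝ (fderiv ℝ (fderiv ℝ F)) y u v w)
        + fderiv ℝ (rho β F) y u (fderiv ℝ (fderiv ℝ F) y v w) := by
    refine (congrArg (fun T : E →L[ℝ] E => T u) hd.fderiv).trans ?_
    simp
  have h2 : rho β F y (sff β F y u (Gam β F y v w)) = 0 := mem_normalSpace.1 (H.sff_mem hy _ _)
  have h3 : ∀ x, rho β F y (skew β F y u x) = -rho β F y (dTau β F y u x) := fun x =>
    congrArg (fun T : L →L[ℝ] E => T x) (H.rho_skew hy u)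
  rw [h1, H.fderiv_rho hy]
  simp only [ContinuousLinearMap.sub_apply, ContinuousLinearMap.neg_apply,
    ContinuousLinearMap.comp_apply, h3]
  rw [show rho β F y (fderiv ℝ (fderiv ℝ F) y v w) = Gam β F y v w from rfl,
    H.fderiv_fderiv_apply hy, map_add, map_add,
    show dTau β F y u (fderiv ℝ F y (Gam β F y v w)) = sff β F y u (Gam β F y v w) from rfl, h2,
    map_add]
  abel

/-- The Gauss equation. -/
theorem gauss (H : LocalImmersion β U F) (hy : y ∈ U) (u v w z : E) :
    β (fderiv ℝ F y ((fderiv ℝ (fun z => Gam β F z v w) y u + Gam β F y u (Gam β F y v w))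
        - (fderiv ℝ (fun z => Gam β F z u w) y v + Gam β F y v (Gam β F y u w)))) (fderiv ℝ F y z)
      = β (sff β F y v w) (sff β F y u z) - β (sff β F y u w) (sff β F y v z) := by
  rw [H.fderiv_gam hy, H.fderiv_gam hy, ← map_sub,
    H.fderiv_fderiv_comm H.contDiffOn_fderiv hy u v, add_sub_add_left_eq_sub]
  change β (tau β F y _) _ = _
  rw [H.beta_tau hy, H.tau_apply hy, map_sub, ContinuousLinearMap.sub_apply, H.beta_dTau hy,
    H.beta_dTau hy]
  rfl

end LocalImmersion

end Gauss

/-! ### From the manifold to the local theory in a chart. -/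

section ChartTranslation

open Module

variable {d : ℕ} {M : Type*} [TopologicalSpace M] [ChartedSpace (EuclideanSpace ℝ (Fin d)) M]
  [IsManifold (𝓡 d) ∞ M]

theorem mdifferentiable_chartAt (x : M) :
    (chartAt (EuclideanSpace ℝ (Fin d)) x).MDifferentiable (𝓡 d) (𝓡 d) :=
  haveI : IsManifold (𝓡 d) 1 M := IsManifold.of_le (n := ∞) ENat.LEInfty.out
  mdifferentiable_chart x

theorem toCoord_ofCoord {e : OpenPartialHomeomorph M (EuclideanSpace ℝ (Fin d))}
    (he : e.MDifferentiable (𝓡 d) (𝓡 d)) {y : EuclideanSpace ℝ (Fin d)} (hy : y ∈ e.target)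
    (u : EuclideanSpace ℝ (Fin d)) : toCoord e (e.symm y) (ofCoord e y u) = u :=
  congrArg (fun T : EuclideanSpace ℝ (Fin d) →L[ℝ] EuclideanSpace ℝ (Fin d) => T u)
    (he.comp_symm_deriv hy)

theorem ofCoord_toCoord {e : OpenPartialHomeomorph M (EuclideanSpace ℝ (Fin d))}
    (he : e.MDifferentiable (𝓡 d) (𝓡 d)) {y : EuclideanSpace ℝ (Fin d)} (hy : y ∈ e.target)
    (v : TangentSpace (𝓡 d) (e.symm y)) : ofCoord e y (toCoord e (e.symm y) v) = v := by
  obtain ⟨x, hx, rfl⟩ : ∃ x ∈ e.source, e x = y := ⟨e.symm y, e.map_target hy, e.right_inv hy⟩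
  have h := congrArg (fun T : EuclideanSpace ℝ (Fin d) →L[ℝ] EuclideanSpace ℝ (Fin d) => T v)
    (he.symm_comp_deriv hx)
  have hx' := e.left_inv hx
  unfold ofCoord toCoord
  rw [hx']
  exact h

/-- A field of endomorphisms in the chart `e`, as a field of linear maps. -/
def chartEndo (J : ∀ x : M, TangentSpace (𝓡 d) x →L[ℝ] TangentSpace (𝓡 d) x)
    (e : OpenPartialHomeomorph M (EuclideanSpace ℝ (Fin d))) (y : EuclideanSpace ℝ (Fin d)) :
    EuclideanSpace ℝ (Fin d) →L[ℝ] EuclideanSpace ℝ (Fin d) :=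
  (mfderiv (𝓡 d) (𝓡 d) e (e.symm y)).comp
    ((J (e.symm y)).comp (mfderiv (𝓡 d) (𝓡 d) e.symm y))

theorem chartEndo_apply (J : ∀ x : M, TangentSpace (𝓡 d) x →L[ℝ] TangentSpace (𝓡 d) x)
    (e : OpenPartialHomeomorph M (EuclideanSpace ℝ (Fin d))) (y u : EuclideanSpace ℝ (Fin d)) :
    chartEndo J e y u = coordEndo J e y u := rfl

/-- Smoothness of `J` as a section of the endomorphism bundle is smoothness of its expression in the
trivialization at `x`, which over the chart domain is `chartEndo`. -/
theorem contDiffOn_chartEndo (K : KaehlerStructure d M) (x : M) :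
    ContDiffOn ℝ ∞ (chartEndo K.J (chartAt (EuclideanSpace ℝ (Fin d)) x))
      (chartAt (EuclideanSpace ℝ (Fin d)) x).target := by
  haveI : IsManifold (𝓡 d) 1 M := IsManifold.of_le (n := ∞) ENat.LEInfty.out
  set e := chartAt (EuclideanSpace ℝ (Fin d)) x with he
  have h1 : ContMDiffOn (𝓡 d) 𝓘(ℝ, EuclideanSpace ℝ (Fin d) →L[ℝ] EuclideanSpace ℝ (Fin d)) ∞
      (fun z : M => ContinuousLinearMap.inCoordinates (EuclideanSpace ℝ (Fin d))
        (fun x : M => TangentSpace (𝓡 d) x) (EuclideanSpace ℝ (Fin d))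
        (fun x : M => TangentSpace (𝓡 d) x) x z x z (K.J z)) e.source := by
    intro z hz
    have h2 := ((trivializationAt (EuclideanSpace ℝ (Fin d) →L[ℝ] EuclideanSpace ℝ (Fin d))
      (fun x : M => TangentSpace (𝓡 d) x →L[ℝ] TangentSpace (𝓡 d) x) x).contMDiffAt_section_iff
      (IB := 𝓡 d) (n := ∞) (s := K.J) (x₀ := z) (by
        rw [hom_trivializationAt_baseSet]; exact ⟨hz, hz⟩)).1 (K.contMDiff_J z)
    exact h2.contMDiffWithinAt
  have h2 : ContMDiffOn (𝓡 d) (𝓡 d) ∞ e.symm e.target := contMDiffOn_chart_symm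
  have h3 := h1.comp h2 fun y hy => e.map_target hy
  refine contMDiffOn_iff_contDiffOn.1 (h3.congr fun y hy => ?_)
  simp only [Function.comp_apply, ContinuousLinearMap.inCoordinates]
  rw [TangentBundle.continuousLinearMapAt_trivializationAt (e.map_target hy),
    TangentBundle.symmL_trivializationAt (e.map_target hy)]
  unfold chartEndo
  have h4 : (extChartAt (𝓡 d) x : M → EuclideanSpace ℝ (Fin d)) = e := rfl
  have h5 : ((extChartAt (𝓡 d) x).symm : EuclideanSpace ℝ (Fin d) → M) = e.symm := rfl
  rw [ModelWithCorners.range_eq_univ, mfderivWithin_univ, h4, h5, e.right_inv hy]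
  rfl

/-- The immersion in the chart `e`. -/
def chartMap {N : ℕ} (f : M → HyperbolicSpace N)
    (e : OpenPartialHomeomorph M (EuclideanSpace ℝ (Fin d))) (y : EuclideanSpace ℝ (Fin d)) :
    Fin (N + 1) → ℝ := f (e.symm y)

variable {N : ℕ} {f : M → HyperbolicSpace N} {g : RiemMetric d M} {x : M}
  {y : EuclideanSpace ℝ (Fin d)}

theorem IsIsometricImmersion.contDiffOn (hf : IsIsometricImmersion g f) (x : M) :
    ContDiffOn ℝ ∞ (chartMap f (chartAt (EuclideanSpace ℝ (Fin d)) x))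
      (chartAt (EuclideanSpace ℝ (Fin d)) x).target := by
  have h2 : ContMDiffOn (𝓡 d) (𝓡 d) ∞ (chartAt (EuclideanSpace ℝ (Fin d)) x).symm
    (chartAt (EuclideanSpace ℝ (Fin d)) x).target := contMDiffOn_chart_symm
  exact contMDiffOn_iff_contDiffOn.1 (hf.contMDiff.comp_contMDiffOn h2)

theorem IsIsometricImmersion.fderiv_chartMap (hf : IsIsometricImmersion g f)
    (hy : y ∈ (chartAt (EuclideanSpace ℝ (Fin d)) x).target) (u : EuclideanSpace ℝ (Fin d)) :
    fderiv ℝ (chartMap f (chartAt (EuclideanSpace ℝ (Fin d)) x)) y u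
      = mfderiv (𝓡 d) 𝓘(ℝ, Fin (N + 1) → ℝ) (fun x => (f x : Fin (N + 1) → ℝ))
        ((chartAt (EuclideanSpace ℝ (Fin d)) x).symm y)
        (ofCoord (chartAt (EuclideanSpace ℝ (Fin d)) x) y u) := by
  have h := mfderiv_comp y
    ((hf.contMDiff.mdifferentiable (by simp)) ((chartAt (EuclideanSpace ℝ (Fin d)) x).symm y))
    ((mdifferentiable_chartAt x).mdifferentiableAt_symm hy)
  rw [← mfderiv_eq_fderiv]
  exact congrArg (fun T : EuclideanSpace ℝ (Fin d) →L[ℝ] (Fin (N + 1) → ℝ) => T u) h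

theorem IsIsometricImmersion.coordMetric_eq (hf : IsIsometricImmersion g f)
    (hy : y ∈ (chartAt (EuclideanSpace ℝ (Fin d)) x).target) (u v : EuclideanSpace ℝ (Fin d)) :
    coordMetric g (chartAt (EuclideanSpace ℝ (Fin d)) x) y u v
      = lorentzForm 0 (fderiv ℝ (chartMap f (chartAt (EuclideanSpace ℝ (Fin d)) x)) y u)
        (fderiv ℝ (chartMap f (chartAt (EuclideanSpace ℝ (Fin d)) x)) y v) := by
  rw [lorentzForm_apply, hf.fderiv_chartMap hy u, hf.fderiv_chartMap hy v]
  exact (hf.isometric _ _ _).symm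

theorem ofCoord_ne_zero {e : OpenPartialHomeomorph M (EuclideanSpace ℝ (Fin d))}
    (he : e.MDifferentiable (𝓡 d) (𝓡 d)) (hy : y ∈ e.target) {u : EuclideanSpace ℝ (Fin d)}
    (hu : u ≠ 0) : ofCoord e y u ≠ 0 := by
  intro h
  have h1 := toCoord_ofCoord he hy u
  rw [h] at h1
  exact hu (h1.symm.trans (map_zero (mfderiv (𝓡 d) (𝓡 d) e (e.symm y))))

theorem IsIsometricImmersion.localImmersion (hf : IsIsometricImmersion g f) (x : M) :
    LocalImmersion (lorentzForm 0) (chartAt (EuclideanSpace ℝ (Fin d)) x).target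
      (chartMap f (chartAt (EuclideanSpace ℝ (Fin d)) x)) where
  isOpen := (chartAt (EuclideanSpace ℝ (Fin d)) x).open_target
  symm := lorentz_comm 0
  smooth := hf.contDiffOn x
  pos y hy u hu := by
    rw [← hf.coordMetric_eq hy]
    exact g.pos _ _ (ofCoord_ne_zero (mdifferentiable_chartAt x) hy hu)

/-- Since `g(v, w) = ⟨dF v, dF w⟩`, the Koszul combination collapses, by symmetry of the second
derivative, to `⟨D²F(u, v), dF w⟩`, which only sees the tangential part. -/
theorem IsIsometricImmersion.christoffelLower_eq (hf : IsIsometricImmersion g f)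
    (hy : y ∈ (chartAt (EuclideanSpace ℝ (Fin d)) x).target) (u v w : EuclideanSpace ℝ (Fin d)) :
    christoffelLower g (chartAt (EuclideanSpace ℝ (Fin d)) x) y u v w
      = coordMetric g (chartAt (EuclideanSpace ℝ (Fin d)) x) y
        (Gam (lorentzForm 0) (chartMap f (chartAt (EuclideanSpace ℝ (Fin d)) x)) y u v) w := by
  have H := hf.localImmersion x
  set e := chartAt (EuclideanSpace ℝ (Fin d)) x
  set F := chartMap f e
  have hA := (H.differentiableAt H.contDiffOn_fderiv hy).hasFDerivAt
  have hd : ∀ u v w, fderiv ℝ (fun z => coordMetric g e z v w) y u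
      = lorentzForm 0 (fderiv ℝ (fderiv ℝ F) y u v) (fderiv ℝ F y w)
        + lorentzForm 0 (fderiv ℝ F y v) (fderiv ℝ (fderiv ℝ F) y u w) := by
    intro u v w
    rw [H.fderiv_congr (fun z hz => hf.coordMetric_eq hz v w) hy]
    have h1 := (((lorentzForm (0 : Fin (N + 1))).hasFDerivAt.comp y
      (hA.clm_apply (hasFDerivAt_const v y))).clm_apply (hA.clm_apply (hasFDerivAt_const w y)))
    refine (congrArg (fun T : EuclideanSpace ℝ (Fin d) →L[ℝ] ℝ => T u) h1.fderiv).trans ?_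
    simp [add_comm, F, e]
  have h2 := H.fderiv_fderiv_comm H.smooth hy
  have h3 : lorentzForm 0 (fderiv ℝ F y (Gam (lorentzForm 0) F y u v)) (fderiv ℝ F y w)
      = lorentzForm 0 (fderiv ℝ (fderiv ℝ F) y u v) (fderiv ℝ F y w) := by
    rw [H.fderiv_fderiv_apply hy, map_add, ContinuousLinearMap.add_apply, H.beta_sff hy, add_zero]
  rw [hf.coordMetric_eq hy, h3]
  unfold christoffelLower
  rw [hd, hd, hd, h2 v u, h2 w u, h2 w v, H.symm (fderiv ℝ F y v), H.symm (fderiv ℝ F y u)]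
  ring

theorem IsIsometricImmersion.gram_mulVec (hf : IsIsometricImmersion g f)
    (hy : y ∈ (chartAt (EuclideanSpace ℝ (Fin d)) x).target) (u : EuclideanSpace ℝ (Fin d))
    (l : Fin d) : (gram g (chartAt (EuclideanSpace ℝ (Fin d)) x) y).mulVec u.ofLp l
      = coordMetric g (chartAt (EuclideanSpace ℝ (Fin d)) x) y u (EuclideanSpace.single l (1 : ℝ)) := by
  have hu : u = ∑ k, u k • EuclideanSpace.single k (1 : ℝ) := by
    ext i
    simp [Pi.single_apply]
  conv_rhs => rw [hu]
  simp only [hf.coordMetric_eq hy, map_sum, map_smul, ContinuousLinearMap.sum_apply,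
    ContinuousLinearMap.smul_apply, smul_eq_mul, Matrix.mulVec, dotProduct, gram, Matrix.of_apply]
  refine Finset.sum_congr rfl fun k _ => ?_
  rw [(hf.localImmersion x).symm, mul_comm]

theorem IsIsometricImmersion.isUnit_det_gram (hf : IsIsometricImmersion g f)
    (hy : y ∈ (chartAt (EuclideanSpace ℝ (Fin d)) x).target) :
    IsUnit (gram g (chartAt (EuclideanSpace ℝ (Fin d)) x) y).det := by
  rw [← Matrix.isUnit_iff_isUnit_det, ← Matrix.mulVec_injective_iff_isUnit]
  refine (injective_iff_map_eq_zero (Matrix.mulVecLin _)).2 fun v hv => ?_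
  by_contra hne
  have hne' : WithLp.toLp 2 v ≠ 0 := fun h => hne (congrArg WithLp.ofLp h)
  have hpos := (hf.localImmersion x).pos y hy _ hne'
  have h0 : ∀ l, coordMetric g (chartAt (EuclideanSpace ℝ (Fin d)) x) y (WithLp.toLp 2 v)
      (EuclideanSpace.single l (1 : ℝ)) = 0 := fun l => by
    rw [← hf.gram_mulVec hy]
    exact congrFun hv l
  have hu : WithLp.toLp 2 v = ∑ k, v k • EuclideanSpace.single k (1 : ℝ) := by
    ext i
    simp [Pi.single_apply]
  have h1 : coordMetric g (chartAt (EuclideanSpace ℝ (Fin d)) x) y (WithLp.toLp 2 v)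
      (∑ k, v k • EuclideanSpace.single k (1 : ℝ)) = 0 := by
    simp only [hf.coordMetric_eq hy, map_sum, map_smul] at h0 ⊢
    exact Finset.sum_eq_zero fun k _ => by rw [h0, smul_zero]
  rw [← hu, hf.coordMetric_eq hy] at h1
  exact hpos.ne' h1

theorem IsIsometricImmersion.christoffel_eq (hf : IsIsometricImmersion g f)
    (hy : y ∈ (chartAt (EuclideanSpace ℝ (Fin d)) x).target) (u v : EuclideanSpace ℝ (Fin d)) :
    christoffel g (chartAt (EuclideanSpace ℝ (Fin d)) x) y u v
      = Gam (lorentzForm 0) (chartMap f (chartAt (EuclideanSpace ℝ (Fin d)) x)) y u v := by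
  unfold christoffel
  simp only [hf.christoffelLower_eq hy, ← hf.gram_mulVec hy]
  have h : ∀ w : Fin d → ℝ, (gram g (chartAt (EuclideanSpace ℝ (Fin d)) x) y)⁻¹.mulVec
      ((gram g (chartAt (EuclideanSpace ℝ (Fin d)) x) y).mulVec w) = w := fun w => by
    rw [Matrix.mulVec_mulVec, Matrix.nonsing_inv_mul _ (hf.isUnit_det_gram hy), Matrix.one_mulVec]
  exact congrArg (WithLp.toLp 2) (h _)

theorem IsIsometricImmersion.hyperbolicKaehler {K : KaehlerStructure d M}
    (hf : IsIsometricImmersion K.metric f) (x : M) :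
    HyperbolicKaehler (lorentzForm 0) (chartAt (EuclideanSpace ℝ (Fin d)) x).target
      (chartMap f (chartAt (EuclideanSpace ℝ (Fin d)) x))
      (chartEndo K.J (chartAt (EuclideanSpace ℝ (Fin d)) x)) where
  toLocalImmersion := hf.localImmersion x
  nondeg _ h := eq_zero_of_lorentz_eq_zero h
  smooth_J := contDiffOn_chartEndo K x
  J_J y hy u := by
    simp only [chartEndo_apply, coordEndo]
    rw [ofCoord_toCoord (mdifferentiable_chartAt x) hy, K.J_J]
    have h := toCoord_ofCoord (mdifferentiable_chartAt x) hy u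
    refine Eq.trans ?_ (congrArg Neg.neg h)
    exact map_neg (mfderiv (𝓡 d) (𝓡 d) _ _) _
  orth y hy u v := by
    rw [← hf.coordMetric_eq hy, ← hf.coordMetric_eq hy]
    simp only [chartEndo_apply, coordEndo, coordMetric]
    rw [ofCoord_toCoord (mdifferentiable_chartAt x) hy,
      ofCoord_toCoord (mdifferentiable_chartAt x) hy, K.inner_J_J]
  parallel y hy u := by
    have hJ := (((contDiffOn_chartEndo K x).contDiffAt
      ((chartAt (EuclideanSpace ℝ (Fin d)) x).open_target.mem_nhds hy)).differentiableAt
      (by simp)).hasFDerivAt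
    ext1 v
    have h1 := K.parallel_J _ (IsManifold.chart_mem_maximalAtlas x) y hy u v
    have h2 : fderiv ℝ (fun z => coordEndo K.J (chartAt (EuclideanSpace ℝ (Fin d)) x) z v) y u
        = fderiv ℝ (chartEndo K.J (chartAt (EuclideanSpace ℝ (Fin d)) x)) y u v := by
      have := (hJ.clm_apply (hasFDerivAt_const v y)).fderiv
      refine (congrArg (fun T : EuclideanSpace ℝ (Fin d) →L[ℝ] EuclideanSpace ℝ (Fin d) => T u)
        this).trans ?_
      simp
    unfold coordCovDeriv at h1
    rw [h2, hf.christoffel_eq hy, hf.christoffel_eq hy] at h1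
    rw [ContinuousLinearMap.sub_apply, ContinuousLinearMap.comp_apply,
      ContinuousLinearMap.comp_apply, chartEndo_apply, chartEndo_apply]
    rw [sub_eq_zero] at h1
    exact eq_sub_of_add_eq h1
  norm_eq y hy := by
    have h := (f ((chartAt (EuclideanSpace ℝ (Fin d)) x).symm y)).2.1
    exact h.trans (by norm_num)
  nonneg z w hw h := lorentz_self_nonneg_of_orthogonal (o := 0) (x := z) (z := w) hw h

theorem IsIsometricImmersion.coordCurvature_eq (hf : IsIsometricImmersion g f)
    (hy : y ∈ (chartAt (EuclideanSpace ℝ (Fin d)) x).target) (u v w z : EuclideanSpace ℝ (Fin d)) :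
    coordMetric g (chartAt (EuclideanSpace ℝ (Fin d)) x) y
        (coordCurvature g (chartAt (EuclideanSpace ℝ (Fin d)) x) y u v w) z
      = lorentzForm 0
          (sff (lorentzForm 0) (chartMap f (chartAt (EuclideanSpace ℝ (Fin d)) x)) y v w)
          (sff (lorentzForm 0) (chartMap f (chartAt (EuclideanSpace ℝ (Fin d)) x)) y u z)
        - lorentzForm 0
          (sff (lorentzForm 0) (chartMap f (chartAt (EuclideanSpace ℝ (Fin d)) x)) y u w)
          (sff (lorentzForm 0) (chartMap f (chartAt (EuclideanSpace ℝ (Fin d)) x)) y v z) := by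
  have H := hf.localImmersion x
  unfold coordCurvature
  rw [hf.coordMetric_eq hy, H.fderiv_congr (fun z hz => hf.christoffel_eq hz _ _) hy,
    H.fderiv_congr (fun z hz => hf.christoffel_eq hz _ _) hy]
  simp only [hf.christoffel_eq hy]
  exact H.gauss hy _ _ _ _

theorem coordEndo_toCoord (J : ∀ x : M, TangentSpace (𝓡 d) x →L[ℝ] TangentSpace (𝓡 d) x)
    {e : OpenPartialHomeomorph M (EuclideanSpace ℝ (Fin d))}
    (he : e.MDifferentiable (𝓡 d) (𝓡 d)) (hx : x ∈ e.source) (v : TangentSpace (𝓡 d) x) :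
    coordEndo J e (e x) (toCoord e x v) = toCoord e x (J x v) := by
  -- The point `e.symm (e x)` equals `x` only propositionally, so the equality is transported by
  -- substitution, with the vector kept in the model space.
  have h1 : ∀ x', x' = x → ∀ a : EuclideanSpace ℝ (Fin d),
      toCoord e x' (J x' a) = toCoord e x (J x a) := by
    rintro x' rfl a
    rfl
  have h2 : (ofCoord e (e x) (toCoord e x v) : EuclideanSpace ℝ (Fin d)) = v :=
    congrArg (fun T : EuclideanSpace ℝ (Fin d) →L[ℝ] EuclideanSpace ℝ (Fin d) => T v)
      (he.symm_comp_deriv hx)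
  exact (h1 _ (e.left_inv hx) _).trans (congrArg (fun a => toCoord e x (J x a)) h2)

/-- The Gauss equation rewrites positivity of `K(S, JS)` as the inequality between products of `α`
that `KaehlerPoint.exists_isRegular` requires. The bound `N ≤ d + m` says that the normal space, of
dimension `N + 1 - d`, has dimension at most `m + 1`. -/
theorem exists_regular_of_sectionalCurvature_pos {K : KaehlerStructure d M}
    (hf : IsIsometricImmersion K.metric f) (x : M) (V : Submodule ℝ (TangentSpace (𝓡 d) x))
    (hVJ : ∀ S ∈ V, K.J x S ∈ V) {m : ℕ} (hVm : finrank ℝ V = 2 * m) (hm : N ≤ d + m)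
    (hK : ∀ S ∈ V, S ≠ 0 → 0 < sectionalCurvature K.metric x S (K.J x S)) :
    ∃ Z, HyperbolicKaehler.Regular (lorentzForm 0)
      (chartMap f (chartAt (EuclideanSpace ℝ (Fin d)) x))
      (chartEndo K.J (chartAt (EuclideanSpace ℝ (Fin d)) x))
      (chartAt (EuclideanSpace ℝ (Fin d)) x x) Z := by
  have H := hf.hyperbolicKaehler x
  have he := mdifferentiable_chartAt (d := d) x
  have hx : x ∈ (chartAt (EuclideanSpace ℝ (Fin d)) x).source := mem_chart_source _ x
  have hy : chartAt (EuclideanSpace ℝ (Fin d)) x x ∈ (chartAt (EuclideanSpace ℝ (Fin d)) x).target :=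
    mem_chart_target _ x
  have hJ : ∀ v, chartEndo K.J (chartAt (EuclideanSpace ℝ (Fin d)) x)
      (chartAt (EuclideanSpace ℝ (Fin d)) x x) (toCoord (chartAt (EuclideanSpace ℝ (Fin d)) x) x v)
      = toCoord (chartAt (EuclideanSpace ℝ (Fin d)) x) x (K.J x v) :=
    coordEndo_toCoord K.J he hx
  let D : TangentSpace (𝓡 d) x →ₗ[ℝ] EuclideanSpace ℝ (Fin d) :=
    { toFun := toCoord (chartAt (EuclideanSpace ℝ (Fin d)) x) x
      map_add' := map_add (mfderiv (𝓡 d) (𝓡 d) (chartAt (EuclideanSpace ℝ (Fin d)) x) x)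
      map_smul' := map_smul (mfderiv (𝓡 d) (𝓡 d) (chartAt (EuclideanSpace ℝ (Fin d)) x) x) }
  have hD : Function.Injective D := he.mfderiv_injective hx
  have hdim := H.finrank_normalSpace hy
  rw [finrank_euclideanSpace, Fintype.card_fin, Module.finrank_fintype_fun_eq_card,
    Fintype.card_fin] at hdim
  suffices h : ∃ Z, IsRegular _ (H.normalSff hy) Z from
    h.imp fun Z hZ => (H.isRegular_iff hy Z).1 hZ
  refine (H.kaehlerPoint hy).exists_isRegular (m := m) (V.map D) ?_ ?_ ?_ ?_
  · rintro _ ⟨S, hS, rfl⟩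
    exact ⟨K.J x S, hVJ S hS, (hJ S).symm⟩
  · rw [← (Submodule.equivMapOfInjective D hD V).finrank_eq]
    exact hVm
  · omega
  · rintro _ ⟨S, hS, rfl⟩ hS0
    have hS0' : S ≠ 0 := fun h => hS0 (by rw [h, map_zero])
    have h1 := hK S hS hS0'
    have h2 : K.metric.inner x S (K.J x S) = 0 := by
      have := K.inner_J_J x S (K.J x S)
      rw [K.J_J, map_neg, K.metric.symm] at this
      linarith
    have h3 := K.metric.pos x S hS0'
    unfold sectionalCurvature at h1
    rw [h2, K.inner_J_J] at h1
    -- `S` and `JS` are orthogonal of equal length, so the denominator is the fourth power of the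
    -- norm of `S`.
    have h4 := (div_pos_iff_of_pos_right (by nlinarith)).1 h1
    have h5 := hf.coordCurvature_eq hy (toCoord (chartAt (EuclideanSpace ℝ (Fin d)) x) x S)
      (toCoord (chartAt (EuclideanSpace ℝ (Fin d)) x) x (K.J x S))
      (toCoord (chartAt (EuclideanSpace ℝ (Fin d)) x) x (K.J x S))
      (toCoord (chartAt (EuclideanSpace ℝ (Fin d)) x) x S)
    have h6 := h4.trans_eq h5
    rw [sub_pos, ← hJ, H.sff_comm hy (chartEndo K.J _ _ _) (toCoord _ x S), H.symm (sff _ _ _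
      (chartEndo K.J _ _ _) _)] at h6
    exact h6

end ChartTranslation

/-! ### Propagation of the splitting over the connected manifold. -/

section Propagation

open Module Filter Topology

section Local

variable {E L : Type*} [NormedAddCommGroup E] [NormedSpace ℝ E] [FiniteDimensional ℝ E]
  [NormedAddCommGroup L] [NormedSpace ℝ L] [FiniteDimensional ℝ L]
  {β : L →L[ℝ] L →L[ℝ] ℝ} {F : E → L} {U : Set E} {J : E → E →L[ℝ] E} {y : E}

/-- A self-adjoint operator commutes with the tangent projection and the complex structure if and
only if it preserves the tangent space and is complex linear there. -/
theorem LocalKaehler.ad_eq_zero_iff (H : LocalKaehler β U F J) (hy : y ∈ U) {P : L →L[ℝ] L}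
    (hP : ∀ x z, β (P x) z = β x (P z)) :
    (ad P (tau β F y) = 0 ∧ ad P (Jhat β F J y) = 0) ↔
      ∀ u, ∃ v, P (fderiv ℝ F y u) = fderiv ℝ F y v ∧
        P (fderiv ℝ F y (J y u)) = fderiv ℝ F y (J y v) := by
  have had : ∀ T : L →L[ℝ] L, ad P T = 0 ↔ ∀ x, P (T x) = T (P x) := fun T => by
    rw [ad_apply, sub_eq_zero, ContinuousLinearMap.ext_iff]
    rfl
  rw [had, had]
  constructor
  · rintro ⟨h1, h2⟩ u
    refine ⟨rho β F y (P (fderiv ℝ F y u)), ?_, ?_⟩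
    · change _ = tau β F y _
      rw [← h1, H.tau_apply hy]
    · rw [← H.Jhat_apply hy, h2]
      rfl
  · intro h
    have ht : ∀ x, tau β F y (P (tau β F y x)) = P (tau β F y x) := by
      intro x
      obtain ⟨v, hv, -⟩ := h (rho β F y x)
      change tau β F y (P (fderiv ℝ F y (rho β F y x))) = P (fderiv ℝ F y (rho β F y x))
      rw [hv, H.tau_apply hy]
    have h1 : ∀ x, P (tau β F y x) = tau β F y (P x) := by
      intro x
      refine sub_eq_zero.1 (H.nondeg _ fun z => ?_)
      rw [map_sub, ContinuousLinearMap.sub_apply, ← ht x, H.beta_tau hy, hP, H.beta_tau hy, ht,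
        H.beta_tau hy, hP, sub_self]
    refine ⟨h1, fun x => ?_⟩
    obtain ⟨v, hv, hv'⟩ := h (rho β F y x)
    have hv2 : v = rho β F y (P x) := H.toLocalImmersion.injective_fderiv hy (by
      rw [← hv]
      exact h1 x)
    change P (fderiv ℝ F y (J y (rho β F y x))) = fderiv ℝ F y (J y (rho β F y (P x)))
    rw [hv', hv2]

theorem eq_zero_of_mem_closure {X Y : Type*} [TopologicalSpace X] [TopologicalSpace Y] [T2Space Y]
    [Zero Y] {φ : X → Y} {y : X} {O : Set X} (hφ : ContinuousAt φ y) (hO : ∀ z ∈ O, φ z = 0)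
    (hy : y ∈ closure O) : φ y = 0 := by
  have : (𝓝[O] y).NeBot := mem_closure_iff_nhdsWithin_neBot.1 hy
  refine tendsto_nhds_unique (hφ.tendsto.mono_left (nhdsWithin_le_nhds (s := O)))
    (tendsto_const_nhds.congr' ?_)
  filter_upwards [self_mem_nhdsWithin] with z hz
  exact (hO z hz).symm

/-- On an open set the commutator with `tau` can be differentiated, which gives the one with `dTau`;
all three then pass to the closure by continuity. -/
theorem LocalKaehler.ad_eq_zero_of_mem_closure (H : LocalKaehler β U F J) (hy : y ∈ U)
    {P : L →L[ℝ] L} {O : Set E} (hO : IsOpen O) (hOU : O ⊆ U) (hyO : y ∈ closure O)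
    (h : ∀ z ∈ O, ad P (tau β F z) = 0 ∧ ad P (Jhat β F J z) = 0) :
    ad P (tau β F y) = 0 ∧ (∀ v, ad P (dTau β F y v) = 0) ∧ ad P (Jhat β F J y) = 0 := by
  have hU := H.isOpen.mem_nhds hy
  have h2 : ∀ z ∈ O, ∀ v, ad P (dTau β F z v) = 0 := by
    intro z hz v
    have h3 : HasFDerivAt (fun z => ad P (tau β F z)) ((ad P).comp (dTau β F z)) z :=
      (ad P).hasFDerivAt.comp z (H.differentiableAt H.contDiffOn_tau (hOU hz)).hasFDerivAt
    have h4 : (fun z => ad P (tau β F z)) =ᶠ[𝓝 z] fun _ => 0 := by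
      filter_upwards [hO.mem_nhds hz] with w hw using (h w hw).1
    have h5 := h3.fderiv.symm.trans h4.fderiv_eq
    rw [fderiv_fun_const] at h5
    exact congrArg (fun T : E →L[ℝ] L →L[ℝ] L => T v) h5
  refine ⟨?_, fun v => ?_, ?_⟩
  · exact eq_zero_of_mem_closure (φ := fun z => ad P (tau β F z))
      ((ad P).continuous.continuousAt.comp (H.contDiffOn_tau.contDiffAt hU).continuousAt) (fun z hz => (h z hz).1) hyO
  · exact eq_zero_of_mem_closure (φ := fun z => ad P (dTau β F z v))
      ((ad P).continuous.continuousAt.comp ((H.contDiffOn_dTau.contDiffAt hU).continuousAt.clm_apply continuousAt_const))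
      (fun z hz => h2 z hz v) hyO
  · exact eq_zero_of_mem_closure (φ := fun z => ad P (Jhat β F J z))
      ((ad P).continuous.continuousAt.comp (H.contDiffOn_Jhat.contDiffAt hU).continuousAt) (fun z hz => (h z hz).2) hyO

end Local

variable {d N : ℕ} {M : Type*} [TopologicalSpace M] [ChartedSpace (EuclideanSpace ℝ (Fin d)) M]
  [IsManifold (𝓡 d) ∞ M] {K : KaehlerStructure d M} {f : M → HyperbolicSpace N}
  {κ : Type*} [Fintype κ] [DecidableEq κ]
  {P : κ → (Fin (N + 1) → ℝ) →L[ℝ] (Fin (N + 1) → ℝ)} {r : κ → ℝ}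

variable (K f P r) in
/-- At `x`, the decomposition `P` of the ambient space induces a decomposition of the tangent space
into complex subspaces, and `r j` is the square of the norm of the component `P j (f x)`. -/
def SplitsAt (x : M) : Prop :=
  ∀ j, (∀ u : TangentSpace (𝓡 d) x, ∃ v : TangentSpace (𝓡 d) x,
    P j (mfderiv (𝓡 d) 𝓘(ℝ, Fin (N + 1) → ℝ) (fun x => (f x : Fin (N + 1) → ℝ)) x u)
      = mfderiv (𝓡 d) 𝓘(ℝ, Fin (N + 1) → ℝ) (fun x => (f x : Fin (N + 1) → ℝ)) x v ∧
    P j (mfderiv (𝓡 d) 𝓘(ℝ, Fin (N + 1) → ℝ) (fun x => (f x : Fin (N + 1) → ℝ)) x (K.J x u))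
      = mfderiv (𝓡 d) 𝓘(ℝ, Fin (N + 1) → ℝ) (fun x => (f x : Fin (N + 1) → ℝ)) x (K.J x v)) ∧
    lorentzForm 0 (P j (f x)) (f x) = r j

/-- Links the commutators, which live in a chart, to a condition independent of charts, so that the
points where it holds form a subset of `M`. -/
theorem splitsAt_symm_iff (hf : IsIsometricImmersion K.metric f)
    (HP : OrthogonalSplitting (lorentzForm 0) P) {x : M} {y : EuclideanSpace ℝ (Fin d)}
    (hy : y ∈ (chartAt (EuclideanSpace ℝ (Fin d)) x).target) :
    SplitsAt K f P r ((chartAt (EuclideanSpace ℝ (Fin d)) x).symm y) ↔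
      ∀ j, ad (P j) (tau (lorentzForm 0) (chartMap f (chartAt (EuclideanSpace ℝ (Fin d)) x)) y) = 0 ∧
        ad (P j) (Jhat (lorentzForm 0) (chartMap f (chartAt (EuclideanSpace ℝ (Fin d)) x))
          (chartEndo K.J (chartAt (EuclideanSpace ℝ (Fin d)) x)) y) = 0 ∧
        lorentzForm 0 (P j (chartMap f (chartAt (EuclideanSpace ℝ (Fin d)) x) y))
          (chartMap f (chartAt (EuclideanSpace ℝ (Fin d)) x) y) = r j := by
  have H := hf.hyperbolicKaehler x
  have he := mdifferentiable_chartAt (d := d) x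
  refine forall_congr' fun j => ?_
  rw [← and_assoc, H.ad_eq_zero_iff hy (HP.symm j)]
  refine and_congr ?_ Iff.rfl
  have h1 : ∀ u, fderiv ℝ (chartMap f (chartAt (EuclideanSpace ℝ (Fin d)) x)) y
      (toCoord (chartAt (EuclideanSpace ℝ (Fin d)) x) _ u)
      = mfderiv (𝓡 d) 𝓘(ℝ, Fin (N + 1) → ℝ) (fun x => (f x : Fin (N + 1) → ℝ))
        ((chartAt (EuclideanSpace ℝ (Fin d)) x).symm y) u := by
    intro u
    rw [hf.fderiv_chartMap hy, ofCoord_toCoord he hy]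
  have h2 : ∀ u : TangentSpace (𝓡 d) ((chartAt (EuclideanSpace ℝ (Fin d)) x).symm y),
      chartEndo K.J (chartAt (EuclideanSpace ℝ (Fin d)) x) y
      (toCoord (chartAt (EuclideanSpace ℝ (Fin d)) x) _ u)
      = toCoord (chartAt (EuclideanSpace ℝ (Fin d)) x) _ (K.J _ u) := by
    intro u
    rw [chartEndo_apply, coordEndo, ofCoord_toCoord he hy]
  constructor
  · intro h u
    obtain ⟨v, hv, hv'⟩ := h (ofCoord (chartAt (EuclideanSpace ℝ (Fin d)) x) y u)
    refine ⟨toCoord (chartAt (EuclideanSpace ℝ (Fin d)) x) _ v, ?_, ?_⟩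
    · rw [h1, ← hv, ← h1, toCoord_ofCoord he hy]
    · rw [h2, h1, ← hv', ← h1, ← h2, toCoord_ofCoord he hy]
  · intro h u
    obtain ⟨v, hv, hv'⟩ := h (toCoord (chartAt (EuclideanSpace ℝ (Fin d)) x) _ u)
    rw [h1] at hv
    rw [h2, h1] at hv'
    refine ⟨ofCoord (chartAt (EuclideanSpace ℝ (Fin d)) x) y v, ?_, ?_⟩
    · rw [hv, ← h1, toCoord_ofCoord he hy]
    · rw [hv', ← h1, ← h2, toCoord_ofCoord he hy]

theorem eventually_splitsAt (hf : IsIsometricImmersion K.metric f)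
    (HP : OrthogonalSplitting (lorentzForm 0) P) (hd : d = 2 * Fintype.card κ)
    (hN : N + 1 = 3 * Fintype.card κ) {x : M}
    (h : ∀ j, ad (P j) (tau (lorentzForm 0) (chartMap f (chartAt (EuclideanSpace ℝ (Fin d)) x))
        (chartAt (EuclideanSpace ℝ (Fin d)) x x)) = 0 ∧
      (∀ v, ad (P j) (dTau (lorentzForm 0) (chartMap f (chartAt (EuclideanSpace ℝ (Fin d)) x))
        (chartAt (EuclideanSpace ℝ (Fin d)) x x) v) = 0) ∧
      ad (P j) (Jhat (lorentzForm 0) (chartMap f (chartAt (EuclideanSpace ℝ (Fin d)) x))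
        (chartEndo K.J (chartAt (EuclideanSpace ℝ (Fin d)) x))
        (chartAt (EuclideanSpace ℝ (Fin d)) x x)) = 0)
    (hr : ∀ j, lorentzForm 0 (P j (f x)) (f x) = r j) :
    ∀ᶠ z in 𝓝 x, SplitsAt K f P r z := by
  have hx : x ∈ (chartAt (EuclideanSpace ℝ (Fin d)) x).source := mem_chart_source _ x
  have hy : chartAt (EuclideanSpace ℝ (Fin d)) x x ∈ (chartAt (EuclideanSpace ℝ (Fin d)) x).target :=
    mem_chart_target _ x
  have h1 := (hf.hyperbolicKaehler x).eventually_split hy HP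
    (by rw [finrank_euclideanSpace, Fintype.card_fin, hd])
    (by rw [Module.finrank_fintype_fun_eq_card, Fintype.card_fin, hN])
    (fun j => (h j).1) (fun j v => (h j).2.1 v) (fun j => (h j).2.2)
  filter_upwards [((chartAt (EuclideanSpace ℝ (Fin d)) x).continuousAt hx).eventually h1,
    (chartAt (EuclideanSpace ℝ (Fin d)) x).open_source.mem_nhds hx] with z hz hz'
  rw [← (chartAt (EuclideanSpace ℝ (Fin d)) x).left_inv hz', splitsAt_symm_iff hf HP
    ((chartAt (EuclideanSpace ℝ (Fin d)) x).map_source hz')]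
  intro j
  refine ⟨(hz j).1, (hz j).2.1, (hz j).2.2.trans ?_⟩
  rw [← hr j]
  simp only [chartMap, (chartAt (EuclideanSpace ℝ (Fin d)) x).left_inv hx]

/-- The interior of the set of splitting points is closed: at a limit point the commutators with
`tau`, `dTau` and `Jhat` vanish, and this alone restarts the local propagation. -/
theorem splitsAt_of_eventually [ConnectedSpace M] (hf : IsIsometricImmersion K.metric f)
    (HP : OrthogonalSplitting (lorentzForm 0) P) (hd : d = 2 * Fintype.card κ)
    (hN : N + 1 = 3 * Fintype.card κ) {x₀ : M} (hx₀ : ∀ᶠ z in 𝓝 x₀, SplitsAt K f P r z) (x : M) :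
    SplitsAt K f P r x := by
  have hclosed : IsClosed (interior {z | SplitsAt K f P r z}) := by
    refine isClosed_of_closure_subset fun x hx => ?_
    have hxs : x ∈ (chartAt (EuclideanSpace ℝ (Fin d)) x).source := mem_chart_source _ x
    have hy : chartAt (EuclideanSpace ℝ (Fin d)) x x
      ∈ (chartAt (EuclideanSpace ℝ (Fin d)) x).target := mem_chart_target _ x
    have H := hf.hyperbolicKaehler x
    let S : Set M := (chartAt (EuclideanSpace ℝ (Fin d)) x).source ∩ interior {z | SplitsAt K f P r z}
    have hS : IsOpen S := (chartAt (EuclideanSpace ℝ (Fin d)) x).open_source.inter isOpen_interior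
    have hxS : x ∈ closure S :=
      (chartAt (EuclideanSpace ℝ (Fin d)) x).open_source.inter_closure ⟨hxs, hx⟩
    let O := (chartAt (EuclideanSpace ℝ (Fin d)) x) '' S
    have hO : IsOpen O :=
      (chartAt (EuclideanSpace ℝ (Fin d)) x).isOpen_image_of_subset_source hS Set.inter_subset_left
    have hOU : O ⊆ (chartAt (EuclideanSpace ℝ (Fin d)) x).target := by
      rintro _ ⟨z, hz, rfl⟩
      exact (chartAt (EuclideanSpace ℝ (Fin d)) x).map_source hz.1
    have hyO : chartAt (EuclideanSpace ℝ (Fin d)) x x ∈ closure O :=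
      mem_closure_image ((chartAt (EuclideanSpace ℝ (Fin d)) x).continuousAt hxs) hxS
    have hsplit : ∀ z ∈ O, SplitsAt K f P r ((chartAt (EuclideanSpace ℝ (Fin d)) x).symm z) := by
      rintro _ ⟨z, hz, rfl⟩
      rw [(chartAt (EuclideanSpace ℝ (Fin d)) x).left_inv hz.1]
      exact interior_subset hz.2
    have hsplit' := fun z hz => (splitsAt_symm_iff hf HP (hOU hz)).1 (hsplit z hz)
    refine mem_interior_iff_mem_nhds.2 (eventually_splitsAt hf HP hd hN (fun j => ?_) fun j => ?_)
    · exact H.ad_eq_zero_of_mem_closure hy hO hOU hyO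
        fun z hz => ⟨(hsplit' z hz j).1, (hsplit' z hz j).2.1⟩
    · have hc : ContinuousAt (fun z => lorentzForm 0 (P j (f z)) (f z) - r j) x := by
        have hfc : ContinuousAt (fun z => (f z : Fin (N + 1) → ℝ)) x :=
          hf.contMDiff.continuous.continuousAt
        exact ((((lorentzForm 0).continuous.continuousAt.comp
          ((P j).continuous.continuousAt.comp hfc))).clm_apply hfc).sub continuousAt_const
      exact sub_eq_zero.1 (eq_zero_of_mem_closure
        (φ := fun z => lorentzForm 0 (P j (f z)) (f z) - r j) hc
        (fun z hz => sub_eq_zero.2 (interior_subset hz j).2) hx)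
  have hclopen : IsClopen (interior {z | SplitsAt K f P r z}) := ⟨hclosed, isOpen_interior⟩
  have huniv := hclopen.eq_univ ⟨x₀, mem_interior_iff_mem_nhds.2 hx₀⟩
  exact interior_subset (huniv ▸ Set.mem_univ x)

end Propagation

/-! ### Openness in the extrinsic product and the linear isometry. -/

section Product

open Module Filter Topology

variable {E L : Type*} [NormedAddCommGroup E] [NormedSpace ℝ E] [FiniteDimensional ℝ E]
  [NormedAddCommGroup L] [NormedSpace ℝ L] [FiniteDimensional ℝ L]
  {β : L →L[ℝ] L →L[ℝ] ℝ} {F : E → L} {U : Set E} {J : E → E →L[ℝ] E} {y : E}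

/-- The image of an immersion compatible with a splitting is a neighbourhood of each of its points
within the set of vectors whose components have prescribed norms. -/
theorem HyperbolicKaehler.eventually_mem_image {κ : Type*} [Fintype κ] [DecidableEq κ]
    {P : κ → L →L[ℝ] L} {r : κ → ℝ} (H : HyperbolicKaehler β U F J) (hy : y ∈ U)
    (HP : OrthogonalSplitting β P) (hr : ∀ j, r j ≠ 0)
    (hdim : finrank ℝ L = finrank ℝ E + Fintype.card κ) (h1 : ∀ j, ad (P j) (tau β F y) = 0)
    (hF : ∀ z ∈ U, ∀ j, β (P j (F z)) (F z) = r j) :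
    ∀ᶠ w in 𝓝 (F y), (∀ j, β (P j w) w = r j) → w ∈ F '' U := by
  have hPP : ∀ i x, P i (P i x) = P i x := fun i x =>
    congrArg (fun S : L →L[ℝ] L => S x) (HP.mul_self i)
  have hPne : ∀ i j x, i ≠ j → P i (P j x) = 0 := fun i j x hij =>
    congrArg (fun S : L →L[ℝ] L => S x) (HP.mul_ne i j hij)
  have hPsum : ∀ (j : κ) (s : κ → ℝ) x, P j (∑ i, s i • P i x) = s j • P j x := by
    intro j s x
    rw [map_sum, Finset.sum_eq_single j (fun i _ hi => by rw [map_smul, hPne j i x hi.symm, smul_zero])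
      (by simp), map_smul, hPP]
  -- The image of `F` is thickened by rescaling each component: `Ψ (z, s)` has components `(1 + s j)
  -- P j (F z)`. It is a local diffeomorphism, so nearby vectors have this form.
  let Ψ : E × (κ → ℝ) → L := fun q => F q.1 + ∑ j, q.2 j • P j (F q.1)
  let D : E × (κ → ℝ) →L[ℝ] L := (fderiv ℝ F y).comp (ContinuousLinearMap.fst ℝ E (κ → ℝ))
    + ∑ j, ((ContinuousLinearMap.proj j).comp (ContinuousLinearMap.snd ℝ E (κ → ℝ))).smulRight
      (P j (F y))
  have hD_apply : ∀ u t, D (u, t) = fderiv ℝ F y u + ∑ j, t j • P j (F y) := by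
    intro u t
    simp [D]
  have hΨ : HasStrictFDerivAt Ψ D (y, 0) := by
    have hF' : HasStrictFDerivAt F (fderiv ℝ F y) y :=
      (H.smooth.contDiffAt (H.isOpen.mem_nhds hy)).hasStrictFDerivAt (by simp)
    have hF1 : HasStrictFDerivAt (fun q : E × (κ → ℝ) => F q.1)
        ((fderiv ℝ F y).comp (ContinuousLinearMap.fst ℝ E (κ → ℝ))) (y, 0) :=
      HasStrictFDerivAt.comp (y, (0 : κ → ℝ)) hF' hasStrictFDerivAt_fst
    have hs : ∀ j, HasStrictFDerivAt (fun q : E × (κ → ℝ) => q.2 j)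
        ((ContinuousLinearMap.proj j).comp (ContinuousLinearMap.snd ℝ E (κ → ℝ))) (y, 0) := fun j =>
      ((ContinuousLinearMap.proj (R := ℝ) (φ := fun _ : κ => ℝ) j).comp
        (ContinuousLinearMap.snd ℝ E (κ → ℝ))).hasStrictFDerivAt
    have h2 := hF1.add (HasStrictFDerivAt.fun_sum (u := Finset.univ) fun j _ =>
      (hs j).smul ((P j).hasStrictFDerivAt.comp (y, (0 : κ → ℝ)) hF1))
    refine h2.congr_fderiv ?_
    refine ContinuousLinearMap.ext fun ⟨u, t⟩ => ?_
    rw [hD_apply]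
    simp
  have hinj : Function.Injective D := by
    refine (injective_iff_map_eq_zero D).2 ?_
    rintro ⟨u, t⟩ hut
    rw [hD_apply] at hut
    -- The components of the position vector are normal, so the two parts of `D` are independent.
    have ht : ∀ j, tau β F y (P j (F y)) = 0 := fun j => by
      have h3 : P j (tau β F y (F y)) = tau β F y (P j (F y)) :=
        congrArg (fun S : L →L[ℝ] L => S (F y)) (sub_eq_zero.1 (h1 j))
      rw [← h3, H.tau_self hy, map_zero]
    have hu : fderiv ℝ F y u = 0 := by
      have := congrArg (tau β F y) hut
      simpa only [map_add, map_sum, map_smul, ht, smul_zero, Finset.sum_const_zero, add_zero,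
        H.tau_apply hy, map_zero] using this
    rw [hu, zero_add] at hut
    refine Prod.ext (H.injective_fderiv hy (hu.trans (map_zero _).symm)) (funext fun j => ?_)
    have h3 := hPsum j t (F y)
    rw [hut, map_zero] at h3
    refine (smul_eq_zero.1 h3.symm).resolve_right fun h => hr j ?_
    rw [← hF y hy j, h, map_zero, ContinuousLinearMap.zero_apply]
  have hsurj : D.range = ⊤ := by
    refine LinearMap.range_eq_top.2 ((LinearMap.injective_iff_surjective_of_finrank_eq_finrank ?_).1
      hinj)
    rw [finrank_prod, finrank_fintype_fun_eq_card, hdim]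
  have hmap := hΨ.map_nhds_eq_of_surj hsurj
  have hΨ0 : Ψ (y, 0) = F y := by simp [Ψ]
  rw [hΨ0] at hmap
  have hnhds : {q : E × (κ → ℝ) | q.1 ∈ U ∧ ∀ j, -1 < q.2 j} ∈ 𝓝 (y, (0 : κ → ℝ)) := by
    have n1 : ∀ᶠ q : E × (κ → ℝ) in 𝓝 (y, 0), q.1 ∈ U :=
      continuousAt_fst.eventually (H.isOpen.mem_nhds hy)
    have n2 : ∀ j, ∀ᶠ q : E × (κ → ℝ) in 𝓝 (y, 0), -1 < q.2 j := fun j => by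
      have hc : ContinuousAt (fun q : E × (κ → ℝ) => q.2 j) (y, 0) := by fun_prop
      exact hc.eventually (lt_mem_nhds (by simp))
    exact n1.and (eventually_all.2 n2)
  rw [← hmap]
  filter_upwards [image_mem_map hnhds]
  rintro _ ⟨⟨z, s⟩, ⟨hz, hs⟩, rfl⟩ hw
  -- The prescribed norms give `(1 + s j)² = 1`, and `-1 < s j` excludes the root `-2`.
  have hs0 : s = 0 := by
    ext j
    have h4 := hw j
    have h5 : P j (Ψ (z, s)) = (1 + s j) • P j (F z) := by
      simp only [Ψ]
      rw [map_add, hPsum, add_smul, one_smul]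
    have h6 : β (P j (Ψ (z, s))) (Ψ (z, s)) = (1 + s j) ^ 2 * r j := by
      rw [← hPP, HP.symm, h5, map_smul, map_smul, ContinuousLinearMap.smul_apply, HP.symm, hPP,
        H.symm, hF z hz j, smul_eq_mul, smul_eq_mul]
      ring
    rw [h6] at h4
    have h7 : (1 + s j) ^ 2 = 1 := mul_right_cancel₀ (hr j) (h4.trans (one_mul _).symm)
    have h8 := hs j
    simp only [Pi.zero_apply]
    nlinarith
  subst hs0
  exact ⟨z, hz, by simp [Ψ]⟩

variable {p : ℕ} {b : Fin (p + 1) × Fin 3 → L}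

theorem beta_self_ne_zero (hn : ∀ a, β (b a) (b a) = if a = (0, 0) then -1 else 1)
    (a : Fin (p + 1) × Fin 3) : β (b a) (b a) ≠ 0 := by
  rw [hn]
  split_ifs <;> norm_num

/-- The linear isomorphism given by a Lorentzian orthonormal frame. -/
def frameEquiv (ho : ∀ a a', a ≠ a' → β (b a) (b a') = 0)
    (hn : ∀ a, β (b a) (b a) = if a = (0, 0) then -1 else 1)
    (hcard : Fintype.card (Fin (p + 1) × Fin 3) = finrank ℝ L) :
    (Fin (p + 1) × Fin 3 → ℝ) ≃ₗ[ℝ] L :=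
  (basisOfLinearIndependentOfCardEqFinrank
    (linearIndependent_of_orthogonal ho (beta_self_ne_zero hn)) hcard).equivFun.symm

variable (ho : ∀ a a', a ≠ a' → β (b a) (b a') = 0)
  (hn : ∀ a, β (b a) (b a) = if a = (0, 0) then -1 else 1)
  (hcard : Fintype.card (Fin (p + 1) × Fin 3) = finrank ℝ L)

theorem frameEquiv_apply (x : Fin (p + 1) × Fin 3 → ℝ) :
    frameEquiv ho hn hcard x = ∑ a, x a • b a := by
  simp [frameEquiv, Basis.equivFun_symm_apply]

theorem frameEquiv_single (a : Fin (p + 1) × Fin 3) :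
    frameEquiv ho hn hcard (Pi.single a 1) = b a := by
  rw [frameEquiv_apply, Finset.sum_eq_single a (fun c _ hc => by simp [hc]) (by simp)]
  simp

theorem beta_frameEquiv (x : Fin (p + 1) × Fin 3 → ℝ) (a : Fin (p + 1) × Fin 3) :
    β (frameEquiv ho hn hcard x) (b a) = (if a = (0, 0) then -1 else 1) * x a := by
  rw [frameEquiv_apply, map_sum, ContinuousLinearMap.sum_apply,
    Finset.sum_eq_single a (fun c _ hc => by simp [ho c a hc]) (by simp), map_smul,
    ContinuousLinearMap.smul_apply, hn, smul_eq_mul, mul_comm]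

theorem beta_frameEquiv_frameEquiv (x z : Fin (p + 1) × Fin 3 → ℝ) :
    β (frameEquiv ho hn hcard x) (frameEquiv ho hn hcard z) = lorentz (0, 0) x z := by
  rw [frameEquiv_apply ho hn hcard z, map_sum, lorentz]
  refine Finset.sum_congr rfl fun a _ => ?_
  rw [map_smul, beta_frameEquiv, smul_eq_mul]
  ring

theorem beta_blockProj_frameEquiv (hs : ∀ x z, β x z = β z x) (x : Fin (p + 1) × Fin 3 → ℝ)
    (j : Fin (p + 1)) :
    β (blockProj β b j (frameEquiv ho hn hcard x)) (frameEquiv ho hn hcard x)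
      = ∑ k, (if (j, k) = ((0, 0) : Fin (p + 1) × Fin 3) then -1 else 1) * (x (j, k) * x (j, k)) := by
  rw [blockProj_apply, map_sum, ContinuousLinearMap.sum_apply]
  refine Finset.sum_congr rfl fun k _ => ?_
  rw [map_smul, ContinuousLinearMap.smul_apply, hs (b (j, k)) (frameEquiv ho hn hcard x),
    beta_frameEquiv, hn, smul_eq_mul]
  split_ifs <;> ring

/-- The extrinsic product in terms of the norms of the components. -/
theorem mem_extrinsicProduct_iff (hs : ∀ x z, β x z = β z x) (c : Fin (p + 1) → ℝ)
    (x : Fin (p + 1) × Fin 3 → ℝ) :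
    x ∈ extrinsicProduct p c ↔ (∀ j, β (blockProj β b j (frameEquiv ho hn hcard x))
      (frameEquiv ho hn hcard x) = 1 / c j) ∧ 0 < x (0, 0) := by
  have h0 : lorentz 0 (fun i => x (0, i)) (fun i => x (0, i))
      = β (blockProj β b 0 (frameEquiv ho hn hcard x)) (frameEquiv ho hn hcard x) := by
    rw [beta_blockProj_frameEquiv ho hn hcard hs, lorentz]
    simp
  have hj : ∀ j, j ≠ 0 → ∑ i, x (j, i) ^ 2
      = β (blockProj β b j (frameEquiv ho hn hcard x)) (frameEquiv ho hn hcard x) := by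
    intro j hj
    rw [beta_blockProj_frameEquiv ho hn hcard hs]
    simp [hj, sq]
  constructor
  · rintro ⟨⟨h1, h2⟩, h3⟩
    refine ⟨fun j => ?_, h2⟩
    by_cases hj0 : j = 0
    · subst hj0
      rw [← h0]
      exact h1
    · rw [← hj j hj0]
      exact h3 j hj0
  · rintro ⟨h1, h2⟩
    exact ⟨⟨h0.trans (h1 0), h2⟩, fun j hj0 => (hj j hj0).trans (h1 j)⟩

theorem AdaptedFrame.beta_blockProj_self (hb : AdaptedFrame β F J y b)
    (hs : ∀ x z, β x z = β z x) (j : Fin (p + 1)) :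
    β (blockProj β b j (F y)) (F y) = (if j = 0 then -1 else 1) * β (b (j, 0)) (F y) ^ 2 := by
  rw [blockProj_apply, map_sum, ContinuousLinearMap.sum_apply, Finset.sum_eq_single 0
    (fun k _ hk => by simp [hb.beta_self_eq_zero j k hk]) (by simp), map_smul,
    ContinuousLinearMap.smul_apply, hs (F y), hb.norm_eq, smul_eq_mul]
  by_cases hj : j = 0
  · simp [hj, sq, div_neg]
  · simp [hj, sq]

end Product

end KaehlerHyperbolic

end

/-! ### The main theorem. -/

theorem theorem1 {n p m : ℕ} (hp : p + 1 ≤ n)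
    {M : Type*} [TopologicalSpace M] [T2Space M] [SecondCountableTopology M] [ConnectedSpace M]
    [ChartedSpace (EuclideanSpace ℝ (Fin (2 * n))) M] [IsManifold (𝓡 (2 * n)) ∞ M]
    (K : KaehlerHyperbolic.KaehlerStructure (2 * n) M)
    (f : M → KaehlerHyperbolic.HyperbolicSpace (2 * n + p))
    (hf : KaehlerHyperbolic.IsIsometricImmersion K.metric f)
    (x₀ : M) (V : Submodule ℝ (TangentSpace (𝓡 (2 * n)) x₀))
    (hVJ : ∀ S ∈ V, K.J x₀ S ∈ V) (hVm : Module.finrank ℝ V = 2 * m) (hm : p ≤ m)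
    (hK : ∀ S ∈ V, S ≠ 0 →
      0 < KaehlerHyperbolic.sectionalCurvature K.metric x₀ S (K.J x₀ S)) :
    n = p + 1 ∧
    ∃ c : Fin (p + 1) → ℝ, c 0 < 0 ∧ (∀ j, j ≠ 0 → 0 < c j) ∧ ∑ j, 1 / c j = -1 ∧
      -- the identification of `𝕃³ × ℝ³ × ⋯ × ℝ³` with `𝕃^{2n+p+1} = 𝕃^{3n}`
      ∃ Φ : (Fin (p + 1) × Fin 3 → ℝ) ≃ₗ[ℝ] (Fin (2 * n + p + 1) → ℝ),
        (∀ x y, KaehlerHyperbolic.lorentz 0 (Φ x) (Φ y)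
          = KaehlerHyperbolic.lorentz (0, 0) x y) ∧
        Φ '' KaehlerHyperbolic.hyperboloid (0, 0) (-1)
          = KaehlerHyperbolic.HyperbolicSpace (2 * n + p) ∧
        ∃ O : Set (Fin (2 * n + p + 1) → ℝ), IsOpen O ∧
          Set.range (fun x => (f x : Fin (2 * n + p + 1) → ℝ))
            = O ∩ Φ '' KaehlerHyperbolic.extrinsicProduct p c := by
  open KaehlerHyperbolic Filter Topology in
  have H := hf.hyperbolicKaehler x₀
  have hy₀ : chartAt (EuclideanSpace ℝ (Fin (2 * n))) x₀ x₀
      ∈ (chartAt (EuclideanSpace ℝ (Fin (2 * n))) x₀).target := mem_chart_target _ x₀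
  have hfx : ∀ x, chartMap f (chartAt (EuclideanSpace ℝ (Fin (2 * n))) x)
      (chartAt (EuclideanSpace ℝ (Fin (2 * n))) x x) = f x := fun x => by
    simp only [chartMap, (chartAt (EuclideanSpace ℝ (Fin (2 * n))) x).left_inv (mem_chart_source _ x)]
  obtain ⟨Z, hZ⟩ := exists_regular_of_sectionalCurvature_pos hf x₀ V hVJ hVm (by omega) hK
  have hE : Module.finrank ℝ (EuclideanSpace ℝ (Fin (2 * n))) = 2 * n := by
    rw [finrank_euclideanSpace, Fintype.card_fin]
  have hL : Module.finrank ℝ (Fin (2 * n + p + 1) → ℝ) = 2 * n + p + 1 := by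
    rw [Module.finrank_fintype_fun_eq_card, Fintype.card_fin]
  obtain ⟨hdim, b, hb⟩ := H.exists_adaptedFrame hy₀ (p := p) (by omega) (by omega) hZ
  have hn : n = p + 1 := by omega
  have hcard : Fintype.card (Fin (p + 1) × Fin 3)
      = Module.finrank ℝ (Fin (2 * n + p + 1) → ℝ) := by
    rw [Fintype.card_prod, Fintype.card_fin, Fintype.card_fin]
    omega
  have HP := orthogonalSplitting_blockProj H.symm hb.orthogonal (beta_self_ne_zero hb.norm_eq) hcard
  have hr := hb.beta_blockProj_self H.symm
  have hbneg := hb.beta_self_neg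
  rw [hfx] at hr hbneg
  set P := blockProj (lorentzForm 0) b
  -- `r j` is the squared norm of the `j`-th component of `f x₀`, so the curvature of the `j`-th
  -- factor is `c j = 1 / r j`. These numbers add up to `⟨f x₀, f x₀⟩ = -1`.
  set r : Fin (p + 1) → ℝ := fun j => lorentzForm 0 (P j (f x₀)) (f x₀) with hr_def
  have hr0 : r 0 < 0 := by
    have h1 := hbneg 0
    have h2 : r 0 = _ := hr 0
    rw [h2, if_pos rfl]
    nlinarith
  have hrpos : ∀ j, j ≠ 0 → 0 < r j := by
    intro j hj
    have h1 := hbneg j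
    have h2 : r j = _ := hr j
    rw [h2, if_neg hj]
    nlinarith
  have hrne : ∀ j, r j ≠ 0 := fun j => by
    by_cases hj : j = 0
    · subst hj
      exact hr0.ne
    · exact (hrpos j hj).ne'
  have hsplit : ∀ x, SplitsAt K f P r x := by
    refine splitsAt_of_eventually (x₀ := x₀) hf HP ?_ ?_ (eventually_splitsAt hf HP ?_ ?_
      (fun j => ⟨hb.ad_tau j, hb.ad_dTau j, hb.ad_Jhat j⟩) fun j => rfl)
    all_goals
      rw [Fintype.card_fin]
      omega
  have hcr : ∀ j, 1 / (1 / r j) = r j := fun j => one_div_one_div _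
  have hfneg : ∀ x, lorentz 0 (f x : Fin (2 * n + p + 1) → ℝ) (f x) < 0 := fun x => by
    rw [(f x).2.1]
    norm_num
  have hb00 : lorentz 0 (b (0, 0)) (b (0, 0)) < 0 := by
    have h1 : lorentz 0 (b (0, 0)) (b (0, 0)) = _ := hb.norm_eq (0, 0)
    rw [h1, if_pos rfl]
    norm_num
  -- The product of `b (0, 0)` with the position vector is negative, so `b (0, 0)` is
  -- future-directed; hence the isometry preserves the upper sheets.
  have hbpos : 0 < b (0, 0) 0 :=
    (pos_iff_lorentz_neg hb00 (hfneg x₀) (f x₀).2.2).2 (hbneg 0)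
  refine ⟨hn, fun j => 1 / r j, one_div_neg.2 hr0, fun j hj => one_div_pos.2 (hrpos j hj), ?_,
    frameEquiv hb.orthogonal hb.norm_eq hcard,
    beta_frameEquiv_frameEquiv hb.orthogonal hb.norm_eq hcard,
    image_hyperboloid _ (beta_frameEquiv_frameEquiv hb.orthogonal hb.norm_eq hcard)
      (by rwa [frameEquiv_single]) (by norm_num), ?_⟩
  · simp only [one_div_one_div, hr_def]
    rw [← ContinuousLinearMap.sum_apply, ← map_sum, HP.sum_eq, lorentzForm_apply, (f x₀).2.1]
    norm_num
  have hrange : ∀ x, (f x : Fin (2 * n + p + 1) → ℝ) ∈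
      frameEquiv hb.orthogonal hb.norm_eq hcard '' extrinsicProduct p fun j => 1 / r j := by
    intro x
    obtain ⟨ξ, hξ⟩ := (frameEquiv hb.orthogonal hb.norm_eq hcard).surjective (f x)
    refine ⟨ξ, (mem_extrinsicProduct_iff hb.orthogonal hb.norm_eq hcard H.symm _ ξ).2 ⟨?_, ?_⟩, hξ⟩
    · intro j
      rw [hξ, hcr]
      exact (hsplit x j).2
    · have h1 := beta_frameEquiv hb.orthogonal hb.norm_eq hcard ξ (0, 0)
      rw [hξ, if_pos rfl] at h1
      have h2 : lorentzForm 0 (f x : Fin (2 * n + p + 1) → ℝ) (b (0, 0)) < 0 :=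
        (pos_iff_lorentz_neg (hfneg x) hb00 hbpos).1 (f x).2.2
      linarith
  have hnhds : ∀ x, ∀ᶠ w in 𝓝 (f x : Fin (2 * n + p + 1) → ℝ),
      (∀ j, lorentzForm 0 (P j w) w = r j) →
        w ∈ Set.range fun x => (f x : Fin (2 * n + p + 1) → ℝ) := by
    intro x
    have hx : chartAt (EuclideanSpace ℝ (Fin (2 * n))) x x
        ∈ (chartAt (EuclideanSpace ℝ (Fin (2 * n))) x).target := mem_chart_target _ x
    have hs := fun y hy => (splitsAt_symm_iff (x := x) (y := y) hf HP hy).1 (hsplit _)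
    have h1 := (hf.hyperbolicKaehler x).eventually_mem_image (r := r) hx HP hrne
      (by rw [hE, hL, Fintype.card_fin]; omega) (fun j => (hs _ hx j).1)
      fun y hy j => (hs y hy j).2.2
    rw [hfx] at h1
    filter_upwards [h1] with w hw hwr
    obtain ⟨y, -, rfl⟩ := hw hwr
    exact ⟨_, rfl⟩
  -- Within each `O x`, the vectors whose components have the prescribed norms already belong to the
  -- image; the union of these sets exhibits the image as relatively open.
  choose O hO hOo hxO using fun x => eventually_nhds_iff.1 (hnhds x)
  refine ⟨⋃ x, O x, isOpen_iUnion hOo, Set.Subset.antisymm ?_ ?_⟩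
  · rintro _ ⟨x, rfl⟩
    exact ⟨Set.mem_iUnion.2 ⟨x, hxO x⟩, hrange x⟩
  · rintro _ ⟨hw, ξ, hξ, rfl⟩
    obtain ⟨x, hx⟩ := Set.mem_iUnion.1 hw
    refine hO x _ hx fun j => ?_
    rw [← hcr j]
    exact ((mem_extrinsicProduct_iff hb.orthogonal hb.norm_eq hcard H.symm _ ξ).1 hξ).1 j
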